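/- \textbf{Setting.} Let $d\in\mathbb N$, $d\ge1$, $a\in\{1,-1\}$, $\gamma>-\min(2,d)$ and $\alpha>1+\frac{2+\gamma}{d}$; put $\frac1{q_c}=\frac{2+\gamma}{d(\alpha-1)}$. For $k\in\mathbb R$, $p\in[1,\infty]$ let $\|f\|_{L^{p,\infty}_k}=\big\||\cdot|^kf\big\|_{L^{p,\infty}(\mathbb R^d)}$, where $\|g\|_{L^{p,\infty}}=\sup_{s>0}s^{1/p}g^*(s)$ and $g^*(s)=\inf\{\mu>0:|\{|g|>\mu\}|\le s\}$, and for functions $u$ on $(0,\infty)\times\mathbb R^d$ and $\sigma\in\mathbb R$ let $$\|u\|_{\sigma;k,p}=\sup_{t>0}t^{\frac d2(\frac\sigma d-\frac kd-\frac1p)}\|u(t)\|_{L^{p,\infty}_k},\qquad \|u\|_{\mathcal K^p_k}=\|u\|_{\frac{2+\gamma}{\alpha-1};k,p}.$$ Let $e^{t\Delta}$ be the heat semigroup with kernel $G_t(x)=(4\pi t)^{-d/2}e^{-|x|^2/(4t)}$, acting on $\varphi\in\mathcal S'(\mathbb R^d)$ by $(e^{t\Delta}\varphi)(x)=\langle\varphi,G_t(x-\cdot)\rangle$.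 Consider the Hardy-Hénon equation in the form $$u(t)=e^{t\Delta}\varphi+a\int_0^te^{(t-\tau)\Delta}\big(|\cdot|^\gamma|u(\tau)|^{\alpha-1}u(\tau)\big)\,d\tau\quad\text{for all }t>0,\ \text{a.e. on }\mathbb R^d.\tag{1}$$ \textbf{Exponents.} Let $l\in\mathbb R$, $q\in[1,\infty]$ with $\frac ld+\frac1q=\frac1{q_c}$, $\frac\gamma{\alpha-1}\le l$. Let $k\in\mathbb R$ and $p\in[1,\infty]$ satisfy $\alpha<p\le\infty$, $\frac{l+\gamma}\alpha\le k\le l$, $0\le\frac kd+\frac1p$ and $\frac{2+\gamma\alpha}{d\alpha(\alpha-1)}<\frac kd+\frac1p<\min\{\frac1{q_c},\frac{d+\gamma}{d\alpha}\}$. Let $\frac{2+\gamma}{\alpha-1}\le\sigma_j<d$, $j=1,2$. For $\sigma\in\mathbb R$, a pair $(k_0,p_0)\in\mathbb R\times[1,\infty]$ is called $\sigma$-admissible if $0\le\frac{k_0}d+\frac1{p_0}$, $0\le\frac{\alpha-1}p+\frac1{p_0}<1$, $\frac\sigma d<(\alpha-1)(\frac kd+\frac1p)+\frac{k_0}d+\frac1{p_0}-\frac\gamma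 d<1$, and, in case $\alpha>3$ and $\frac kd+\frac1p<\frac{k_0}d+\frac1{p_0}$, also $(\alpha-2)(\frac kd+\frac1p)+(\frac{k_0}d+\frac1{p_0})<\frac{2+\gamma}d$. Let $(k_0,p_0)\in\mathbb R\times[1,\infty]$. \textbf{Data and solutions.} For $j=1,2$ let $\omega_j\in L^\infty(\mathbb R^d)$ be real-valued and homogeneous of degree $0$, and $\Phi_{\sigma_j}(x)=\omega_j(x)|x|^{-\sigma_j}$. Let $\varphi=\varphi_1+i\varphi_2\in\mathcal S'(\mathbb R^d)$ with $\varphi_1,\varphi_2$ real and $\varphi\ne0$. Assume that $\|\omega_1\|_{L^\infty}$, $\|\omega_2\|_{L^\infty}$ and $\|e^{t\Delta}\varphi\|_{\mathcal K^p_k}$ are at most some sufficiently small $\varepsilon>0$, which depends only on $d,a,\gamma,\alpha,l,q,k,p,\sigma_1,\sigma_2,k_0,p_0$. Let $u=u_1+iu_2$ be the global solution of (1) with $\|u\|_{\mathcal K^p_k}\le2\|e^{t\Delta}\varphi\|_{\mathcal K^p_k}$. Let $u_{j\mathcal S}$ be the global real self-similar solution of (1) with initial data $\Phi=\omega_j|x|^{-\frac{2+\gamma}{\alpha-1}}$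 and $\|u_{j\mathcal S}\|_{\mathcal K^p_k}\le2\|e^{t\Delta}\Phi\|_{\mathcal K^p_k}$; self-similar means $\lambda^{\frac{2+\gamma}{\alpha-1}}u_{j\mathcal S}(\lambda^2t,\lambda x)=u_{j\mathcal S}(t,x)$ for all $\lambda>0$. Let $z_2$ and $w_1$ be the global real solutions of $$z_2(t)=e^{t\Delta}\Phi_{\sigma_2}+a\int_0^te^{(t-\tau)\Delta}\big(|\cdot|^\gamma|u_{1\mathcal S}(\tau)|^{\alpha-1}z_2(\tau)\big)d\tau,\qquad w_1(t)=e^{t\Delta}\Phi_{\sigma_1}+a\int_0^te^{(t-\tau)\Delta}\big(|\cdot|^\gamma|u_{2\mathcal S}(\tau)|^{\alpha-1}w_1(\tau)\big)d\tau$$ with $\|z_2\|_{\sigma_2;k_0,p_0}<\infty$, $\|w_1\|_{\sigma_1;k_0,p_0}<\infty$, self-similar in the sense that $\lambda^{\sigma_2}z_2(\lambda^2t,\lambda x)=z_2(t,x)$ and $\lambda^{\sigma_1}w_1(\lambda^2t,\lambda x)=w_1(t,x)$ for all $\lambda>0$. \textbf{(i)} Let $\frac{2+\gamma}{\alpha-1}=\sigma_1<\sigma_2$,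 let $(k_0,p_0)$ be $\sigma_2$-admissible, and suppose that there are positive constants $C_1,C_2,\delta_{01},\delta_{02}$ such that for all $t>0$ $$t^{\frac d2(\frac{\sigma_1}d-\frac kd-\frac1p)+\delta_{01}}\|e^{t\Delta}(\varphi_1-\Phi_{\sigma_1})\|_{L^{p,\infty}_k}\le C_1,$$ $$t^{\frac d2(\frac{\sigma_2}d-\frac{k_0}d-\frac1{p_0})}\|e^{t\Delta}\varphi_2\|_{L^{p_0,\infty}_{k_0}}+t^{\frac d2(\frac{\sigma_2}d-\frac{k_0}d-\frac1{p_0})+\delta_{02}}\|e^{t\Delta}(\varphi_2-\Phi_{\sigma_2})\|_{L^{p_0,\infty}_{k_0}}\le C_2.$$ Then there are $\delta_1,\delta_2>0$ such that, for every $(\tilde k,\tilde p)\in\mathbb R\times[1,\infty]$ with $\tilde k\le k$, $p\le\tilde p$, $0\le\frac{\tilde k}d+\frac1{\tilde p}$, and for every $(\tilde k_0,\tilde p_0)\in\mathbb R\times[1,\infty]$ with $\tilde k_0\le k_0$, $p_0\le\tilde p_0$, $0\le\frac{\tilde k_0}d+\frac1{\tilde p_0}$, there is $C>0$ with $$\|u_1(t)-u_{1\mathcal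 S}(t)\|_{L^{\tilde p,\infty}_{\tilde k}}\le Ct^{-\frac d2(\frac1{q_c}-\frac{\tilde k}d-\frac1{\tilde p})-\delta_1},\qquad\|u_2(t)-z_2(t)\|_{L^{\tilde p_0,\infty}_{\tilde k_0}}\le Ct^{-\frac d2(\frac{\sigma_2}d-\frac{\tilde k_0}d-\frac1{\tilde p_0})-\delta_2}$$ for all sufficiently large $t$. \textbf{(ii)} Let $\frac{2+\gamma}{\alpha-1}=\sigma_2<\sigma_1$, let $(k_0,p_0)$ be $\sigma_1$-admissible, and suppose that there are positive constants $C_1,C_2,\delta_{01},\delta_{02}$ such that for all $t>0$ $$t^{\frac d2(\frac{\sigma_1}d-\frac{k_0}d-\frac1{p_0})}\|e^{t\Delta}\varphi_1\|_{L^{p_0,\infty}_{k_0}}+t^{\frac d2(\frac{\sigma_1}d-\frac{k_0}d-\frac1{p_0})+\delta_{01}}\|e^{t\Delta}(\varphi_1-\Phi_{\sigma_1})\|_{L^{p_0,\infty}_{k_0}}\le C_1,$$ $$t^{\frac d2(\frac{\sigma_2}d-\frac kd-\frac1p)+\delta_{02}}\|e^{t\Delta}(\varphi_2-\Phi_{\sigma_2})\|_{L^{p,\infty}_k}\le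 C_2.$$ Then there are $\delta_1,\delta_2>0$ such that, for all $(\tilde k,\tilde p)$ and $(\tilde k_0,\tilde p_0)$ as in (i), there is $C>0$ with $$\|u_1(t)-w_1(t)\|_{L^{\tilde p_0,\infty}_{\tilde k_0}}\le Ct^{-\frac d2(\frac{\sigma_1}d-\frac{\tilde k_0}d-\frac1{\tilde p_0})-\delta_1},\qquad\|u_2(t)-u_{2\mathcal S}(t)\|_{L^{\tilde p,\infty}_{\tilde k}}\le Ct^{-\frac d2(\frac1{q_c}-\frac{\tilde k}d-\frac1{\tilde p})-\delta_2}$$ for all sufficiently large $t$. -/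

import Mathlib

open MeasureTheory Set Filter Topology
open scoped ENNReal SchwartzMap

/-! ## Weighted weak Lebesgue spaces on Euclidean space -/

/-- The Euclidean space of dimension `d`. -/
abbrev E (d : ℕ) : Type := EuclideanSpace ℝ (Fin d)

/-- The real number `1 / p` for an exponent `p ∈ [1, ∞]`, with `1 / ∞ = 0`. -/
noncomputable def invExp (p : ℝ≥0∞) : ℝ := (p⁻¹).toReal

/-- The decreasing rearrangement
`f^*(s) = inf {μ > 0 : |{x : |f(x)| > μ}| ≤ s}` (infinite if there is no such `μ`). -/
noncomputable def decreasingRearrangement {d : ℕ} {F : Type*} [NormedAddCommGroup F]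
    (f : E d → F) (s : ℝ) : ℝ≥0∞ :=
  sInf {μ : ℝ≥0∞ | 0 < μ ∧ volume {x : E d | μ < ‖f x‖ₑ} ≤ ENNReal.ofReal s}

/-- The weak Lebesgue (Lorentz) quasi-norm `‖f‖_{L^{p,∞}} = sup_{s > 0} s^{1/p} f^*(s)`. -/
noncomputable def weakNorm {d : ℕ} {F : Type*} [NormedAddCommGroup F]
    (p : ℝ≥0∞) (f : E d → F) : ℝ≥0∞ :=
  ⨆ (s : ℝ) (_ : 0 < s), ENNReal.ofReal (s ^ invExp p) * decreasingRearrangement f s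

/-- The weighted quasi-norm `‖f‖_{L^{p,∞}_k} = ‖ |x|^k f ‖_{L^{p,∞}}`. -/
noncomputable def wNorm {d : ℕ} {F : Type*} [NormedAddCommGroup F] [NormedSpace ℝ F]
    (k : ℝ) (p : ℝ≥0∞) (f : E d → F) : ℝ≥0∞ :=
  weakNorm p (fun x => (‖x‖ ^ k) • f x)

/-- The exponent `(d/2) (s/d - k/d - 1/p)`. -/
noncomputable def decayExp (d : ℕ) (s k : ℝ) (p : ℝ≥0∞) : ℝ :=
  (d / 2 : ℝ) * (s / d - k / d - invExp p)

/-- The Kato-type norm `sup_{t > 0} t^{(d/2)(s/d - k/d - 1/p)} ‖u(t)‖_{L^{p,∞}_k}`. -/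
noncomputable def katoNorm {d : ℕ} {F : Type*} [NormedAddCommGroup F] [NormedSpace ℝ F]
    (s k : ℝ) (p : ℝ≥0∞) (u : ℝ → E d → F) : ℝ≥0∞ :=
  ⨆ (t : ℝ) (_ : 0 < t), ENNReal.ofReal (t ^ decayExp d s k p) * wNorm k p (u t)

/-! ## The heat semigroup on functions -/

/-- The heat kernel `G_t(x) = (4πt)^{-d/2} exp(-|x|²/(4t))`. -/
noncomputable def heatKernel {d : ℕ} (t : ℝ) (x : E d) : ℝ :=
  (4 * Real.pi * t) ^ (-(d / 2 : ℝ)) * Real.exp (-(1 / (4 * t)) * ‖x‖ ^ 2)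

/-- `(e^{tΔ} f)(x) = ∫ G_t(x - y) f(y) dy`. -/
noncomputable def heat {d : ℕ} {F : Type*} [NormedAddCommGroup F] [NormedSpace ℝ F]
    (t : ℝ) (f : E d → F) (x : E d) : F :=
  ∫ y, heatKernel t (x - y) • f y

/-! ## The heat semigroup on tempered distributions -/

/-- Every derivative of a Gaussian decays faster than every power. -/
theorem gaussian_decay (d : ℕ) {b : ℝ} (hb : 0 < b) (k n : ℕ) :
    ∃ C, ∀ x : E d,
      ‖x‖ ^ k * ‖iteratedFDeriv ℝ n
        (fun y : E d => Real.exp (-b * ‖y‖ ^ 2)) x‖ ≤ C := by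
  have hT : (fun y : E d => -b * ‖y‖ ^ 2).HasTemperateGrowth :=
    (Function.HasTemperateGrowth.const (-b)).mul
      (Function.hasTemperateGrowth_norm_sq (E d))
  obtain ⟨m, A, hA, hbd⟩ := hT.norm_iteratedFDeriv_le_uniform n
  set N := k + m * n with hN
  refine ⟨n.factorial * (1 + A) ^ n * (2 ^ N * (N.factorial * Real.exp b / b ^ N)), fun x => ?_⟩
  have hr : 0 ≤ ‖x‖ := norm_nonneg x
  have h1r : 1 ≤ (1 + ‖x‖) ^ m := one_le_pow₀ (by linarith)
  have hD1 : 1 ≤ (1 + A) * (1 + ‖x‖) ^ m := by nlinarith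
  have key := norm_iteratedFDeriv_comp_le (𝕜 := ℝ) (g := Real.exp)
    (f := fun y : E d => -b * ‖y‖ ^ 2) (n := n) (N := ((⊤ : ℕ∞) : WithTop ℕ∞))
    Real.contDiff_exp hT.1 (by exact_mod_cast le_top) x
    (C := Real.exp (-b * ‖x‖ ^ 2)) (D := (1 + A) * (1 + ‖x‖) ^ m)
    (fun i _ => by
      rw [norm_iteratedFDeriv_eq_norm_iteratedDeriv, iteratedDeriv_eq_iterate, Real.iter_deriv_exp,
        Real.norm_of_nonneg (Real.exp_pos _).le])
    (fun i hi hin => by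
      calc _ ≤ A * (1 + ‖x‖) ^ m := hbd i hin x
        _ ≤ (1 + A) * (1 + ‖x‖) ^ m := by nlinarith
        _ ≤ _ := le_self_pow₀ hD1 (by omega))
  have hgauss : (1 + ‖x‖) ^ N * Real.exp (-b * ‖x‖ ^ 2) ≤
      2 ^ N * (N.factorial * Real.exp b / b ^ N) := by
    have h1 : (1 + ‖x‖) ^ N ≤ (2 * (1 + ‖x‖ ^ 2)) ^ N :=
      pow_le_pow_left₀ (by positivity) (by nlinarith [sq_nonneg (‖x‖ - 1)]) N
    have h2 : (b * (1 + ‖x‖ ^ 2)) ^ N / N.factorial ≤ Real.exp (b * (1 + ‖x‖ ^ 2)) :=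
      Real.pow_div_factorial_le_exp _ (by positivity) N
    rw [div_le_iff₀ (by positivity), mul_pow] at h2
    have h3 : Real.exp (b * (1 + ‖x‖ ^ 2)) * Real.exp (-b * ‖x‖ ^ 2) = Real.exp b := by
      rw [← Real.exp_add]; ring_nf
    have h4 : (1 + ‖x‖ ^ 2) ^ N * Real.exp (-b * ‖x‖ ^ 2) ≤ N.factorial * Real.exp b / b ^ N := by
      rw [le_div_iff₀ (by positivity)]
      calc _ = (b ^ N * (1 + ‖x‖ ^ 2) ^ N) * Real.exp (-b * ‖x‖ ^ 2) := by ring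
        _ ≤ (Real.exp (b * (1 + ‖x‖ ^ 2)) * N.factorial) * Real.exp (-b * ‖x‖ ^ 2) := by gcongr
        _ = N.factorial * (Real.exp (b * (1 + ‖x‖ ^ 2)) * Real.exp (-b * ‖x‖ ^ 2)) := by ring
        _ = _ := by rw [h3]
    calc _ ≤ (2 * (1 + ‖x‖ ^ 2)) ^ N * Real.exp (-b * ‖x‖ ^ 2) := by gcongr
      _ = 2 ^ N * ((1 + ‖x‖ ^ 2) ^ N * Real.exp (-b * ‖x‖ ^ 2)) := by rw [mul_pow]; ring
      _ ≤ _ := by gcongr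
  calc _ ≤ (1 + ‖x‖) ^ k * (n.factorial * Real.exp (-b * ‖x‖ ^ 2) *
          ((1 + A) * (1 + ‖x‖) ^ m) ^ n) := by
        gcongr
        · linarith
        · exact key
    _ = n.factorial * (1 + A) ^ n * ((1 + ‖x‖) ^ N * Real.exp (-b * ‖x‖ ^ 2)) := by
        rw [hN, mul_pow, pow_add, ← pow_mul]; ring
    _ ≤ _ := by gcongr

/-- The Gaussian `y ↦ exp(-b|y|²)`, `b > 0`, as a real-valued Schwartz function. -/
noncomputable def gaussianSchwartz (d : ℕ) {b : ℝ} (hb : 0 < b) : 𝓢(E d, ℝ) where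
  toFun y := Real.exp (-b * ‖y‖ ^ 2)
  smooth' := Real.contDiff_exp.comp (contDiff_const.mul (contDiff_norm_sq ℝ))
  decay' k n := gaussian_decay d hb k n

/-- For `t > 0`, the complex-valued Schwartz function `y ↦ G_t(x - y)`. -/
noncomputable def heatKernelSchwartz {d : ℕ} {t : ℝ} (ht : 0 < t) (x : E d) : 𝓢(E d, ℂ) :=
  (((4 * Real.pi * t) ^ (-(d / 2 : ℝ)) : ℝ) : ℂ) •
    SchwartzMap.compSubConstCLM ℂ x
      (SchwartzMap.postcompCLM (𝕜 := ℝ) Complex.ofRealCLM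
        (gaussianSchwartz d (b := 1 / (4 * t)) (by positivity)))

theorem heatKernelSchwartz_apply {d : ℕ} {t : ℝ} (ht : 0 < t) (x y : E d) :
    heatKernelSchwartz ht x y = ((heatKernel t (x - y) : ℝ) : ℂ) := by
  change (((4 * Real.pi * t) ^ (-(d / 2 : ℝ)) : ℝ) : ℂ) *
    ((Real.exp (-(1 / (4 * t)) * ‖y - x‖ ^ 2) : ℝ) : ℂ) = _
  rw [heatKernel, norm_sub_rev x y, Complex.ofReal_mul]

open Classical in
/-- `(e^{tΔ} φ)(x) = ⟨φ, G_t(x - ·)⟩` for a tempered distribution `φ` and `t > 0`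
(the value at `t ≤ 0` is not used). -/
noncomputable def heatDist {d : ℕ} (φ : 𝓢'(E d, ℂ)) (t : ℝ) (x : E d) : ℂ :=
  if ht : 0 < t then φ (heatKernelSchwartz ht x) else 0

/-- A tempered distribution is real if it takes real values on real-valued test functions. -/
def IsRealDist {d : ℕ} (φ : 𝓢'(E d, ℂ)) : Prop :=
  ∀ g : 𝓢(E d, ℂ), (∀ x, (g x).im = 0) → (φ g).im = 0

/-! ## Homogeneous data and self-similar solutions -/

/-- `ω ∈ L^∞` is homogeneous of degree `0`. -/
structure IsAngular {d : ℕ} (ω : E d → ℝ) : Prop where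
  measurable : AEStronglyMeasurable ω volume
  bounded : eLpNorm ω ⊤ volume < ⊤
  homogeneous : ∀ c : ℝ, 0 < c → ∀ᵐ x : E d, ω (c • x) = ω x

/-- The homogeneous function `Φ_σ(x) = ω(x) |x|^{-σ}`. -/
noncomputable def homData {d : ℕ} (σ : ℝ) (ω : E d → ℝ) (x : E d) : ℝ :=
  ω x * ‖x‖ ^ (-σ)

/-- `v` is self-similar of order `s`: `c^s v(c² t, c x) = v(t, x)` for all `c > 0`. -/
def IsSelfSimilar {d : ℕ} (s : ℝ) (v : ℝ → E d → ℝ) : Prop :=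
  ∀ c : ℝ, 0 < c → ∀ t : ℝ, 0 < t → ∀ᵐ x : E d, c ^ s * v (c ^ 2 * t) (c • x) = v t x

/-- `v` is a global solution of the integral equation
`v(t) = L(t) + a ∫_0^t e^{(t-τ)Δ} ( |·|^γ |V(τ)|^{α-1} v(τ) ) dτ`, `t > 0`.
With `V = v` this is the Hardy-Hénon equation, and with `V` given it is a linear equation
with potential `a |x|^γ |V|^{α-1}`; `L` is the heat flow of the initial data. -/
structure IsMildSolution {d : ℕ} {F : Type*} [NormedAddCommGroup F] [NormedSpace ℝ F]
    (a γ α : ℝ) (V L v : ℝ → E d → F) : Prop where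
  measurable : AEStronglyMeasurable (Function.uncurry v)
    ((volume.restrict (Ioi (0 : ℝ))).prod (volume : Measure (E d)))
  measurable_slice : ∀ t : ℝ, 0 < t → AEStronglyMeasurable (v t) volume
  equation : ∀ t : ℝ, 0 < t → ∀ᵐ x : E d,
    v t x = L t x + a • ∫ τ in (0 : ℝ)..t,
      heat (t - τ) (fun y => (‖y‖ ^ γ * ‖V τ y‖ ^ (α - 1)) • v τ y) x

/-- The global solution of the Hardy-Hénon equation generated by small data with heat flow `L`:
the mild solution with `‖v‖_{K^p_k} ≤ 2 ‖L‖_{K^p_k}`, where the norm of `K^p_k` is the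
scale-invariant one. -/
structure IsSmallSolution {d : ℕ} {F : Type*} [NormedAddCommGroup F] [NormedSpace ℝ F]
    (a γ α k : ℝ) (p : ℝ≥0∞) (L v : ℝ → E d → F) : Prop where
  mild : IsMildSolution a γ α v L v
  bound : katoNorm ((2 + γ) / (α - 1)) k p v ≤ 2 * katoNorm ((2 + γ) / (α - 1)) k p L

/-- `U` is the self-similar solution of the Hardy-Hénon equation with initial data
`ω(x) |x|^{-(2+γ)/(α-1)}`. -/
structure IsSelfSimilarSolution {d : ℕ} (a γ α k : ℝ) (p : ℝ≥0∞) (ω : E d → ℝ)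
    (U : ℝ → E d → ℝ) : Prop where
  solution : IsSmallSolution a γ α k p (fun t => heat t (homData ((2 + γ) / (α - 1)) ω)) U
  selfSimilar : IsSelfSimilar ((2 + γ) / (α - 1)) U

/-- `z` is the self-similar solution of the linear equation
`z(t) = e^{tΔ} (ω |·|^{-σ}) + a ∫_0^t e^{(t-τ)Δ} ( |·|^γ |U(τ)|^{α-1} z(τ) ) dτ`
in the space of functions with `sup_{t > 0} t^{(d/2)(σ/d - k₀/d - 1/p₀)} ‖z(t)‖ < ∞`,
the norm being that of `L^{p₀,∞}_{k₀}`. -/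
structure IsModifiedLinearSolution {d : ℕ} (a γ α σ k₀ : ℝ) (p₀ : ℝ≥0∞) (ω : E d → ℝ)
    (U z : ℝ → E d → ℝ) : Prop where
  mild : IsMildSolution a γ α U (fun t => heat t (homData σ ω)) z
  bound : katoNorm σ k₀ p₀ z < ⊤
  selfSimilar : IsSelfSimilar σ z

/-! ## Admissible exponents -/

/-- `1/q_c = (2 + γ) / (d (α - 1))`. -/
noncomputable def invQc (d : ℕ) (γ α : ℝ) : ℝ := (2 + γ) / (d * (α - 1))

/-- Conditions on the pair `(l, q)` of the critical space `L^{q,r}_l`. -/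
structure CriticalPair (d : ℕ) (γ α l : ℝ) (q : ℝ≥0∞) : Prop where
  one_le : 1 ≤ q
  critical : l / d + invExp q = invQc d γ α
  weight : γ / (α - 1) ≤ l

/-- Conditions on the pair `(k, p)` of the space `K^p_k` in which the solution is constructed. -/
structure AuxiliaryPair (d : ℕ) (γ α l k : ℝ) (p : ℝ≥0∞) : Prop where
  lt_exp : ENNReal.ofReal α < p
  weight_lower : (l + γ) / α ≤ k
  weight_upper : k ≤ l
  nonneg : 0 ≤ k / d + invExp p
  lower : (2 + γ * α) / (d * α * (α - 1)) < k / d + invExp p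
  upper_critical : k / d + invExp p < invQc d γ α
  upper_integrable : k / d + invExp p < (d + γ) / (d * α)

/-- Conditions on the pair `(k₀, p₀)` used for the component with the faster decay `|x|^{-σ}`. -/
structure SecondaryPair (d : ℕ) (γ α k : ℝ) (p : ℝ≥0∞) (σ k₀ : ℝ) (p₀ : ℝ≥0∞) : Prop where
  one_le : 1 ≤ p₀
  nonneg : 0 ≤ k₀ / d + invExp p₀
  holder_nonneg : 0 ≤ (α - 1) * invExp p + invExp p₀
  holder_lt_one : (α - 1) * invExp p + invExp p₀ < 1
  lower : σ / d < (α - 1) * (k / d + invExp p) + k₀ / d + invExp p₀ - γ / d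
  upper : (α - 1) * (k / d + invExp p) + k₀ / d + invExp p₀ - γ / d < 1
  large_exp : 3 < α → k / d + invExp p < k₀ / d + invExp p₀ →
    (α - 2) * (k / d + invExp p) + (k₀ / d + invExp p₀) < (2 + γ) / d

/-- Pairs `(k', p')` reached from `(k, p)`: `k' ≤ k`, `p ≤ p'` and `0 ≤ k'/d + 1/p'`. -/
structure ReachablePair (d : ℕ) (k : ℝ) (p : ℝ≥0∞) (k' : ℝ) (p' : ℝ≥0∞) : Prop where
  weight_le : k' ≤ k
  exp_le : p ≤ p'
  nonneg : 0 ≤ k' / d + invExp p'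

/-! ## Hypotheses and conclusions on rates -/

/-- `t^{(d/2)(σ/d - k/d - 1/p) + δ} ‖e^{tΔ}(φ - ω|·|^{-σ})‖_{L^{p,∞}_k}`. -/
noncomputable def dataGap {d : ℕ} (σ k : ℝ) (p : ℝ≥0∞) (ω : E d → ℝ) (φ : 𝓢'(E d, ℂ))
    (δ t : ℝ) : ℝ≥0∞ :=
  ENNReal.ofReal (t ^ (decayExp d σ k p + δ)) *
    wNorm k p (fun x => heatDist φ t x - ((heat t (homData σ ω) x : ℝ) : ℂ))

/-- `t^{(d/2)(σ/d - k/d - 1/p)} ‖e^{tΔ}φ‖_{L^{p,∞}_k}`. -/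
noncomputable def dataSize {d : ℕ} (σ k : ℝ) (p : ℝ≥0∞) (φ : 𝓢'(E d, ℂ)) (t : ℝ) : ℝ≥0∞ :=
  ENNReal.ofReal (t ^ decayExp d σ k p) * wNorm k p (heatDist φ t)

/-- For every pair `(k', p')` reached from `(k, p)` there is a `C > 0` with
`‖v(t) - V(t)‖_{L^{p',∞}_{k'}} ≤ C t^{-(d/2)(s/d - k'/d - 1/p') - δ}` for all large `t`. -/
def ConvergesAtRate {d : ℕ} (s k : ℝ) (p : ℝ≥0∞) (δ : ℝ) (v V : ℝ → E d → ℝ) : Prop :=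
  ∀ (k' : ℝ) (p' : ℝ≥0∞), ReachablePair d k p k' p' →
    ∃ C : ℝ, 0 < C ∧ ∀ᶠ t : ℝ in atTop,
      wNorm k' p' (fun x => v t x - V t x) ≤
        ENNReal.ofReal (C * t ^ (-decayExp d s k' p' - δ))

/-! Put s = (2+γ)/(α-1), β = α-1 and K = k + d/p. A time-dependent function has order ρ at (k,p) if
its weighted weak norm is at most a constant times t^{-(ρ-K)/2} for all t > 0; this is `KatoBound`.
Data homogeneous of degree -σ generate a heat flow of order σ, and the Duhamel integral turns a
source of order ρ+2 into a function of order ρ. Since βs - γ = 2, the potential |x|^γ m^β has order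
2 when m has order s. Hence F ↦ ∫ e^{(t-τ)Δ}(|x|^γ m^β F) preserves every order in a suitable range,
and it is a contraction when m is small. All nonlinear comparisons thus become linear inequalities f
≤ h + T f with a small positive operator T, and `KatoBound.absorb` passes the bound of h on to f.

Let P u be the component with slow data (order s) and Q u the component with fast data (order σ >
s). The Q-part of the nonlinearity is |x|^γ |u|^β Q u, so Q u satisfies a linear inequality of this
kind and has order σ. The differences w = P u - U and v = Q u - z satisfy similar inequalities, with
source terms of the shape |x|^γ m^{β-θ} e^θ F (`abs_slow_sub_le`, `abs_fast_sub_le`). Here θ powers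
of m, of order s, have been traded for θ powers of a function e of higher order ρ₁, so the Duhamel
integral gains θ(ρ₁ - s) (`KatoBound.duhamel_mixedSource`). With e = Q u this gives w the order s +
2δ₁; with e = w and e = Q u it gives v the order σ + 2δ₂. A small θ keeps all exponents inside the
open admissible range, and θ ≤ min(1, β) covers powers |u|^β that are merely Hölder continuous.
`asymptotic_comparison` assembles these steps.

The smallness ε is fixed before the rates of the data are known, so the contraction constants have
to be uniform over an interval of orders. The linear theory rests on smoothing of the heat flow
between weighted weak spaces (`WeakBound.eHeat`) and on Minkowski's inequality in time
(`WeakBound.lintegral_time`); `KatoBound.bootstrap` then reaches all pairs with smaller weight and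
larger exponent. For distributional data the semigroup law (`isHeatFlow_heatDist`) is obtained by
factoring the distribution through a Banach space with Hahn-Banach. -/

/-! ## Weak bounds for nonnegative functions -/

/-- `|x|^k f` has weak `L^{1/r}` quasi-norm at most `A`. -/
def WeakBound {d : ℕ} (k r A : ℝ) (f : E d → ℝ≥0∞) : Prop :=
  ∀ s : ℝ, 0 < s →
    volume {x : E d | ENNReal.ofReal (A * s ^ (-r)) < ENNReal.ofReal (‖x‖ ^ k) * f x} ≤
      ENNReal.ofReal s

namespace WeakBound

variable {d : ℕ} {k r A B k' r' : ℝ} {f g : E d → ℝ≥0∞}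

theorem mono (hg : WeakBound k r A g) (h : f ≤ᵐ[volume] g) : WeakBound k r A f := by
  intro s hs
  refine (measure_mono_ae ?_).trans (hg s hs)
  filter_upwards [h] with x hx hx'
  exact lt_of_lt_of_le hx' (mul_le_mul_right hx _)

theorem mono_const (hf : WeakBound k r A f) (h : A ≤ B) : WeakBound k r B f := by
  intro s hs
  refine (measure_mono ?_).trans (hf s hs)
  intro x hx
  refine lt_of_le_of_lt (ENNReal.ofReal_le_ofReal ?_) hx
  gcongr

/-- Powers of |x| can be cancelled only off the origin, which is null in positive dimension but is
the whole space in dimension zero. -/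
theorem ae_eq_zero_space : ∀ᵐ x : E d, (0 < d) → x ≠ 0 := by
  rcases Nat.eq_zero_or_pos d with h | h
  · simp [h]
  · have : Nonempty (Fin d) := ⟨⟨0, h⟩⟩
    have : Nontrivial (E d) := inferInstance
    have : ∀ᵐ x : E d, x ≠ 0 := by
      simp [ae_iff]
    filter_upwards [this] with x hx _ using hx

/-- Each summand receives half of the exceptional measure. Passing from s to s/2 costs 2^r ≤ 2,
whence a constant independent of r. -/
theorem add (hA : 0 ≤ A) (hB : 0 ≤ B) (hr : r ≤ 1) (hf : WeakBound k r A f)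
    (hg : WeakBound k r B g) : WeakBound k r (2 * (A + B)) (fun x => f x + g x) := by
  intro s hs
  have h2 : (0 : ℝ) < s / 2 := by positivity
  have hsr : (s / 2) ^ (-r) ≤ 2 * s ^ (-r) := by
    rw [Real.div_rpow hs.le (by norm_num), Real.rpow_neg (by norm_num : (0 : ℝ) ≤ 2), div_inv_eq_mul,
      mul_comm]
    gcongr
    calc (2 : ℝ) ^ r ≤ 2 ^ (1 : ℝ) := Real.rpow_le_rpow_of_exponent_le (by norm_num) hr
      _ = 2 := by norm_num
  have hsub : {x : E d | ENNReal.ofReal (2 * (A + B) * s ^ (-r)) <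
      ENNReal.ofReal (‖x‖ ^ k) * (f x + g x)} ⊆
      {x : E d | ENNReal.ofReal (A * (s / 2) ^ (-r)) < ENNReal.ofReal (‖x‖ ^ k) * f x} ∪
      {x : E d | ENNReal.ofReal (B * (s / 2) ^ (-r)) < ENNReal.ofReal (‖x‖ ^ k) * g x} := by
    intro x hx
    by_contra hcon
    simp only [mem_union, mem_ofPred_eq, not_or, not_lt] at hcon hx
    refine absurd hx (not_lt.mpr ?_)
    rw [mul_add]
    refine (add_le_add hcon.1 hcon.2).trans ?_
    rw [← ENNReal.ofReal_add (by positivity) (by positivity)]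
    apply ENNReal.ofReal_le_ofReal
    nlinarith
  refine (measure_mono hsub).trans ((measure_union_le _ _).trans
    ((add_le_add (hf _ h2) (hg _ h2)).trans ?_))
  rw [← ENNReal.ofReal_add (by positivity) (by positivity)]
  simp

/-- Hölder's inequality in weak spaces: off two exceptional sets of measure s/2 both factors lie
below their thresholds, and the thresholds multiply. Weights and reciprocal exponents add up. -/
theorem mul (hd : 0 < d) (hA : 0 ≤ A) (hf : WeakBound k r A f)
    (hg : WeakBound k' r' B g) :
    WeakBound (k + k') (r + r') (2 ^ (r + r') * (A * B)) (fun x => f x * g x) := by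
  intro s hs
  have h2 : (0 : ℝ) < s / 2 := by positivity
  have hsr : 2 ^ (r + r') * (A * B) * s ^ (-(r + r')) =
      (A * (s / 2) ^ (-r)) * (B * (s / 2) ^ (-r')) := by
    have : (s / 2) ^ (-r) * (s / 2) ^ (-r') = 2 ^ (r + r') * s ^ (-(r + r')) := by
      rw [← Real.rpow_add h2, Real.div_rpow hs.le (by norm_num), show -r + -r' = -(r + r') by ring,
        Real.rpow_neg (by norm_num : (0 : ℝ) ≤ 2), div_inv_eq_mul, mul_comm]
    calc _ = A * B * (2 ^ (r + r') * s ^ (-(r + r'))) := by ring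
      _ = _ := by rw [← this]; ring
  have hsub : {x : E d | ENNReal.ofReal (2 ^ (r + r') * (A * B) * s ^ (-(r + r'))) <
      ENNReal.ofReal (‖x‖ ^ (k + k')) * (f x * g x)} ≤ᵐ[volume]
      ({x : E d | ENNReal.ofReal (A * (s / 2) ^ (-r)) < ENNReal.ofReal (‖x‖ ^ k) * f x} ∪
      {x : E d | ENNReal.ofReal (B * (s / 2) ^ (-r')) < ENNReal.ofReal (‖x‖ ^ k') * g x} :
        Set (E d)) := by
    filter_upwards [ae_eq_zero_space (d := d)] with x hx0 hx
    by_contra hcon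
    have hx : ENNReal.ofReal (2 ^ (r + r') * (A * B) * s ^ (-(r + r'))) <
      ENNReal.ofReal (‖x‖ ^ (k + k')) * (f x * g x) := hx
    have hcon : x ∉ ({x : E d | ENNReal.ofReal (A * (s / 2) ^ (-r)) < ENNReal.ofReal (‖x‖ ^ k) * f x} ∪
      {x : E d | ENNReal.ofReal (B * (s / 2) ^ (-r')) < ENNReal.ofReal (‖x‖ ^ k') * g x} :
        Set (E d)) := hcon
    simp only [mem_union, mem_ofPred_eq, not_or, not_lt] at hcon
    refine absurd hx (not_lt.mpr ?_)
    rw [Real.rpow_add (norm_pos_iff.mpr (hx0 hd)), ENNReal.ofReal_mul (by positivity), hsr,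
      ENNReal.ofReal_mul (by positivity), mul_mul_mul_comm]
    exact mul_le_mul' hcon.1 hcon.2
  refine (measure_mono_ae hsub).trans ((measure_union_le _ _).trans
    ((add_le_add (hf _ h2) (hg _ h2)).trans ?_))
  rw [← ENNReal.ofReal_add (by positivity) (by positivity)]
  simp

theorem rpow {θ : ℝ} (hA : 0 ≤ A) (hθ : 0 ≤ θ) (hf : WeakBound k r A f) :
    WeakBound (θ * k) (θ * r) (A ^ θ) (fun x => f x ^ θ) := by
  intro s hs
  refine (measure_mono ?_).trans (hf s hs)
  intro x hx
  simp only [mem_ofPred_eq] at hx ⊢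
  by_contra hcon
  rw [not_lt] at hcon
  refine absurd hx (not_lt.mpr ?_)
  have h1 := ENNReal.rpow_le_rpow hcon hθ
  rw [ENNReal.mul_rpow_of_nonneg _ _ hθ, ENNReal.ofReal_rpow_of_nonneg (by positivity) hθ,
    ENNReal.ofReal_rpow_of_nonneg (by positivity) hθ, ← Real.rpow_mul (norm_nonneg x),
    Real.mul_rpow hA (by positivity), ← Real.rpow_mul hs.le] at h1
  rwa [mul_comm k θ, show -r * θ = -(θ * r) by ring] at h1

theorem const_mul {c : ℝ} (hc : 0 < c) (hf : WeakBound k r A f) :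
    WeakBound k r (c * A) (fun x => ENNReal.ofReal c * f x) := by
  intro s hs
  refine (measure_mono ?_).trans (hf s hs)
  intro x hx
  simp only [mem_ofPred_eq] at hx ⊢
  rw [mul_assoc, ENNReal.ofReal_mul hc.le, mul_left_comm] at hx
  exact lt_of_mul_lt_mul_left' hx

/-- Powers of `|x|` are bounded after removing the weight. -/
theorem norm_rpow (hd : 0 < d) (m : ℝ) :
    WeakBound (-m) 0 1 (fun x : E d => ENNReal.ofReal (‖x‖ ^ m)) := by
  intro s hs
  refine le_of_eq_of_le ?_ zero_le
  rw [← nonpos_iff_eq_zero, ← measure_empty (μ := (volume : Measure (E d)))]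
  apply measure_mono_ae
  filter_upwards [ae_eq_zero_space (d := d)] with x hx0 hx
  have hx : ENNReal.ofReal (1 * s ^ (-(0 : ℝ))) <
      ENNReal.ofReal (‖x‖ ^ (-m)) * ENNReal.ofReal (‖x‖ ^ m) := hx
  have hpos := norm_pos_iff.mpr (hx0 hd)
  rw [← ENNReal.ofReal_mul (by positivity), ← Real.rpow_add hpos] at hx
  simp at hx

/-- Monotone limits preserve weak bounds. -/
theorem iSup {F : ℕ → E d → ℝ≥0∞} (hmono : Monotone F) (hF : ∀ n, WeakBound k r A (F n)) :
    WeakBound k r A (fun x => ⨆ n, F n x) := by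
  intro s hs
  have : {x : E d | ENNReal.ofReal (A * s ^ (-r)) < ENNReal.ofReal (‖x‖ ^ k) * ⨆ n, F n x} =
      ⋃ n, {x : E d | ENNReal.ofReal (A * s ^ (-r)) < ENNReal.ofReal (‖x‖ ^ k) * F n x} := by
    ext x
    simp only [mem_ofPred_eq, mem_iUnion, ENNReal.mul_iSup, lt_iSup_iff]
  rw [this, Directed.measure_iUnion]
  · exact iSup_le fun n => hF n s hs
  · apply Monotone.directed_le
    intro m n hmn x hx
    exact lt_of_lt_of_le hx (mul_le_mul_right (hmono hmn x) _)

/-- Away from the origin, points with f = ∞ lie in superlevel sets of every height, in particular in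
one of measure at most ε for each ε > 0. -/
theorem ae_lt_top (hd : 0 < d) (hf : WeakBound k r A f) : ∀ᵐ x, f x < ∞ := by
  have h0 : volume {x : E d | x ≠ 0 ∧ f x = ∞} = 0 := by
    refine le_antisymm (ENNReal.le_of_forall_pos_le_add fun ε hε _ => ?_) zero_le
    rw [zero_add]
    have h := hf ε (by exact_mod_cast hε)
    rw [ENNReal.ofReal_coe_nnreal] at h
    refine (measure_mono ?_).trans h
    rintro x ⟨hx0, hx⟩
    have : 0 < ‖x‖ ^ k := Real.rpow_pos_of_pos (norm_pos_iff.mpr hx0) _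
    simp only [mem_ofPred_eq, hx]
    rw [ENNReal.mul_top (by simpa using this)]
    exact ENNReal.ofReal_lt_top
  filter_upwards [ae_eq_zero_space (d := d), measure_eq_zero_iff_ae_notMem.mp h0] with x hx0 hx
  rw [lt_top_iff_ne_top]
  exact fun h => hx ⟨hx0 hd, h⟩

/-- The support is covered by the sets where the weighted function exceeds 1/(n+1). Choosing A so
that the threshold belonging to measure ε equals 1/(n+1) shows that each of them is null. -/
theorem ae_eq_zero (hd : 0 < d) (hf : ∀ A > 0, WeakBound k r A f) : ∀ᵐ x, f x = 0 := by
  have h0 : volume {x : E d | x ≠ 0 ∧ f x ≠ 0} = 0 := by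
    have hU : {x : E d | x ≠ 0 ∧ f x ≠ 0} ⊆ ⋃ n : ℕ, {x : E d | ENNReal.ofReal (1 / (n + 1)) <
        ENNReal.ofReal (‖x‖ ^ k) * f x} := by
      rintro x ⟨hx0, hx⟩
      have hp : 0 < ‖x‖ ^ k := Real.rpow_pos_of_pos (norm_pos_iff.mpr hx0) _
      have : ENNReal.ofReal (‖x‖ ^ k) * f x ≠ 0 :=
        mul_ne_zero (by simpa using hp) hx
      obtain ⟨n, hn⟩ := ENNReal.exists_inv_nat_lt this
      simp only [mem_iUnion, mem_ofPred_eq]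
      refine ⟨n, lt_of_le_of_lt ?_ hn⟩
      rw [one_div, ENNReal.ofReal_inv_of_pos (by positivity), ENNReal.inv_le_inv,
        ENNReal.ofReal_add (by positivity) (by positivity), ENNReal.ofReal_natCast]
      exact le_self_add
    refine measure_mono_null hU (measure_iUnion_null fun n => ?_)
    refine le_antisymm (ENNReal.le_of_forall_pos_le_add fun ε hε _ => ?_) zero_le
    rw [zero_add]
    have hε' : (0 : ℝ) < ε := by exact_mod_cast hε
    have hpos : 0 < (ε : ℝ) ^ (-r) := Real.rpow_pos_of_pos hε' _
    have h := hf (1 / (n + 1) / (ε : ℝ) ^ (-r)) (by positivity) ε hε'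
    rw [ENNReal.ofReal_coe_nnreal, div_mul_cancel₀ _ hpos.ne'] at h
    exact h
  filter_upwards [ae_eq_zero_space (d := d), measure_eq_zero_iff_ae_notMem.mp h0] with x hx0 hx
  by_contra h
  exact hx ⟨hx0 hd, h⟩

theorem of_weight : WeakBound k r A f ↔
    WeakBound 0 r A (fun x => ENNReal.ofReal (‖x‖ ^ k) * f x) := by
  simp [WeakBound]

theorem zero : WeakBound k r A (fun _ : E d => 0) := by
  intro s hs
  simp

end WeakBound

/-! ## Link with the quasi-norms -/

/-- The infimum is attained at positive finite levels: the superlevel set at c is the increasing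
union of those at c + 1/(n+1), so the measure bound passes to the limit. -/
theorem decreasingRearrangement_le_iff {d : ℕ} {F : Type*} [NormedAddCommGroup F]
    (f : E d → F) (s : ℝ) {c : ℝ≥0∞} (hc : 0 < c) (hc' : c ≠ ∞) :
    decreasingRearrangement f s ≤ c ↔ volume {x : E d | c < ‖f x‖ₑ} ≤ ENNReal.ofReal s := by
  constructor
  · intro h
    have hU : {x : E d | c < ‖f x‖ₑ} = ⋃ n : ℕ, {x : E d | c + (n + 1 : ℝ≥0∞)⁻¹ < ‖f x‖ₑ} := by
      ext x
      simp only [mem_ofPred_eq, mem_iUnion]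
      constructor
      · intro hx
        have h0 : ‖f x‖ₑ - c ≠ 0 := (tsub_pos_of_lt hx).ne'
        obtain ⟨n, hn⟩ := ENNReal.exists_inv_nat_lt h0
        refine ⟨n, ?_⟩
        have : (n + 1 : ℝ≥0∞)⁻¹ < ‖f x‖ₑ - c :=
          lt_of_le_of_lt (ENNReal.inv_le_inv.mpr le_self_add) hn
        rw [add_comm]
        exact lt_tsub_iff_right.mp this
      · rintro ⟨n, hn⟩
        exact lt_of_le_of_lt le_self_add hn
    rw [hU, Directed.measure_iUnion]
    · refine iSup_le fun n => ?_
      have hlt : decreasingRearrangement f s < c + (n + 1 : ℝ≥0∞)⁻¹ :=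
        lt_of_le_of_lt h (ENNReal.lt_add_right hc' (by simp))
      obtain ⟨μ, hμ, hμlt⟩ := sInf_lt_iff.mp hlt
      exact (measure_mono fun x hx => lt_trans hμlt hx).trans hμ.2
    · apply Monotone.directed_le
      intro m n hmn x hx
      simp only [mem_ofPred_eq] at hx ⊢
      refine lt_of_le_of_lt ?_ hx
      gcongr
  · intro h
    exact sInf_le ⟨hc, h⟩

theorem wNorm_le_iff {d : ℕ} {F : Type*} [NormedAddCommGroup F] [NormedSpace ℝ F]
    {k A : ℝ} (hA : 0 < A) (p : ℝ≥0∞) (f : E d → F) :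
    wNorm k p f ≤ ENNReal.ofReal A ↔ WeakBound k (invExp p) A (fun x => ‖f x‖ₑ) := by
  unfold wNorm weakNorm WeakBound
  simp only [iSup_le_iff]
  refine forall₂_congr fun s hs => ?_
  have hs1 : 0 < s ^ invExp p := Real.rpow_pos_of_pos hs _
  have hs2 : 0 < s ^ (-invExp p) := Real.rpow_pos_of_pos hs _
  have e1 : ENNReal.ofReal A = ENNReal.ofReal (s ^ invExp p) *
      ENNReal.ofReal (A * s ^ (-invExp p)) := by
    rw [← ENNReal.ofReal_mul hs1.le, Real.rpow_neg hs.le]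
    congr 1
    field_simp
  rw [e1, ENNReal.mul_le_mul_iff_right (by simpa using hs1) ENNReal.ofReal_ne_top,
    decreasingRearrangement_le_iff _ _ (by simp; positivity) ENNReal.ofReal_ne_top]
  have e2 : ∀ x : E d, ‖(‖x‖ ^ k) • f x‖ₑ = ENNReal.ofReal (‖x‖ ^ k) * ‖f x‖ₑ := fun x => by
    rw [enorm_smul, Real.enorm_eq_ofReal (by positivity)]
  simp only [e2]

/-! ## Integrals of weakly bounded functions -/

namespace WeakBound

variable {d : ℕ} {k r A B k' r' : ℝ} {f g : E d → ℝ≥0∞}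

theorem measure_lt_le (h : WeakBound 0 r A g) {s : ℝ} (hs : 0 < s) :
    volume {x : E d | ENNReal.ofReal (A * s ^ (-r)) < g x} ≤ ENNReal.ofReal s := by
  simpa using h s hs

/-- Layer-cake formula cut at the level A m^{-r}. Below it the distribution function is at most m;
above it, it is at most (A/t)^{1/r}, which is integrable at infinity because r < 1. For r = 0 the
function is essentially bounded. -/
theorem lintegral_set_le (hd : 0 < d) (hr0 : 0 ≤ r) (hr1 : r < 1) (hA : 0 < A)
    (hg : AEMeasurable g) (h : WeakBound 0 r A g) {S : Set (E d)} {m : ℝ} (hm : 0 < m)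
    (hS : volume S ≤ ENNReal.ofReal m) :
    ∫⁻ x in S, g x ≤ ENNReal.ofReal (A / (1 - r) * m ^ (1 - r)) := by
  rcases hr0.eq_or_lt with rfl | hr0
  · have hle : ∀ᵐ x, g x ≤ ENNReal.ofReal A := by
      have h0 : volume {x : E d | ENNReal.ofReal A < g x} = 0 := by
        refine le_antisymm (ENNReal.le_of_forall_pos_le_add fun ε hε _ => ?_) zero_le
        have := h.measure_lt_le (s := ε) (by exact_mod_cast hε)
        simpa using this
      filter_upwards [measure_eq_zero_iff_ae_notMem.mp h0] with x hx
      simpa using hx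
    calc ∫⁻ x in S, g x ≤ ∫⁻ x in S, ENNReal.ofReal A :=
          lintegral_mono_ae (ae_restrict_of_ae hle)
      _ = ENNReal.ofReal A * volume S := by simp
      _ ≤ ENNReal.ofReal A * ENNReal.ofReal m := by gcongr
      _ = _ := by rw [← ENNReal.ofReal_mul hA.le]; simp
  · have htop := ae_lt_top hd h
    have e1 : ∫⁻ x in S, g x = ∫⁻ x in S, ENNReal.ofReal (g x).toReal := by
      refine lintegral_congr_ae (ae_restrict_of_ae ?_)
      filter_upwards [htop] with x hx
      rw [ENNReal.ofReal_toReal hx.ne]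
    rw [e1, lintegral_eq_lintegral_meas_lt _ (Eventually.of_forall fun x => ENNReal.toReal_nonneg)
      hg.ennreal_toReal.restrict]
    set t₀ := A * m ^ (-r) with ht₀
    have ht₀pos : 0 < t₀ := by positivity
    have hsplit : Ioi (0 : ℝ) = Ioc 0 t₀ ∪ Ioi t₀ := (Ioc_union_Ioi_eq_Ioi ht₀pos.le).symm
    have hrinv : 1 < r⁻¹ := (one_lt_inv₀ hr0).mpr hr1
    have hb1 : ∫⁻ t in Ioc 0 t₀, (volume.restrict S) {a | t < (g a).toReal} ≤
        ENNReal.ofReal (t₀ * m) := by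
      calc _ ≤ ∫⁻ t in Ioc 0 t₀, ENNReal.ofReal m := by
            refine lintegral_mono fun t => ?_
            exact (measure_mono (subset_univ _)).trans (by simpa using hS)
        _ = _ := by
            rw [setLIntegral_const, Real.volume_Ioc, mul_comm, sub_zero, ENNReal.ofReal_mul ht₀pos.le]
    have hb2 : ∫⁻ t in Ioi t₀, (volume.restrict S) {a | t < (g a).toReal} ≤
        ENNReal.ofReal (r / (1 - r) * A * m ^ (1 - r)) := by
      have hint : IntegrableOn (fun t : ℝ => A ^ r⁻¹ * t ^ (-r⁻¹)) (Ioi t₀) :=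
        (integrableOn_Ioi_rpow_of_lt (by linarith) ht₀pos).const_mul _
      calc _ ≤ ∫⁻ t in Ioi t₀, ENNReal.ofReal (A ^ r⁻¹ * t ^ (-r⁻¹)) := by
            refine setLIntegral_mono' measurableSet_Ioi fun t ht => ?_
            have ht' : 0 < t := ht₀pos.trans ht
            have hs : 0 < (A / t) ^ r⁻¹ := by positivity
            refine (Measure.restrict_apply_le _ _).trans ?_
            have key := h.measure_lt_le hs
            have e2 : A * ((A / t) ^ r⁻¹) ^ (-r) = t := by
              rw [← Real.rpow_mul (by positivity), mul_neg, inv_mul_cancel₀ hr0.ne', Real.rpow_neg_one]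
              field_simp
            rw [e2, Real.div_rpow hA.le ht'.le, div_eq_mul_inv, ← Real.rpow_neg ht'.le] at key
            refine (measure_mono ?_).trans key
            intro x hx
            exact (ENNReal.ofReal_lt_iff_lt_toReal ht'.le (fun hh => by
              simp only [mem_ofPred_eq, hh, ENNReal.toReal_top] at hx; linarith)).mpr hx
        _ = ENNReal.ofReal (∫ t in Ioi t₀, A ^ r⁻¹ * t ^ (-r⁻¹)) := by
            rw [ofReal_integral_eq_lintegral_ofReal hint]
            filter_upwards [self_mem_ae_restrict measurableSet_Ioi] with t ht
            have ht' : 0 < t := ht₀pos.trans ht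
            positivity
        _ = _ := by
            congr 1
            rw [integral_const_mul, integral_Ioi_rpow_of_lt (by linarith) ht₀pos, ht₀,
              Real.mul_rpow hA.le (by positivity), ← Real.rpow_mul hm.le,
              show -r * (-r⁻¹ + 1) = 1 - r by field_simp; ring]
            have : A ^ r⁻¹ * A ^ (-r⁻¹ + 1) = A := by
              rw [← Real.rpow_add hA]; simp
            have h1r : (1 - r) ≠ 0 := by linarith
            have h2r : -r⁻¹ + 1 ≠ 0 := by linarith
            have e3 : -(A ^ (-r⁻¹ + 1) * m ^ (1 - r)) / (-r⁻¹ + 1) =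
              A ^ (-r⁻¹ + 1) * (r / (1 - r) * m ^ (1 - r)) := by
              have : -r⁻¹ + 1 = - ((1 - r) / r) := by field_simp; ring
              rw [this]
              field_simp
            rw [e3, ← mul_assoc, this]
            ring
    calc _ ≤ (∫⁻ t in Ioc 0 t₀, (volume.restrict S) {a | t < (g a).toReal}) +
          ∫⁻ t in Ioi t₀, (volume.restrict S) {a | t < (g a).toReal} := by
          conv_lhs => rw [hsplit]
          exact lintegral_union_le _ _ _
      _ ≤ ENNReal.ofReal (t₀ * m) + ENNReal.ofReal (r / (1 - r) * A * m ^ (1 - r)) :=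
          add_le_add hb1 hb2
      _ = _ := by
          have h1r : 0 < 1 - r := by linarith
          rw [← ENNReal.ofReal_add (by positivity) (by positivity)]
          congr 1
          have : m ^ (-r) * m = m ^ (1 - r) := by
            nth_rewrite 2 [← Real.rpow_one m]
            rw [← Real.rpow_add hm]; ring_nf
          rw [ht₀, mul_assoc, this]
          field_simp
          ring

/-- Cut g at height A: the lower part is paired with the integral of K, the upper part lives on a
set of measure at most one and is paired with the supremum of K. -/
theorem lintegral_mul_le (hd : 0 < d) (hr0 : 0 ≤ r) (hr1 : r < 1) (hA : 0 < A)
    (hg : AEMeasurable g) (h : WeakBound 0 r A g) {K : E d → ℝ≥0∞} (hK : Measurable K)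
    {M I : ℝ} (hM : 0 ≤ M) (hI : 0 ≤ I) (hKM : ∀ x, K x ≤ ENNReal.ofReal M)
    (hKI : ∫⁻ x, K x ≤ ENNReal.ofReal I) :
    ∫⁻ x, K x * g x ≤ ENNReal.ofReal ((I + M / (1 - r)) * A) := by
  have h1r : 0 < 1 - r := by linarith
  set S := {x : E d | ENNReal.ofReal A < g x} with hSdef
  have hS : volume S ≤ ENNReal.ofReal 1 := by
    simpa using h.measure_lt_le one_pos
  calc ∫⁻ x, K x * g x ≤ ∫⁻ x, (K x * ENNReal.ofReal A + ENNReal.ofReal M * S.indicator g x) := by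
        refine lintegral_mono fun x => ?_
        by_cases hx : x ∈ S
        · rw [indicator_of_mem hx]
          exact le_add_left (mul_le_mul_left (hKM x) _)
        · have : g x ≤ ENNReal.ofReal A := by simpa [hSdef] using hx
          exact le_add_right (mul_le_mul_right this _)
    _ = (∫⁻ x, K x) * ENNReal.ofReal A + ENNReal.ofReal M * ∫⁻ x, S.indicator g x := by
        rw [lintegral_add_left (hK.mul_const _), lintegral_mul_const _ hK,
          lintegral_const_mul' _ _ ENNReal.ofReal_ne_top]
    _ ≤ ENNReal.ofReal I * ENNReal.ofReal A +
        ENNReal.ofReal M * ENNReal.ofReal (A / (1 - r) * 1 ^ (1 - r)) := by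
        gcongr
        exact (lintegral_indicator_le _ _).trans (lintegral_set_le hd hr0 hr1 hA hg h one_pos hS)
    _ = _ := by
        rw [← ENNReal.ofReal_mul hI, ← ENNReal.ofReal_mul hM,
          ← ENNReal.ofReal_add (by positivity) (by positivity)]
        congr 1
        simp
        ring

/-- Convolution with an integrable kernel preserves weak bounds. -/
theorem conv (hd : 0 < d) (hr0 : 0 ≤ r) (hr1 : r < 1) (hA : 0 < A)
    (hg : Measurable g) (h : WeakBound 0 r A g) {K : E d → ℝ≥0∞} (hK : Measurable K)
    (hKI : ∫⁻ x, K x ≤ 1) :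
    WeakBound 0 r ((1 + 1 / (1 - r)) * A) (fun x => ∫⁻ y, K (x - y) * g y) := by
  have h1r : 0 < 1 - r := by linarith
  intro s hs
  -- Truncation height: the part of g below c stays below c after convolution, the part above is
  -- integrable and is treated by Chebyshev's inequality.
  set c := A * s ^ (-r) with hc
  have hcpos : 0 < c := by positivity
  set S := {x : E d | ENNReal.ofReal c < g x} with hSdef
  have hSm : MeasurableSet S := measurableSet_lt measurable_const hg
  have hS : volume S ≤ ENNReal.ofReal s := h.measure_lt_le hs
  set G := S.indicator g with hG
  have hGm : Measurable G := hg.indicator hSm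
  have hKxy : Measurable fun z : E d × E d => K (z.1 - z.2) * G z.2 :=
    (hK.comp (measurable_fst.sub measurable_snd)).mul (hGm.comp measurable_snd)
  have hpt : ∀ x, ∫⁻ y, K (x - y) * g y ≤ ENNReal.ofReal c + ∫⁻ y, K (x - y) * G y := by
    intro x
    calc _ ≤ ∫⁻ y, (K (x - y) * ENNReal.ofReal c + K (x - y) * G y) := by
          refine lintegral_mono fun y => ?_
          by_cases hy : y ∈ S
          · rw [hG, indicator_of_mem hy]
            exact le_add_left le_rfl
          · have : g y ≤ ENNReal.ofReal c := by simpa [hSdef] using hy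
            exact le_add_right (mul_le_mul_right this _)
      _ = (∫⁻ y, K (x - y)) * ENNReal.ofReal c + ∫⁻ y, K (x - y) * G y := by
          have hm : Measurable fun y => K (x - y) := hK.comp (measurable_const.sub measurable_id)
          rw [lintegral_add_left (hm.mul_const _), lintegral_mul_const _ hm]
      _ ≤ _ := by
          rw [lintegral_sub_left_eq_self (fun y => K y) x]
          gcongr
          exact mul_le_of_le_one_left' hKI
  have htot : ∫⁻ x, ∫⁻ y, K (x - y) * G y ≤ ENNReal.ofReal (A / (1 - r) * s ^ (1 - r)) := by
    rw [lintegral_lintegral_swap hKxy.aemeasurable]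
    calc _ = ∫⁻ y, (∫⁻ x, K x) * G y := by
          refine lintegral_congr fun y => ?_
          rw [lintegral_mul_const, lintegral_sub_right_eq_self (fun x => K x) y]
          exact hK.comp (measurable_id.sub measurable_const)
      _ ≤ ∫⁻ y, G y := lintegral_mono fun y => mul_le_of_le_one_left' hKI
      _ ≤ _ := (lintegral_indicator_le _ _).trans
          (lintegral_set_le hd hr0 hr1 hA hg.aemeasurable h hs hS)
  -- The L¹ bound of the upper part divided by b is exactly s, and c + b is the asserted threshold.
  set b := c / (1 - r) with hb
  have hbpos : 0 < b := by positivity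
  calc _ ≤ volume {x : E d | ENNReal.ofReal b ≤ ∫⁻ y, K (x - y) * G y} := by
        refine measure_mono fun x hx => ?_
        simp only [mem_ofPred_eq, Real.rpow_zero, ENNReal.ofReal_one, one_mul] at hx ⊢
        by_contra hcon
        rw [not_le] at hcon
        refine absurd hx (not_lt.mpr ?_)
        refine (hpt x).trans ((add_le_add le_rfl hcon.le).trans ?_)
        rw [← ENNReal.ofReal_add hcpos.le hbpos.le]
        apply ENNReal.ofReal_le_ofReal
        rw [hb, hc]
        apply le_of_eq
        field_simp
    _ ≤ (∫⁻ x, ∫⁻ y, K (x - y) * G y) / ENNReal.ofReal b :=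
        meas_ge_le_lintegral_div (Measurable.lintegral_prod_right' hKxy).aemeasurable
          (by simpa using hbpos) ENNReal.ofReal_ne_top
    _ ≤ ENNReal.ofReal (A / (1 - r) * s ^ (1 - r)) / ENNReal.ofReal b := by gcongr
    _ = ENNReal.ofReal s := by
        rw [← ENNReal.ofReal_div_of_pos hbpos]
        congr 1
        have : s ^ (1 - r) = s * s ^ (-r) := by
          nth_rewrite 2 [← Real.rpow_one s]
          rw [← Real.rpow_add hs]; ring_nf
        rw [this, hb, hc]
        have := (Real.rpow_pos_of_pos hs (-r)).ne'
        field_simp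

/-- Functions bounded by `C |x|^{-d r}` are weakly bounded. -/
theorem of_le_rpow (hd : 0 < d) (hr0 : 0 ≤ r) : ∃ C > 0, ∀ a > 0, ∀ f : E d → ℝ≥0∞,
    (∀ᵐ x, f x ≤ ENNReal.ofReal (a * ‖x‖ ^ (-(d * r)))) → WeakBound 0 r (C * a) f := by
  have : Nonempty (Fin d) := ⟨⟨0, hd⟩⟩
  have hN : Nontrivial (E d) := inferInstance
  set v := (volume (Metric.ball (0 : E d) 1)).toReal with hv
  have hvpos : 0 < v := ENNReal.toReal_pos (Metric.measure_ball_pos _ _ one_pos).ne'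
    measure_ball_lt_top.ne
  have hvb : volume (Metric.ball (0 : E d) 1) = ENNReal.ofReal v :=
    (ENNReal.ofReal_toReal measure_ball_lt_top.ne).symm
  have hd' : (0 : ℝ) < d := by exact_mod_cast hd
  refine ⟨v ^ r, by positivity, fun a ha f hf s hs => ?_⟩
  -- The radius of the ball of volume s.
  set R := (s / v) ^ (1 / (d : ℝ)) with hR
  have hRpos : 0 < R := by positivity
  have hRd : R ^ d = s / v := by
    rw [hR, ← Real.rpow_natCast, ← Real.rpow_mul (by positivity), one_div,
      inv_mul_cancel₀ hd'.ne', Real.rpow_one]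
  calc _ ≤ volume (Metric.ball (0 : E d) R) := by
        refine measure_mono_ae ?_
        filter_upwards [hf, ae_eq_zero_space (d := d)] with x hx hx0 hlt
        have hlt : ENNReal.ofReal (v ^ r * a * s ^ (-r)) < ENNReal.ofReal (‖x‖ ^ (0 : ℝ)) * f x := hlt
        change x ∈ Metric.ball (0 : E d) R
        simp only [Real.rpow_zero, ENNReal.ofReal_one, one_mul] at hlt
        have hxp := norm_pos_iff.mpr (hx0 hd)
        rw [mem_ball_zero_iff]
        by_contra hcon
        rw [not_lt] at hcon
        have hlt2 := hlt.trans_le hx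
        rw [ENNReal.ofReal_lt_ofReal_iff (by positivity)] at hlt2
        refine absurd hlt2 (not_lt.mpr ?_)
        have h1 : ‖x‖ ^ (-(d * r)) ≤ R ^ (-(d * r)) :=
          Real.rpow_le_rpow_of_nonpos hRpos hcon (by have := mul_nonneg hd'.le hr0; linarith)
        have h2 : R ^ (-(d * r)) = v ^ r * s ^ (-r) := by
          rw [show -(d * r) = d * (-r) by ring, Real.rpow_mul hRpos.le, Real.rpow_natCast, hRd,
            Real.div_rpow hs.le hvpos.le, Real.rpow_neg hvpos.le, div_inv_eq_mul, mul_comm]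
        calc _ ≤ a * R ^ (-(d * r)) := by gcongr
          _ = _ := by rw [h2]; ring
    _ = ENNReal.ofReal s := by
        rw [Measure.addHaar_ball _ _ hRpos.le, finrank_euclideanSpace, Fintype.card_fin, hRd, hvb,
          ← ENNReal.ofReal_mul (by positivity)]
        congr 1
        field_simp

end WeakBound

/-! ## The heat kernel -/

section HeatKernel

variable {d : ℕ}

theorem heatKernel_nonneg {t : ℝ} (ht : 0 < t) (x : E d) : 0 ≤ heatKernel t x := by
  unfold heatKernel
  positivity

theorem measurable_heatKernel_uncurry :
    Measurable (fun z : ℝ × E d => heatKernel z.1 z.2) := by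
  unfold heatKernel
  fun_prop

theorem measurable_heatKernel (t : ℝ) : Measurable (heatKernel t : E d → ℝ) := by
  unfold heatKernel
  fun_prop

theorem lintegral_exp_neg_mul_sq {c : ℝ} (hc : 0 < c) :
    ∫⁻ y : E d, ENNReal.ofReal (Real.exp (-c * ‖y‖ ^ 2)) =
      ENNReal.ofReal ((Real.pi / c) ^ (d / 2 : ℝ)) := by
  have h := GaussianFourier.integral_rexp_neg_mul_sq_norm (V := E d) hc
  rw [finrank_euclideanSpace, Fintype.card_fin] at h
  rw [← h, ofReal_integral_eq_lintegral_ofReal]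
  -- A non-integrable function has Bochner integral zero, which contradicts the positive value of
  -- the Gaussian integral.
  · by_contra hcon
    rw [integral_undef hcon] at h
    have : 0 < (Real.pi / c) ^ (d / 2 : ℝ) := by positivity
    linarith
  · exact Eventually.of_forall fun x => (Real.exp_pos _).le

theorem lintegral_heatKernel {t : ℝ} (ht : 0 < t) :
    ∫⁻ y : E d, ENNReal.ofReal (heatKernel t y) = 1 := by
  have h4 : 0 < 4 * Real.pi * t := by positivity
  unfold heatKernel
  simp_rw [ENNReal.ofReal_mul (Real.rpow_nonneg h4.le _)]
  rw [lintegral_const_mul' _ _ ENNReal.ofReal_ne_top, lintegral_exp_neg_mul_sq (by positivity),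
    ← ENNReal.ofReal_mul (by positivity)]
  have : Real.pi / (1 / (4 * t)) = 4 * Real.pi * t := by field_simp
  rw [this, ← Real.rpow_add h4]
  simp

theorem heatKernel_one_le (x : E d) : heatKernel 1 x ≤ Real.exp (-(1 / 4) * ‖x‖ ^ 2) := by
  unfold heatKernel
  have h1 : (4 * Real.pi * 1) ^ (-(d / 2 : ℝ)) ≤ 1 := by
    apply Real.rpow_le_one_of_one_le_of_nonpos
    · nlinarith [Real.pi_gt_three]
    · have : (0 : ℝ) ≤ d / 2 := by positivity
      linarith
  simp only [mul_one] at h1 ⊢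
  exact mul_le_of_le_one_left (Real.exp_pos _).le h1

/-- In both cases |x-y| is at least half of the larger of |x| and |y|, so the Gaussian decouples.
This makes the off-diagonal part of the heat flow an operator of rank one. -/
theorem heatKernel_one_sub_le {x y : E d} (h : ‖y‖ ≤ ‖x‖ / 2 ∨ 2 * ‖x‖ ≤ ‖y‖) :
    heatKernel 1 (x - y) ≤ Real.exp (-(1 / 32) * ‖x‖ ^ 2) * Real.exp (-(1 / 32) * ‖y‖ ^ 2) := by
  refine (heatKernel_one_le _).trans ?_
  rw [← Real.exp_add]
  apply Real.exp_le_exp.mpr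
  have hx := norm_nonneg x
  have hy := norm_nonneg y
  have h0 := norm_nonneg (x - y)
  rcases h with h | h
  · have h1 : ‖x‖ - ‖y‖ ≤ ‖x - y‖ := norm_sub_norm_le x y
    have h2 : ‖x‖ / 2 ≤ ‖x - y‖ := by linarith
    nlinarith
  · have h1 : ‖y‖ - ‖x‖ ≤ ‖x - y‖ := by rw [norm_sub_rev]; exact norm_sub_norm_le y x
    have h2 : ‖y‖ / 2 ≤ ‖x - y‖ := by linarith
    nlinarith

theorem exists_rpow_mul_exp_le {a c : ℝ} (ha : 0 ≤ a) (hc : 0 < c) :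
    ∃ C > 0, ∀ y : ℝ, 0 ≤ y → y ^ a * Real.exp (-c * y ^ 2) ≤ C := by
  obtain ⟨n, hn⟩ := exists_nat_ge a
  refine ⟨1 + n.factorial / c ^ n, by positivity, fun y hy => ?_⟩
  have h1 : (c * y ^ 2) ^ n / n.factorial ≤ Real.exp (c * y ^ 2) :=
    Real.pow_div_factorial_le_exp _ (by positivity) n
  have h2 : y ^ a ≤ 1 + (y ^ 2) ^ n := by
    rcases le_total y 1 with h | h
    · have := Real.rpow_le_one hy h ha
      have : 0 ≤ (y ^ 2) ^ n := by positivity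
      linarith
    · have h3 : y ^ a ≤ y ^ (n : ℝ) := Real.rpow_le_rpow_of_exponent_le h hn
      rw [Real.rpow_natCast] at h3
      have h4 : y ^ n ≤ (y ^ 2) ^ n := pow_le_pow_left₀ hy (by nlinarith) n
      linarith
  have h5 : Real.exp (c * y ^ 2) * Real.exp (-c * y ^ 2) = 1 := by
    rw [← Real.exp_add]; simp
  have h6 : (y ^ 2) ^ n ≤ n.factorial / c ^ n * Real.exp (c * y ^ 2) := by
    rw [div_le_iff₀ (by positivity), mul_pow] at h1
    rw [div_mul_eq_mul_div, le_div_iff₀ (by positivity)]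
    linarith
  have h7 : Real.exp (-c * y ^ 2) ≤ 1 := Real.exp_le_one_iff.mpr (by nlinarith [sq_nonneg y])
  have h8 := (Real.exp_pos (-c * y ^ 2)).le
  calc _ ≤ (1 + n.factorial / c ^ n * Real.exp (c * y ^ 2)) * Real.exp (-c * y ^ 2) := by
        gcongr
        linarith
    _ = Real.exp (-c * y ^ 2) + n.factorial / c ^ n *
        (Real.exp (c * y ^ 2) * Real.exp (-c * y ^ 2)) := by ring
    _ ≤ _ := by rw [h5]; linarith

end HeatKernel

/-- The heat flow of a nonnegative function. -/
noncomputable def eHeat {d : ℕ} (t : ℝ) (f : E d → ℝ≥0∞) (x : E d) : ℝ≥0∞ :=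
  ∫⁻ y, ENNReal.ofReal (heatKernel t (x - y)) * f y

/-! ## Smoothing estimates -/

namespace WeakBound

variable {d : ℕ} {k r A B k' r' : ℝ} {f g : E d → ℝ≥0∞}

/-- Interpolation with L^∞: for s ≥ 1 the threshold with r dominates the one with r', and for s ≤ 1
it dominates the supremum. -/
theorem of_bounded (hB : 0 ≤ B) (hr : r ≤ r') (h0 : 0 ≤ r) (hg : WeakBound 0 r' B g)
    (hb : ∀ x, g x ≤ ENNReal.ofReal B) : WeakBound 0 r B g := by
  intro s hs
  rcases le_total 1 s with h | h
  · refine (measure_mono ?_).trans (hg s hs)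
    intro x hx
    refine lt_of_le_of_lt (ENNReal.ofReal_le_ofReal ?_) hx
    have := Real.rpow_le_rpow_of_exponent_le h (neg_le_neg hr)
    gcongr
  · refine le_of_eq_of_le ?_ zero_le
    rw [← measure_empty (μ := (volume : Measure (E d)))]
    congr 1
    ext x
    simp only [Real.rpow_zero, ENNReal.ofReal_one, one_mul, mem_ofPred_eq, mem_empty_iff_false,
      iff_false, not_lt]
    refine (hb x).trans (ENNReal.ofReal_le_ofReal ?_)
    have : 1 ≤ s ^ (-r) := Real.one_le_rpow_of_pos_of_le_one_of_nonpos hs h (by linarith)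
    nlinarith

theorem norm_rpow_zero_weight (hd : 0 < d) {D : ℝ} (hD : 0 ≤ D) :
    ∃ C > 0, WeakBound 0 (D / d) C (fun x : E d => ENNReal.ofReal (‖x‖ ^ (-D))) := by
  have hd' : (0 : ℝ) < d := by exact_mod_cast hd
  obtain ⟨C, hC, h⟩ := of_le_rpow (d := d) (r := D / d) hd (by positivity)
  refine ⟨C * 1, by positivity, h 1 one_pos _ (Eventually.of_forall fun x => ?_)⟩
  rw [one_mul, mul_div_cancel₀ _ hd'.ne']

/-- Gaussian averages of weakly bounded functions are finite. -/
theorem gaussian_average (hd : 0 < d) (hr0 : 0 ≤ r) (hr1 : r < 1) (hK : k + d * r < d) :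
    ∃ C > 0, ∀ f : E d → ℝ≥0∞, Measurable f → ∀ A > 0, WeakBound k r A f →
      ∫⁻ y, ENNReal.ofReal (Real.exp (-(1 / 32) * ‖y‖ ^ 2)) * f y ≤ ENNReal.ofReal (C * A) := by
  have hd' : (0 : ℝ) < d := by exact_mod_cast hd
  -- For k ≥ 0 the factor |y|^{-k} is weakly bounded and is multiplied into the function, which
  -- yields the reciprocal exponent k/d + r < 1. For k ≤ 0 it grows at infinity and half of the
  -- Gaussian absorbs it.
  rcases le_total 0 k with hk | hk
  · obtain ⟨C, hC, hCb⟩ := norm_rpow_zero_weight hd hk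
    have hr' : k / d + r < 1 := by
      rw [← lt_sub_iff_add_lt, div_lt_iff₀ hd']; linarith
    have h1r : 0 < 1 - (k / d + r) := by linarith
    refine ⟨((Real.pi / (1 / 32)) ^ (d / 2 : ℝ) + 1 / (1 - (k / d + r))) * (2 ^ (k / d + r) * C),
      by positivity, fun f hf A hA hfA => ?_⟩
    have h1 := (hCb.mul hd hC.le (of_weight.mp hfA))
    have h2 : WeakBound 0 (k / d + r) (2 ^ (k / d + r) * (C * A)) f := by
      rw [add_zero] at h1
      refine h1.mono ?_
      filter_upwards [ae_eq_zero_space (d := d)] with x hx0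
      have hxp := norm_pos_iff.mpr (hx0 hd)
      rw [← mul_assoc, ← ENNReal.ofReal_mul (by positivity), ← Real.rpow_add hxp]
      simp
    have h3 := h2.lintegral_mul_le hd (by positivity) hr' (by positivity) hf.aemeasurable
      (K := fun y : E d => ENNReal.ofReal (Real.exp (-(1 / 32) * ‖y‖ ^ 2))) (by fun_prop)
      (M := 1) (I := (Real.pi / (1 / 32)) ^ (d / 2 : ℝ)) zero_le_one (by positivity)
      (fun x => ENNReal.ofReal_le_ofReal (Real.exp_le_one_iff.mpr (by nlinarith [sq_nonneg ‖x‖])))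
      (lintegral_exp_neg_mul_sq (by norm_num)).le
    refine h3.trans (le_of_eq ?_)
    ring_nf
  · obtain ⟨C, hC, hCb⟩ := exists_rpow_mul_exp_le (a := -k) (c := 1 / 64) (by linarith) (by norm_num)
    have h1r : 0 < 1 - r := by linarith
    refine ⟨C * (Real.pi / (1 / 64)) ^ (d / 2 : ℝ) + C / (1 - r), by positivity,
      fun f hf A hA hfA => ?_⟩
    have hpt : ∀ x : E d, ‖x‖ ^ (-k) * Real.exp (-(1 / 32) * ‖x‖ ^ 2) ≤
        C * Real.exp (-(1 / 64) * ‖x‖ ^ 2) := fun x => by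
      have e : Real.exp (-(1 / 32) * ‖x‖ ^ 2) =
          Real.exp (-(1 / 64) * ‖x‖ ^ 2) * Real.exp (-(1 / 64) * ‖x‖ ^ 2) := by
        rw [← Real.exp_add]; ring_nf
      rw [e, ← mul_assoc]
      have := hCb ‖x‖ (norm_nonneg x)
      gcongr
    set K : E d → ℝ≥0∞ := fun x =>
      ENNReal.ofReal (‖x‖ ^ (-k) * Real.exp (-(1 / 32) * ‖x‖ ^ 2)) with hKdef
    have hg := of_weight.mp hfA
    have hgm : Measurable fun x : E d => ENNReal.ofReal (‖x‖ ^ k) * f x := by fun_prop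
    have h3 := hg.lintegral_mul_le hd hr0 hr1 hA hgm.aemeasurable (K := K) (by fun_prop)
      (M := C) (I := C * (Real.pi / (1 / 64)) ^ (d / 2 : ℝ)) hC.le (by positivity)
      (fun x => ENNReal.ofReal_le_ofReal ((hpt x).trans (by
        have : Real.exp (-(1 / 64) * ‖x‖ ^ 2) ≤ 1 :=
          Real.exp_le_one_iff.mpr (by nlinarith [sq_nonneg ‖x‖])
        nlinarith)))
      (by
        calc _ ≤ ∫⁻ x : E d, ENNReal.ofReal C * ENNReal.ofReal (Real.exp (-(1 / 64) * ‖x‖ ^ 2)) := by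
              refine lintegral_mono fun x => ?_
              rw [← ENNReal.ofReal_mul hC.le]
              exact ENNReal.ofReal_le_ofReal (hpt x)
          _ = _ := by
              rw [lintegral_const_mul' _ _ ENNReal.ofReal_ne_top,
                lintegral_exp_neg_mul_sq (by norm_num), ← ENNReal.ofReal_mul hC.le])
    refine le_trans (lintegral_mono_ae ?_) h3
    filter_upwards [ae_eq_zero_space (d := d)] with x hx0
    have hxp := norm_pos_iff.mpr (hx0 hd)
    rw [← mul_assoc, hKdef, ← ENNReal.ofReal_mul (by positivity), mul_right_comm,
      ← Real.rpow_add hxp]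
    simp

theorem near_weight_le {k : ℝ} {x y : E d} (hx : 0 < ‖x‖) (h1 : ‖x‖ / 2 ≤ ‖y‖)
    (h2 : ‖y‖ ≤ 2 * ‖x‖) : ‖y‖ ^ (-k) ≤ 2 ^ |k| * ‖x‖ ^ (-k) := by
  have hy : 0 < ‖y‖ := by linarith
  rcases le_total 0 k with hk | hk
  · rw [abs_of_nonneg hk]
    calc ‖y‖ ^ (-k) ≤ (‖x‖ / 2) ^ (-k) :=
          Real.rpow_le_rpow_of_nonpos (by positivity) h1 (by linarith)
      _ = _ := by
          rw [Real.div_rpow hx.le (by norm_num), Real.rpow_neg (by norm_num : (0 : ℝ) ≤ 2),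
            div_inv_eq_mul, mul_comm]
  · rw [abs_of_nonpos hk]
    calc ‖y‖ ^ (-k) ≤ (2 * ‖x‖) ^ (-k) := Real.rpow_le_rpow hy.le h2 (by linarith)
      _ = _ := by rw [Real.mul_rpow (by norm_num) hx.le]

/-- Far from the diagonal the kernel decouples; near it |y| is comparable to |x|, so the weight can
be moved out of the integral at the price 2^{|k|}. The ball of radius 2|x| is kept because it
provides smallness near the origin. -/
theorem heat_split (hd : 0 < d) (k : ℝ) (f : E d → ℝ≥0∞) (hf : Measurable f) {x : E d}
    (hx : 0 < ‖x‖) :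
    eHeat 1 f x ≤ ENNReal.ofReal (Real.exp (-(1 / 32) * ‖x‖ ^ 2)) *
        (∫⁻ y, ENNReal.ofReal (Real.exp (-(1 / 32) * ‖y‖ ^ 2)) * f y) +
      ENNReal.ofReal (2 ^ |k| * ‖x‖ ^ (-k)) *
        ∫⁻ y, ENNReal.ofReal (heatKernel 1 (x - y)) *
          (Metric.ball (0 : E d) (2 * ‖x‖)).indicator (fun y => ENNReal.ofReal (‖y‖ ^ k) * f y) y := by
  rw [← lintegral_const_mul' _ _ ENNReal.ofReal_ne_top,
    ← lintegral_const_mul' _ _ ENNReal.ofReal_ne_top, ← lintegral_add_left (by fun_prop)]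
  refine lintegral_mono_ae ?_
  filter_upwards [ae_eq_zero_space (d := d)] with y hy0
  have hyp := norm_pos_iff.mpr (hy0 hd)
  by_cases h : ‖y‖ ≤ ‖x‖ / 2 ∨ 2 * ‖x‖ ≤ ‖y‖
  · refine le_add_right ?_
    rw [← mul_assoc, ← ENNReal.ofReal_mul (by positivity)]
    gcongr
    exact heatKernel_one_sub_le h
  · rw [not_or, not_le, not_le] at h
    refine le_add_left ?_
    have hmem : y ∈ Metric.ball (0 : E d) (2 * ‖x‖) := by
      rw [mem_ball_zero_iff]; exact h.2
    rw [indicator_of_mem hmem, mul_left_comm]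
    refine mul_le_mul_right ?_ _
    rw [← mul_assoc, ← ENNReal.ofReal_mul (by positivity)]
    have h1 : 1 ≤ 2 ^ |k| * ‖x‖ ^ (-k) * ‖y‖ ^ k := by
      have h2 := near_weight_le (k := k) hx h.1.le h.2.le
      have h3 : ‖y‖ ^ (-k) * ‖y‖ ^ k = 1 := by rw [← Real.rpow_add hyp]; simp
      rw [← h3]
      gcongr
    calc f y = 1 * f y := (one_mul _).symm
      _ ≤ _ := by
        gcongr
        rw [← ENNReal.ofReal_one]
        exact ENNReal.ofReal_le_ofReal h1

/-- The far part of `heat_split` is a finite Gaussian average times a Gaussian in x. In the near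
part the surplus weight |x|^{k₂-k₁} is either paid for by smallness of the integral over the ball or
multiplied in as a weakly bounded factor. -/
theorem eHeat_one (hd : 0 < d) {k₁ r₁ k₂ r₂ : ℝ} (h01 : 0 ≤ r₁) (h11 : r₁ < 1)
    (hK₁ : k₁ + d * r₁ < d) (hk : k₂ ≤ k₁) (h02 : 0 ≤ r₂) (h12 : r₂ ≤ 1) (hK₂ : 0 ≤ k₂ + d * r₂)
    (hK : k₂ + d * r₂ ≤ k₁ + d * r₁) :
    ∃ C > 0, ∀ f : E d → ℝ≥0∞, Measurable f → ∀ A > 0, WeakBound k₁ r₁ A f →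
      WeakBound k₂ r₂ (C * A) (eHeat 1 f) := by
  have hd' : (0 : ℝ) < d := by exact_mod_cast hd
  have h1r : 0 < 1 - r₁ := by linarith
  have : Nonempty (Fin d) := ⟨⟨0, hd⟩⟩
  have hN : Nontrivial (E d) := inferInstance
  obtain ⟨CJ, hCJ, hJ⟩ := gaussian_average hd h01 h11 hK₁
  obtain ⟨CE, hCE, hE⟩ := exists_rpow_mul_exp_le (a := k₂ + d * r₂) (c := 1 / 32) hK₂ (by norm_num)
  obtain ⟨CP, hCP, hP⟩ := of_le_rpow (d := d) hd h02
  set c₀ := 1 + 1 / (1 - r₁) with hc₀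
  have hc₀pos : 0 < c₀ := by positivity
  have hpow : ∀ x : E d, 0 < ‖x‖ → ‖x‖ ^ k₂ * Real.exp (-(1 / 32) * ‖x‖ ^ 2) ≤
      CE * ‖x‖ ^ (-(d * r₂)) := fun x hx => by
    have h1 := hE ‖x‖ hx.le
    have h2 : ‖x‖ ^ k₂ = ‖x‖ ^ (k₂ + d * r₂) * ‖x‖ ^ (-(d * r₂)) := by
      rw [← Real.rpow_add hx]; ring_nf
    rw [h2, mul_right_comm]
    gcongr
  -- the far part
  have hfar : ∀ f : E d → ℝ≥0∞, Measurable f → ∀ A > 0, WeakBound k₁ r₁ A f →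
      WeakBound 0 r₂ (CP * (CE * (CJ * A))) (fun x : E d => ENNReal.ofReal (‖x‖ ^ k₂) *
        (ENNReal.ofReal (Real.exp (-(1 / 32) * ‖x‖ ^ 2)) *
        (∫⁻ y, ENNReal.ofReal (Real.exp (-(1 / 32) * ‖y‖ ^ 2)) * f y))) := by
    intro f hf A hA hfA
    refine hP _ (by positivity) _ ?_
    filter_upwards [ae_eq_zero_space (d := d)] with x hx0
    have hxp := norm_pos_iff.mpr (hx0 hd)
    rw [← mul_assoc, ← ENNReal.ofReal_mul (by positivity)]
    refine (mul_le_mul' (ENNReal.ofReal_le_ofReal (hpow x hxp)) (hJ f hf A hA hfA)).trans ?_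
    rw [← ENNReal.ofReal_mul (by positivity)]
    apply ENNReal.ofReal_le_ofReal
    apply le_of_eq
    ring
  -- the near part
  have hnear : ∃ CN > 0, ∀ g : E d → ℝ≥0∞, Measurable g → ∀ A > 0, WeakBound 0 r₁ A g →
      WeakBound 0 r₂ (CN * A) (fun x : E d => ENNReal.ofReal (‖x‖ ^ k₂) *
        (ENNReal.ofReal (2 ^ |k₁| * ‖x‖ ^ (-k₁)) *
        ∫⁻ y, ENNReal.ofReal (heatKernel 1 (x - y)) *
          (Metric.ball (0 : E d) (2 * ‖x‖)).indicator g y)) := by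
    have hbd : ∀ g : E d → ℝ≥0∞, Measurable g → ∀ A > 0, WeakBound 0 r₁ A g → ∀ x,
        ∫⁻ y, ENNReal.ofReal (heatKernel 1 (x - y)) * g y ≤ ENNReal.ofReal (c₀ * A) := by
      intro g hg A hA hgA x
      refine hgA.lintegral_mul_le hd h01 h11 hA hg.aemeasurable
        (K := fun y => ENNReal.ofReal (heatKernel 1 (x - y)))
        ((measurable_heatKernel 1).comp (measurable_const.sub measurable_id)).ennreal_ofReal
        zero_le_one zero_le_one (fun y => ENNReal.ofReal_le_ofReal ?_) ?_
      · exact (heatKernel_one_le _).trans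
          (Real.exp_le_one_iff.mpr (by nlinarith [sq_nonneg ‖x - y‖]))
      · rw [lintegral_sub_left_eq_self (fun y => ENNReal.ofReal (heatKernel 1 y)) x,
          lintegral_heatKernel one_pos, ENNReal.ofReal_one]
    rcases le_or_gt (d * r₂) (k₁ - k₂) with hcase | hcase
    -- Here a pointwise bound suffices: the near integral has to be O(|x|^m) with 0 ≤ m ≤ d(1-r₁).
    -- For |x| ≥ 1 this follows from its boundedness, for |x| ≤ 1 from integrating g over the ball.
    · set m := k₁ - k₂ - d * r₂ with hm
      have hm0 : 0 ≤ m := by linarith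
      have hm1 : m ≤ d * (1 - r₁) := by rw [hm]; linarith
      set v := (volume (Metric.ball (0 : E d) 1)).toReal with hv
      have hvpos : 0 < v := ENNReal.toReal_pos (Metric.measure_ball_pos _ _ one_pos).ne'
        measure_ball_lt_top.ne
      have hvb : volume (Metric.ball (0 : E d) 1) = ENNReal.ofReal v :=
        (ENNReal.ofReal_toReal measure_ball_lt_top.ne).symm
      set cB := 1 / (1 - r₁) * (v * 2 ^ d) ^ (1 - r₁) with hcB
      have hcBpos : 0 < cB := by positivity
      refine ⟨CP * (2 ^ |k₁| * (c₀ + cB)), by positivity, fun g hg A hA hgA => ?_⟩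
      have := hP (2 ^ |k₁| * (c₀ + cB) * A) (by positivity) (fun x : E d => ENNReal.ofReal (‖x‖ ^ k₂) *
        (ENNReal.ofReal (2 ^ |k₁| * ‖x‖ ^ (-k₁)) *
        ∫⁻ y, ENNReal.ofReal (heatKernel 1 (x - y)) *
          (Metric.ball (0 : E d) (2 * ‖x‖)).indicator g y)) ?_
      · rwa [← mul_assoc] at this
      filter_upwards [ae_eq_zero_space (d := d)] with x hx0
      have hxp := norm_pos_iff.mpr (hx0 hd)
      have hM1 : ∫⁻ y, ENNReal.ofReal (heatKernel 1 (x - y)) *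
          (Metric.ball (0 : E d) (2 * ‖x‖)).indicator g y ≤ ENNReal.ofReal (c₀ * A) := by
        refine le_trans (lintegral_mono fun y => ?_) (hbd g hg A hA hgA x)
        exact mul_le_mul_right (indicator_le_self _ _ _) _
      have hM2 : ∫⁻ y, ENNReal.ofReal (heatKernel 1 (x - y)) *
          (Metric.ball (0 : E d) (2 * ‖x‖)).indicator g y ≤
          ENNReal.ofReal (cB * ‖x‖ ^ (d * (1 - r₁)) * A) := by
        calc _ ≤ ∫⁻ y, (Metric.ball (0 : E d) (2 * ‖x‖)).indicator g y := by
              refine lintegral_mono fun y => mul_le_of_le_one_left' ?_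
              rw [← ENNReal.ofReal_one]
              exact ENNReal.ofReal_le_ofReal ((heatKernel_one_le _).trans
                (Real.exp_le_one_iff.mpr (by nlinarith [sq_nonneg ‖x - y‖])))
          _ ≤ ∫⁻ y in Metric.ball (0 : E d) (2 * ‖x‖), g y := lintegral_indicator_le _ _
          _ ≤ ENNReal.ofReal (A / (1 - r₁) * (v * 2 ^ d * ‖x‖ ^ d) ^ (1 - r₁)) := by
              refine hgA.lintegral_set_le hd h01 h11 hA hg.aemeasurable (by positivity) ?_
              rw [Measure.addHaar_ball _ _ (by positivity), finrank_euclideanSpace,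
                Fintype.card_fin, hvb, ← ENNReal.ofReal_mul (by positivity)]
              apply ENNReal.ofReal_le_ofReal
              apply le_of_eq
              ring
          _ = _ := by
              congr 1
              rw [Real.mul_rpow (by positivity) (by positivity), hcB, ← Real.rpow_natCast ‖x‖,
                ← Real.rpow_mul hxp.le]
              ring
      have hM : ∫⁻ y, ENNReal.ofReal (heatKernel 1 (x - y)) *
          (Metric.ball (0 : E d) (2 * ‖x‖)).indicator g y ≤
          ENNReal.ofReal ((c₀ + cB) * ‖x‖ ^ m * A) := by
        rcases le_total 1 ‖x‖ with h | h
        · refine hM1.trans (ENNReal.ofReal_le_ofReal ?_)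
          have : 1 ≤ ‖x‖ ^ m := Real.one_le_rpow h hm0
          gcongr
          nlinarith
        · refine hM2.trans (ENNReal.ofReal_le_ofReal ?_)
          have : ‖x‖ ^ (d * (1 - r₁)) ≤ ‖x‖ ^ m := Real.rpow_le_rpow_of_exponent_ge hxp h hm1
          gcongr
          linarith
      rw [← mul_assoc, ← ENNReal.ofReal_mul (by positivity)]
      refine (mul_le_mul_right hM _).trans ?_
      rw [← ENNReal.ofReal_mul (by positivity)]
      apply ENNReal.ofReal_le_ofReal
      apply le_of_eq
      have e : ‖x‖ ^ (-(d * r₂)) = ‖x‖ ^ k₂ * ‖x‖ ^ (-k₁) * ‖x‖ ^ m := by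
        rw [← Real.rpow_add hxp, ← Real.rpow_add hxp]
        congr 1
        rw [hm]; ring
      rw [e]
      ring
    · set D := k₁ - k₂ with hD
      have hD0 : 0 ≤ D := by linarith
      obtain ⟨CD, hCD, hDb⟩ := norm_rpow_zero_weight hd hD0
      have hDd : D / d < r₂ := by rw [div_lt_iff₀ hd']; linarith
      -- The factor |x|^{-D} uses up D/d of the reciprocal exponent r₂. The rest is at most r₁, so
      -- it is available from the weak bound of the convolution together with its boundedness.
      have hrr : r₂ - D / d ≤ r₁ := by
        rw [sub_le_iff_le_add, ← sub_le_iff_le_add', le_div_iff₀ hd', hD]; linarith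
      refine ⟨2 ^ |k₁| * (2 ^ r₂ * (CD * c₀)), by positivity, fun g hg A hA hgA => ?_⟩
      have h1 := hgA.conv hd h01 h11 hA hg (K := fun x => ENNReal.ofReal (heatKernel 1 x))
        (measurable_heatKernel 1).ennreal_ofReal (lintegral_heatKernel one_pos).le
      have h2 := h1.of_bounded (r := r₂ - D / d) (by positivity) hrr (by linarith) (hbd g hg A hA hgA)
      have h3 := (hDb.mul hd hCD.le h2).const_mul (c := 2 ^ |k₁|) (by positivity)
      rw [add_zero, show D / d + (r₂ - D / d) = r₂ by ring] at h3
      have e : 2 ^ |k₁| * (2 ^ r₂ * (CD * c₀)) * A = 2 ^ |k₁| * (2 ^ r₂ * (CD * (c₀ * A))) := by ring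
      rw [e]
      refine h3.mono ?_
      filter_upwards [ae_eq_zero_space (d := d)] with x hx0
      have hxp := norm_pos_iff.mpr (hx0 hd)
      rw [← mul_assoc, ← mul_assoc, ← ENNReal.ofReal_mul (by positivity),
        ← ENNReal.ofReal_mul (by positivity)]
      have e2 : ‖x‖ ^ k₂ * (2 ^ |k₁| * ‖x‖ ^ (-k₁)) = 2 ^ |k₁| * ‖x‖ ^ (-D) := by
        rw [mul_left_comm, ← Real.rpow_add hxp, hD]
        ring_nf
      rw [e2]
      refine mul_le_mul_right (lintegral_mono fun y => ?_) _
      exact mul_le_mul_right (indicator_le_self _ _ _) _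
  obtain ⟨CN, hCN, hnear⟩ := hnear
  refine ⟨2 * (CP * (CE * CJ) + CN), by positivity, fun f hf A hA hfA => ?_⟩
  have hg := of_weight.mp hfA
  have hgm : Measurable fun x : E d => ENNReal.ofReal (‖x‖ ^ k₁) * f x := by fun_prop
  have h1 := (hfar f hf A hA hfA).add (by positivity) (by positivity) h12 (hnear _ hgm A hA hg)
  rw [of_weight]
  have e : 2 * (CP * (CE * CJ) + CN) * A = 2 * (CP * (CE * (CJ * A)) + CN * A) := by ring
  rw [e]
  refine h1.mono ?_
  filter_upwards [ae_eq_zero_space (d := d)] with x hx0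
  have hxp := norm_pos_iff.mpr (hx0 hd)
  rw [← mul_add]
  exact mul_le_mul_right (heat_split hd k₁ f hf hxp) _

end WeakBound

/-! ### Parabolic scaling and smoothing at all times -/

section EHeat

variable {d : ℕ}

theorem eHeat_mono_ae {t : ℝ} {f g : E d → ℝ≥0∞} (h : f ≤ᵐ[volume] g) (x : E d) :
    eHeat t f x ≤ eHeat t g x := by
  refine lintegral_mono_ae ?_
  filter_upwards [h] with y hy
  exact mul_le_mul_right hy _

theorem eHeat_congr_ae {t : ℝ} {f g : E d → ℝ≥0∞} (h : f =ᵐ[volume] g) : eHeat t f = eHeat t g := by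
  ext x
  exact le_antisymm (eHeat_mono_ae h.le x) (eHeat_mono_ae h.symm.le x)

theorem lintegral_comp_smul_pos {l : ℝ} (hl : 0 < l) (F : E d → ℝ≥0∞) :
    ∫⁻ y, F y = ENNReal.ofReal (l ^ d) * ∫⁻ y, F (l • y) := by
  have h1 : ∫⁻ y, F (l • y) = ENNReal.ofReal (l ^ d)⁻¹ * ∫⁻ y, F y := by
    have h := (Homeomorph.smulOfNeZero l hl.ne').measurableEmbedding.lintegral_map
      (μ := (volume : Measure (E d))) F
    have h2 : Measure.map (⇑(Homeomorph.smulOfNeZero l hl.ne')) (volume : Measure (E d)) =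
        ENNReal.ofReal |(l ^ d)⁻¹| • volume := by
      have := Measure.map_addHaar_smul (volume : Measure (E d)) hl.ne'
      rwa [finrank_euclideanSpace, Fintype.card_fin] at this
    rw [h2, lintegral_smul_measure, abs_of_pos (by positivity)] at h
    exact h.symm
  rw [h1, ← mul_assoc, ← ENNReal.ofReal_mul (by positivity), mul_inv_cancel₀ (by positivity)]
  simp

theorem heatKernel_smul {l : ℝ} (hl : 0 < l) (x : E d) :
    l ^ d * heatKernel (l ^ 2) (l • x) = heatKernel 1 x := by
  unfold heatKernel
  rw [norm_smul, Real.norm_of_nonneg hl.le]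
  have e1 : (4 * Real.pi * l ^ 2) ^ (-(d / 2 : ℝ)) = (4 * Real.pi * 1) ^ (-(d / 2 : ℝ)) * (l ^ d)⁻¹ := by
    rw [mul_one, Real.mul_rpow (by positivity) (by positivity), ← Real.rpow_natCast l 2,
      ← Real.rpow_mul hl.le, ← Real.rpow_natCast l d, ← Real.rpow_neg hl.le]
    congr 2
    push_cast
    ring
  have e2 : -(1 / (4 * l ^ 2)) * (l * ‖x‖) ^ 2 = -(1 / (4 * 1)) * ‖x‖ ^ 2 := by field_simp
  rw [e1, e2]
  have : l ^ d ≠ 0 := by positivity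
  field_simp

theorem eHeat_smul {l : ℝ} (hl : 0 < l) (f : E d → ℝ≥0∞) (x : E d) :
    eHeat (l ^ 2) f (l • x) = eHeat 1 (fun y => f (l • y)) x := by
  unfold eHeat
  rw [lintegral_comp_smul_pos hl, ← lintegral_const_mul' _ _ ENNReal.ofReal_ne_top]
  refine lintegral_congr fun y => ?_
  rw [← mul_assoc, ← ENNReal.ofReal_mul (by positivity), ← smul_sub, heatKernel_smul hl]

namespace WeakBound

variable {k r A B k' r' : ℝ} {f g : E d → ℝ≥0∞}

/-- The quasi-norm is homogeneous under dilations, of degree -(k + dr). This is why pairs enter all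
powers of time through k + dr alone. -/
theorem dilate {l : ℝ} (hl : 0 < l) (hf : WeakBound k r A f) :
    WeakBound k r (l ^ (-(k + d * r)) * A) (fun x => f (l • x)) := by
  intro s hs
  have hs' : 0 < l ^ d * s := by positivity
  have h := hf _ hs'
  have e : {x : E d | ENNReal.ofReal (l ^ (-(k + d * r)) * A * s ^ (-r)) <
      ENNReal.ofReal (‖x‖ ^ k) * f (l • x)} = (l • ·) ⁻¹' {x : E d | ENNReal.ofReal
        (A * (l ^ d * s) ^ (-r)) < ENNReal.ofReal (‖x‖ ^ k) * f x} := by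
    ext x
    simp only [mem_ofPred_eq, mem_preimage]
    rw [norm_smul, Real.norm_of_nonneg hl.le, Real.mul_rpow hl.le (norm_nonneg x),
      ENNReal.ofReal_mul (by positivity : 0 ≤ l ^ k), mul_assoc (ENNReal.ofReal (l ^ k))]
    have e1 : A * (l ^ d * s) ^ (-r) = l ^ k * (l ^ (-(k + d * r)) * A * s ^ (-r)) := by
      rw [Real.mul_rpow (by positivity) hs.le, ← Real.rpow_natCast, ← Real.rpow_mul hl.le]
      have : l ^ (d * (-r)) = l ^ k * l ^ (-(k + d * r)) := by
        rw [← Real.rpow_add hl]; ring_nf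
      rw [this]; ring
    rw [e1, ENNReal.ofReal_mul (by positivity : 0 ≤ l ^ k),
      ENNReal.mul_lt_mul_iff_right (by simp; positivity) ENNReal.ofReal_ne_top]
  rw [e, Measure.addHaar_preimage_smul _ hl.ne', finrank_euclideanSpace, Fintype.card_fin,
    abs_of_pos (by positivity)]
  calc _ ≤ ENNReal.ofReal (l ^ d)⁻¹ * ENNReal.ofReal (l ^ d * s) := by gcongr
    _ = _ := by
      rw [← ENNReal.ofReal_mul (by positivity)]
      congr 1
      field_simp

/-- Smoothing of the heat flow between weighted weak Lebesgue spaces. -/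
theorem eHeat (hd : 0 < d) {k₁ r₁ k₂ r₂ : ℝ} (h01 : 0 ≤ r₁) (h11 : r₁ < 1)
    (hK₁ : k₁ + d * r₁ < d) (hk : k₂ ≤ k₁) (h02 : 0 ≤ r₂) (h12 : r₂ ≤ 1) (hK₂ : 0 ≤ k₂ + d * r₂)
    (hK : k₂ + d * r₂ ≤ k₁ + d * r₁) :
    ∃ C > 0, ∀ t > 0, ∀ f : E d → ℝ≥0∞, AEMeasurable f → ∀ A > 0, WeakBound k₁ r₁ A f →
      WeakBound k₂ r₂ (C * A * t ^ (-((k₁ + d * r₁) - (k₂ + d * r₂)) / 2)) (eHeat t f) := by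
  obtain ⟨C, hC, h⟩ := eHeat_one hd h01 h11 hK₁ hk h02 h12 hK₂ hK
  refine ⟨C, hC, fun t ht f hf A hA hfA => ?_⟩
  have hfA' : WeakBound k₁ r₁ A (hf.mk f) := hfA.mono hf.ae_eq_mk.symm.le
  rw [eHeat_congr_ae hf.ae_eq_mk]
  set g := hf.mk f with hg
  have hgm : Measurable g := hf.measurable_mk
  have hl : 0 < √t := Real.sqrt_pos.mpr ht
  -- Dilating by √t, applying the estimate at time one and dilating back produces the power of t.
  have h1 := h _ (hgm.comp (measurable_const_smul (√t))) _ (by positivity) (hfA'.dilate hl)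
  have h2 := h1.dilate (l := (√t)⁻¹) (by positivity)
  have e : ∀ x, _root_.eHeat t g x = _root_.eHeat 1 (g ∘ fun x => √t • x) ((√t)⁻¹ • x) := by
    intro x
    have := eHeat_smul hl g ((√t)⁻¹ • x)
    rw [Real.sq_sqrt ht.le, smul_smul, mul_inv_cancel₀ hl.ne', one_smul] at this
    exact this
  have e2 : (fun x => _root_.eHeat 1 (g ∘ fun x => √t • x) ((√t)⁻¹ • x)) = _root_.eHeat t g := by
    ext x; exact (e x).symm
  rw [e2] at h2
  refine h2.mono_const (le_of_eq ?_)
  have e3 : t ^ (-((k₁ + d * r₁) - (k₂ + d * r₂)) / 2) =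
      (√t)⁻¹ ^ (-(k₂ + d * r₂)) * √t ^ (-(k₁ + d * r₁)) := by
    rw [Real.inv_rpow hl.le, ← Real.rpow_neg hl.le, ← Real.rpow_add hl, Real.sqrt_eq_rpow,
      ← Real.rpow_mul ht.le]
    congr 1
    ring
  rw [e3]
  ring

/-- Minkowski's inequality for weak bounds. -/
theorem lintegral_time (hr0 : 0 ≤ r) (hr1 : r < 1) (hd : 0 < d) {μ : Measure ℝ} [SFinite μ]
    {Φ : ℝ → E d → ℝ≥0∞} (hΦ : Measurable (Function.uncurry Φ)) {b : ℝ → ℝ}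
    (hb : ∀ᵐ τ ∂μ, 0 < b τ ∧ WeakBound k r (b τ) (Φ τ)) {I : ℝ} (hI : 0 < I)
    (hbI : ∫⁻ τ, ENNReal.ofReal (b τ) ∂μ ≤ ENNReal.ofReal I) :
    WeakBound k r (2 / (1 - r) * I) (fun x => ∫⁻ τ, Φ τ x ∂μ) := by
  have h1r : 0 < 1 - r := by linarith
  intro s hs
  -- The factor 2 provides the strict contradiction at the end.
  set c := 2 / (1 - r) * I * s ^ (-r) with hc
  have hcpos : 0 < c := by positivity
  set F : E d → ℝ≥0∞ := fun x => ENNReal.ofReal (‖x‖ ^ k) * ∫⁻ τ, Φ τ x ∂μ with hF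
  have hFm : Measurable F := by
    refine Measurable.mul (by fun_prop) ?_
    exact Measurable.lintegral_prod_left' hΦ
  have hSm : MeasurableSet {x | ENNReal.ofReal c < F x} := measurableSet_lt measurable_const hFm
  by_contra hcon
  rw [not_le] at hcon
  -- Duality in place of a norm: on a subset S of finite measure m > s the integral of F is at least
  -- c m, whereas Tonelli and the bound for integrals over sets of measure m give at most I
  -- m^{1-r}/(1-r).
  obtain ⟨S, hS, hSsub, hlt, hfin⟩ := Measure.exists_subset_measure_lt_top hSm hcon
  set m := (volume S).toReal with hm
  have hmS : volume S = ENNReal.ofReal m := (ENNReal.ofReal_toReal hfin.ne).symm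
  have hsm : s < m := by
    rw [hmS] at hlt
    exact (ENNReal.ofReal_lt_ofReal_iff_of_nonneg hs.le).mp hlt
  have hm0 : 0 < m := hs.trans hsm
  have hup : ∫⁻ x in S, F x ≤ ENNReal.ofReal (I / (1 - r) * m ^ (1 - r)) := by
    calc _ = ∫⁻ x in S, ∫⁻ τ, ENNReal.ofReal (‖x‖ ^ k) * Φ τ x ∂μ := by
          simp_rw [hF, lintegral_const_mul' _ _ ENNReal.ofReal_ne_top]
      _ = ∫⁻ τ, (∫⁻ x in S, ENNReal.ofReal (‖x‖ ^ k) * Φ τ x) ∂μ := by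
          rw [lintegral_lintegral_swap]
          refine (Measurable.mul (by fun_prop) ?_).aemeasurable
          exact hΦ.comp measurable_swap
      _ ≤ ∫⁻ τ, ENNReal.ofReal (b τ) * ENNReal.ofReal (1 / (1 - r) * m ^ (1 - r)) ∂μ := by
          refine lintegral_mono_ae ?_
          filter_upwards [hb] with τ hτ
          have hm1 : Measurable fun x : E d => ENNReal.ofReal (‖x‖ ^ k) * Φ τ x :=
            Measurable.mul (by fun_prop) (hΦ.comp measurable_prodMk_left)
          refine ((of_weight.mp hτ.2).lintegral_set_le hd hr0 hr1 hτ.1 hm1.aemeasurable hm0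
            hmS.le).trans (le_of_eq ?_)
          rw [← ENNReal.ofReal_mul hτ.1.le]
          congr 1
          ring
      _ = (∫⁻ τ, ENNReal.ofReal (b τ) ∂μ) * ENNReal.ofReal (1 / (1 - r) * m ^ (1 - r)) :=
          lintegral_mul_const' _ _ ENNReal.ofReal_ne_top
      _ ≤ ENNReal.ofReal I * ENNReal.ofReal (1 / (1 - r) * m ^ (1 - r)) := by gcongr
      _ = _ := by
          rw [← ENNReal.ofReal_mul hI.le]
          congr 1
          ring
  have hlow : ENNReal.ofReal (c * m) ≤ ∫⁻ x in S, F x := by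
    calc _ = ∫⁻ x in S, ENNReal.ofReal c := by
          rw [setLIntegral_const, hmS, ENNReal.ofReal_mul hcpos.le]
      _ ≤ _ := setLIntegral_mono' hS fun x hx => (hSsub hx).le
  have h := hlow.trans hup
  rw [ENNReal.ofReal_le_ofReal_iff (by positivity)] at h
  have e : m ^ (1 - r) = m * m ^ (-r) := by
    nth_rewrite 2 [← Real.rpow_one m]
    rw [← Real.rpow_add hm0]; ring_nf
  have h2 : m ^ (-r) ≤ s ^ (-r) := Real.rpow_le_rpow_of_nonpos hs hsm.le (by linarith)
  have h3 : 0 < s ^ (-r) := by positivity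
  rw [e, hc] at h
  have h4 : I / (1 - r) * (m * m ^ (-r)) ≤ I / (1 - r) * (m * s ^ (-r)) := by gcongr
  have h5 : 2 / (1 - r) * I * s ^ (-r) * m = 2 * (I / (1 - r) * (m * s ^ (-r))) := by ring
  have h6 : 0 < I / (1 - r) * (m * s ^ (-r)) := by positivity
  linarith

end WeakBound

end EHeat

/-! ## Time integrals -/

theorem rpow_le_two_rpow_abs {x t : ℝ} (ht : 0 < t) (h1 : t / 2 ≤ x) (h2 : x ≤ t) (b : ℝ) :
    x ^ (-b) ≤ 2 ^ |b| * t ^ (-b) := by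
  have hx : 0 < x := by linarith
  rcases le_total 0 b with hb | hb
  · rw [abs_of_nonneg hb]
    calc x ^ (-b) ≤ (t / 2) ^ (-b) := Real.rpow_le_rpow_of_nonpos (by positivity) h1 (by linarith)
      _ = _ := by
        rw [Real.div_rpow ht.le (by norm_num), Real.rpow_neg (by norm_num : (0 : ℝ) ≤ 2),
          div_inv_eq_mul, mul_comm]
  · have h3 : x ^ (-b) ≤ t ^ (-b) := Real.rpow_le_rpow hx.le h2 (by linarith)
    have h4 : (1 : ℝ) ≤ 2 ^ |b| := Real.one_le_rpow (by norm_num) (abs_nonneg b)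
    have h5 : 0 ≤ t ^ (-b) := by positivity
    nlinarith

theorem lintegral_rpow_Ioo {t a : ℝ} (ht : 0 < t) (ha : a < 1) :
    ∫⁻ τ in Ioo 0 t, ENNReal.ofReal (τ ^ (-a)) = ENNReal.ofReal (t ^ (1 - a) / (1 - a)) := by
  have h := integral_rpow (a := 0) (b := t) (r := -a) (Or.inl (by linarith))
  have hi : IntervalIntegrable (fun x : ℝ => x ^ (-a)) volume 0 t :=
    intervalIntegral.intervalIntegrable_rpow' (by linarith)
  rw [intervalIntegral.integral_of_le ht.le, ← setIntegral_congr_set Ioo_ae_eq_Ioc] at h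
  rw [← ofReal_integral_eq_lintegral_ofReal, h]
  · congr 1
    rw [Real.zero_rpow (by linarith), show -a + 1 = 1 - a by ring, sub_zero]
  · exact ((intervalIntegrable_iff_integrableOn_Ioc_of_le ht.le).mp hi).mono_set Ioo_subset_Ioc_self
  · filter_upwards [self_mem_ae_restrict measurableSet_Ioo] with τ hτ
    exact Real.rpow_nonneg hτ.1.le _

/-- On the first half of the interval t-τ is comparable to t. The constant depends on the upper
bound a₁ and not on a; this yields estimates uniform in the order ρ. -/
theorem lintegral_time_left {t a a₁ b : ℝ} (ht : 0 < t) (ha : a ≤ a₁) (ha₁ : a₁ < 1) :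
    ∫⁻ τ in Ioo 0 (t / 2), ENNReal.ofReal ((t - τ) ^ (-b) * τ ^ (-a)) ≤
      ENNReal.ofReal (2 ^ |b| / (1 - a₁) * t ^ (1 - a - b)) := by
  have h1 : 0 < 1 - a₁ := by linarith
  have h2 : 0 < 1 - a := by linarith
  calc _ ≤ ∫⁻ τ in Ioo 0 (t / 2), ENNReal.ofReal (2 ^ |b| * t ^ (-b)) * ENNReal.ofReal (τ ^ (-a)) := by
        refine setLIntegral_mono' measurableSet_Ioo fun τ hτ => ?_
        rw [← ENNReal.ofReal_mul (by positivity)]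
        apply ENNReal.ofReal_le_ofReal
        have := rpow_le_two_rpow_abs ht (x := t - τ) (by linarith [hτ.2]) (by linarith [hτ.1]) b
        have h3 : 0 ≤ τ ^ (-a) := Real.rpow_nonneg hτ.1.le _
        gcongr
    _ = ENNReal.ofReal (2 ^ |b| * t ^ (-b) * ((t / 2) ^ (1 - a) / (1 - a))) := by
        rw [lintegral_const_mul' _ _ ENNReal.ofReal_ne_top, lintegral_rpow_Ioo (by positivity)
          (by linarith), ← ENNReal.ofReal_mul (by positivity)]
    _ ≤ _ := by
        apply ENNReal.ofReal_le_ofReal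
        have h3 : (t / 2) ^ (1 - a) ≤ t ^ (1 - a) :=
          Real.rpow_le_rpow (by positivity) (by linarith) h2.le
        have h4 : t ^ (1 - a - b) = t ^ (-b) * t ^ (1 - a) := by
          rw [← Real.rpow_add ht]; ring_nf
        rw [h4]
        calc _ ≤ 2 ^ |b| * t ^ (-b) * (t ^ (1 - a) / (1 - a₁)) := by gcongr
          _ = _ := by ring

/-- On the second half τ is comparable to t, and after reflection only the singularity at τ = t has
to be integrable. The constant is again uniform in a. -/
theorem lintegral_time_right {t a a₁ b : ℝ} (ht : 0 < t) (ha : |a| ≤ a₁) (hb : b < 1) :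
    ∫⁻ τ in Ico (t / 2) t, ENNReal.ofReal ((t - τ) ^ (-b) * τ ^ (-a)) ≤
      ENNReal.ofReal (2 ^ a₁ / (1 - b) * t ^ (1 - a - b)) := by
  have h2 : 0 < 1 - b := by linarith
  calc _ ≤ ∫⁻ τ in Ico (t / 2) t, ENNReal.ofReal (2 ^ a₁ * t ^ (-a)) * ENNReal.ofReal ((t - τ) ^ (-b)) := by
        refine setLIntegral_mono' measurableSet_Ico fun τ hτ => ?_
        rw [← ENNReal.ofReal_mul (by positivity)]
        apply ENNReal.ofReal_le_ofReal
        have h3 := rpow_le_two_rpow_abs ht (x := τ) (by linarith [hτ.1]) (by linarith [hτ.2]) a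
        have h4 : (2 : ℝ) ^ |a| ≤ 2 ^ a₁ := Real.rpow_le_rpow_of_exponent_le (by norm_num) ha
        have h5 : 0 ≤ (t - τ) ^ (-b) := Real.rpow_nonneg (by linarith [hτ.2]) _
        have h6 : 0 ≤ t ^ (-a) := by positivity
        rw [mul_comm]
        gcongr
        nlinarith
    _ ≤ ENNReal.ofReal (2 ^ a₁ * t ^ (-a)) * ∫⁻ τ in Ioo 0 t, ENNReal.ofReal (τ ^ (-b)) := by
        rw [lintegral_const_mul' _ _ ENNReal.ofReal_ne_top]
        refine mul_le_mul_right ?_ _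
        rw [← lintegral_indicator measurableSet_Ico, ← lintegral_indicator measurableSet_Ioo,
          ← lintegral_sub_left_eq_self (fun τ => (Ioo 0 t).indicator
            (fun τ => ENNReal.ofReal (τ ^ (-b))) τ) t]
        refine lintegral_mono fun τ => ?_
        by_cases hτ : τ ∈ Ico (t / 2) t
        · have hτ' : t - τ ∈ Ioo 0 t := ⟨by linarith [hτ.2], by linarith [hτ.1]⟩
          rw [indicator_of_mem hτ, indicator_of_mem hτ']
        · rw [indicator_of_notMem hτ]
          exact zero_le
    _ = _ := by
        rw [lintegral_rpow_Ioo ht hb, ← ENNReal.ofReal_mul (by positivity)]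
        congr 1
        have h4 : t ^ (1 - a - b) = t ^ (-a) * t ^ (1 - b) := by
          rw [← Real.rpow_add ht]; ring_nf
        rw [h4]
        ring

/-! ## Families of functions in time -/

/-- Joint measurability of a time-dependent nonnegative function on `(0, ∞)`. -/
def FamMeas {d : ℕ} (F : ℝ → E d → ℝ≥0∞) : Prop :=
  AEMeasurable (Function.uncurry F) ((volume.restrict (Ioi (0 : ℝ))).prod volume)

/-- `F(t)` has weak norm at most `A t^{-(ρ - k - d r)/2}` for all `t > 0`. -/
def KatoBound {d : ℕ} (ρ k r A : ℝ) (F : ℝ → E d → ℝ≥0∞) : Prop :=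
  ∀ t : ℝ, 0 < t → WeakBound k r (A * t ^ (-(ρ - (k + d * r)) / 2)) (F t)

/-- The Duhamel integral of a nonnegative source. -/
noncomputable def duhamel {d : ℕ} (Q : ℝ → E d → ℝ≥0∞) (t : ℝ) (x : E d) : ℝ≥0∞ :=
  ∫⁻ τ in Ioo 0 t, eHeat (t - τ) (Q τ) x

section Families

variable {d : ℕ} {F G Q Q' : ℝ → E d → ℝ≥0∞}

namespace FamMeas

theorem mul (hF : FamMeas F) (hG : FamMeas G) : FamMeas (fun t x => F t x * G t x) :=
  AEMeasurable.mul hF hG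

theorem add (hF : FamMeas F) (hG : FamMeas G) : FamMeas (fun t x => F t x + G t x) :=
  AEMeasurable.add hF hG

theorem rpow (hF : FamMeas F) (θ : ℝ) : FamMeas (fun t x => F t x ^ θ) :=
  AEMeasurable.pow_const hF θ

theorem const_mul (c : ℝ≥0∞) (hF : FamMeas F) : FamMeas (fun t x => c * F t x) :=
  AEMeasurable.const_mul hF c

theorem of_measurable (hF : Measurable (Function.uncurry F)) : FamMeas F := hF.aemeasurable

theorem exists_measurable (hF : FamMeas F) : ∃ G : ℝ → E d → ℝ≥0∞,
    Measurable (Function.uncurry G) ∧ ∀ᵐ τ ∂(volume.restrict (Ioi (0 : ℝ))), F τ =ᵐ[volume] G τ := by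
  refine ⟨fun t x => AEMeasurable.mk _ hF (t, x), AEMeasurable.measurable_mk hF, ?_⟩
  exact Measure.ae_ae_of_ae_prod (AEMeasurable.ae_eq_mk hF)

end FamMeas

theorem duhamel_congr (h : ∀ᵐ τ ∂(volume.restrict (Ioi (0 : ℝ))), Q τ =ᵐ[volume] Q' τ) :
    duhamel Q = duhamel Q' := by
  ext t x
  refine lintegral_congr_ae ?_
  filter_upwards [ae_restrict_of_ae_restrict_of_subset Ioo_subset_Ioi_self h] with τ hτ
  rw [eHeat_congr_ae hτ]

theorem duhamel_mono (h : ∀ τ, 0 < τ → ∀ᵐ y, Q τ y ≤ Q' τ y) (t : ℝ) (x : E d) :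
    duhamel Q t x ≤ duhamel Q' t x :=
  setLIntegral_mono' measurableSet_Ioo fun τ hτ => eHeat_mono_ae (h τ hτ.1) x

theorem measurable_eHeat_uncurry (hQ : Measurable (Function.uncurry Q)) :
    Measurable (fun z : (ℝ × E d) × ℝ => eHeat (z.1.1 - z.2) (Q z.2) z.1.2) := by
  unfold eHeat
  refine Measurable.lintegral_prod_right'
    (f := fun w : ((ℝ × E d) × ℝ) × E d =>
      ENNReal.ofReal (heatKernel (w.1.1.1 - w.1.2) (w.1.1.2 - w.2)) * Q w.1.2 w.2) ?_
  refine Measurable.mul (Measurable.ennreal_ofReal ?_) ?_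
  · exact measurable_heatKernel_uncurry.comp (by fun_prop :
      Measurable fun w : ((ℝ × E d) × ℝ) × E d => (w.1.1.1 - w.1.2, w.1.1.2 - w.2))
  · exact hQ.comp (by fun_prop : Measurable fun w : ((ℝ × E d) × ℝ) × E d => (w.1.2, w.2))

theorem measurable_eHeat_slice (hQ : Measurable (Function.uncurry Q)) (t : ℝ) :
    Measurable (Function.uncurry fun τ x => eHeat (t - τ) (Q τ) x) := by
  have hm : Measurable fun z : ℝ × E d => (((t, z.2) : ℝ × E d), z.1) := by fun_prop
  have h := (measurable_eHeat_uncurry hQ).comp hm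
  exact h

theorem FamMeas.duhamel_measurable (hQ : FamMeas Q) : Measurable (Function.uncurry (duhamel Q)) := by
  obtain ⟨Q', hQ', hae⟩ := hQ.exists_measurable
  rw [duhamel_congr hae]
  have e : Function.uncurry (duhamel Q') = fun z : ℝ × E d => ∫⁻ τ,
      ({w : (ℝ × E d) × ℝ | w.2 ∈ Ioo 0 w.1.1}.indicator
        (fun z : (ℝ × E d) × ℝ => eHeat (z.1.1 - z.2) (Q' z.2) z.1.2) (z, τ)) := by
    ext ⟨t, x⟩
    simp only [Function.uncurry, duhamel]
    rw [← lintegral_indicator measurableSet_Ioo]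
    rfl
  rw [e]
  refine Measurable.lintegral_prod_right' ?_
  refine (measurable_eHeat_uncurry hQ').indicator ?_
  refine MeasurableSet.inter (measurableSet_lt measurable_const measurable_snd)
    (measurableSet_lt measurable_snd (by fun_prop))

theorem FamMeas.duhamel (hQ : FamMeas Q) : FamMeas (duhamel Q) :=
  FamMeas.of_measurable hQ.duhamel_measurable

theorem duhamel_add (hG : FamMeas G) (t : ℝ) (x : E d) :
    duhamel (fun τ y => F τ y + G τ y) t x = duhamel F t x + duhamel G t x := by
  obtain ⟨G', hG', hae⟩ := hG.exists_measurable
  rw [duhamel_congr hae, duhamel_congr (Q' := fun τ y => F τ y + G' τ y)]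
  · have hm : Measurable fun τ => eHeat (t - τ) (G' τ) x :=
      (measurable_eHeat_slice hG' t).of_uncurry_right
    have hadd : ∀ τ, eHeat (t - τ) (fun y => F τ y + G' τ y) x =
        eHeat (t - τ) (F τ) x + eHeat (t - τ) (G' τ) x := fun τ => by
      have hk : Measurable fun y => ENNReal.ofReal (heatKernel (t - τ) (x - y)) :=
        ((measurable_heatKernel (t - τ)).comp (measurable_const.sub measurable_id)).ennreal_ofReal
      have hg : Measurable fun y => G' τ y := hG'.comp measurable_prodMk_left
      unfold eHeat
      simp_rw [mul_add]
      exact lintegral_add_right _ (hk.mul hg)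
    unfold duhamel
    simp_rw [hadd]
    exact lintegral_add_right _ hm
  · filter_upwards [hae] with τ hτ
    filter_upwards [hτ] with y hy
    rw [hy]

namespace KatoBound

variable {ρ ρ' k r A B k' r' : ℝ}

theorem mono (hG : KatoBound ρ k r A G) (h : ∀ t, 0 < t → ∀ᵐ x, F t x ≤ G t x) :
    KatoBound ρ k r A F := fun t ht => (hG t ht).mono (h t ht)

theorem mono_const (hG : KatoBound ρ k r A G) (h : A ≤ B) : KatoBound ρ k r B G := fun t ht =>
  (hG t ht).mono_const (by gcongr)

theorem add (hA : 0 ≤ A) (hB : 0 ≤ B) (hr : r ≤ 1) (hF : KatoBound ρ k r A F)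
    (hG : KatoBound ρ k r B G) : KatoBound ρ k r (2 * (A + B)) (fun t x => F t x + G t x) := by
  intro t ht
  refine ((hF t ht).add (by positivity) (by positivity) hr (hG t ht)).mono_const (le_of_eq ?_)
  ring

theorem mul (hd : 0 < d) (hA : 0 ≤ A) (hF : KatoBound ρ k r A F) (hG : KatoBound ρ' k' r' B G) :
    KatoBound (ρ + ρ') (k + k') (r + r') (2 ^ (r + r') * (A * B)) (fun t x => F t x * G t x) := by
  intro t ht
  refine ((hF t ht).mul hd (by positivity) (hG t ht)).mono_const (le_of_eq ?_)
  have : t ^ (-(ρ + ρ' - (k + k' + d * (r + r'))) / 2) =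
      t ^ (-(ρ - (k + d * r)) / 2) * t ^ (-(ρ' - (k' + d * r')) / 2) := by
    rw [← Real.rpow_add ht]; ring_nf
  rw [this]
  ring

theorem rpow {θ : ℝ} (hA : 0 ≤ A) (hθ : 0 ≤ θ) (hF : KatoBound ρ k r A F) :
    KatoBound (θ * ρ) (θ * k) (θ * r) (A ^ θ) (fun t x => F t x ^ θ) := by
  intro t ht
  refine ((hF t ht).rpow (by positivity) hθ).mono_const (le_of_eq ?_)
  rw [Real.mul_rpow hA (by positivity), ← Real.rpow_mul ht.le]
  ring_nf

theorem const_mul {c : ℝ} (hc : 0 < c) (hF : KatoBound ρ k r A F) :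
    KatoBound ρ k r (c * A) (fun t x => ENNReal.ofReal c * F t x) := by
  intro t ht
  rw [mul_assoc]
  exact (hF t ht).const_mul hc

theorem norm_rpow (hd : 0 < d) (m : ℝ) :
    KatoBound (-m) (-m) 0 1 (fun (_ : ℝ) (x : E d) => ENNReal.ofReal (‖x‖ ^ m)) := by
  intro t ht
  simpa using WeakBound.norm_rpow hd m

/-- The lower order is the better bound for t ≤ 1, the higher order for t ≥ 1. -/
theorem interpolate {ρ₁ A₁ : ℝ} (h₀ : KatoBound ρ k r A F) (h₁ : KatoBound ρ₁ k r A₁ F)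
    (hA : 0 ≤ A) (hA₁ : 0 ≤ A₁) (hρ : ρ ≤ ρ') (hρ₁ : ρ' ≤ ρ₁) : KatoBound ρ' k r (A + A₁) F := by
  intro t ht
  rcases le_total t 1 with h | h
  · refine (h₀ t ht).mono_const ?_
    have := Real.rpow_le_rpow_of_exponent_ge ht h
      (by linarith : -(ρ' - (k + d * r)) / 2 ≤ -(ρ - (k + d * r)) / 2)
    have h2 : 0 ≤ t ^ (-(ρ' - (k + d * r)) / 2) := by positivity
    nlinarith
  · refine (h₁ t ht).mono_const ?_
    have := Real.rpow_le_rpow_of_exponent_le h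
      (by linarith : -(ρ₁ - (k + d * r)) / 2 ≤ -(ρ' - (k + d * r)) / 2)
    have h2 : 0 ≤ t ^ (-(ρ' - (k + d * r)) / 2) := by positivity
    nlinarith

end KatoBound

set_option maxHeartbeats 400000 in
/-- The Duhamel integral gains two orders. The first pair `(k₁, r₁)` controls the source near
`τ = 0`, the second pair `(k₂, r₂)` controls it near `τ = t`. -/
theorem KatoBound.duhamel (hd : 0 < d) {ρ₀ ρ₁ k₁ r₁ k₂ r₂ k' r' : ℝ}
    (hr₁ : 0 ≤ r₁) (hr₁' : r₁ < 1) (hr₂ : 0 ≤ r₂) (hr₂' : r₂ < 1) (hr' : 0 ≤ r') (hr'1 : r' < 1)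
    (hρ₁ : ρ₁ < k₁ + d * r₁) (hK₁ : k₁ + d * r₁ < d) (hK₂ : k₂ + d * r₂ < d)
    (hk₁ : k' ≤ k₁) (hk₂ : k' ≤ k₂) (hK' : 0 ≤ k' + d * r')
    (hK'₁ : k' + d * r' ≤ k₁ + d * r₁) (hK'₂ : k' + d * r' ≤ k₂ + d * r₂)
    (hgap : k₂ + d * r₂ - (k' + d * r') < 2) :
    ∃ C > 0, ∀ ρ, ρ₀ ≤ ρ → ρ ≤ ρ₁ → ∀ Q : ℝ → E d → ℝ≥0∞, FamMeas Q → ∀ A > 0,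
      KatoBound (ρ + 2) k₁ r₁ A Q → KatoBound (ρ + 2) k₂ r₂ A Q →
      KatoBound ρ k' r' (C * A) (duhamel Q) := by
  obtain ⟨C₁, hC₁, h₁⟩ := WeakBound.eHeat hd hr₁ hr₁' hK₁ hk₁ hr' hr'1.le hK' hK'₁
  obtain ⟨C₂, hC₂, h₂⟩ := WeakBound.eHeat hd hr₂ hr₂' hK₂ hk₂ hr' hr'1.le hK' hK'₂
  set K₁ := k₁ + d * r₁ with hK₁def
  set K₂ := k₂ + d * r₂ with hK₂def
  set K' := k' + d * r' with hK'def
  -- The largest power of 1/τ at the origin over all admitted orders; it is integrable precisely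
  -- because ρ₁ < K₁.
  set a₁ := (ρ₁ + 2 - K₁) / 2 with ha₁
  have ha₁1 : a₁ < 1 := by rw [ha₁]; linarith
  -- A bound for |ρ + 2 - K₂|/2 over the whole interval of orders, so that the final constant is
  -- independent of ρ.
  set a₂ := (|ρ₀| + |ρ₁| + |2 - K₂|) / 2 with ha₂
  set b₁ := (K₁ - K') / 2 with hb₁
  set b₂ := (K₂ - K') / 2 with hb₂
  have hb₂1 : b₂ < 1 := by rw [hb₂]; linarith
  have h1a : 0 < 1 - a₁ := by linarith
  have h1b : 0 < 1 - b₂ := by linarith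
  have h1r : 0 < 1 - r' := by linarith
  set D₁ := 2 ^ |b₁| / (1 - a₁) with hD₁
  set D₂ := 2 ^ a₂ / (1 - b₂) with hD₂
  refine ⟨2 * (2 / (1 - r') * (C₁ * D₁) + 2 / (1 - r') * (C₂ * D₂)), by positivity, ?_⟩
  intro ρ hρ hρ' Q hQ A hA hQ₁ hQ₂ t ht
  obtain ⟨Q', hQ', hae⟩ := hQ.exists_measurable
  rw [duhamel_congr hae]
  have hQm : ∀ τ, AEMeasurable (Q' τ) := fun τ => (hQ'.comp measurable_prodMk_left).aemeasurable
  have hΦ := measurable_eHeat_slice hQ' t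
  have hT : 0 < t ^ (-(ρ - K') / 2) := by positivity
  -- the part near `τ = 0`
  have hleft : WeakBound k' r' (2 / (1 - r') * (C₁ * A * (D₁ * t ^ (-(ρ - K') / 2))))
      (fun x => ∫⁻ τ in Ioo 0 (t / 2), _root_.eHeat (t - τ) (Q' τ) x) := by
    refine WeakBound.lintegral_time (b := fun τ => C₁ * A * ((t - τ) ^ (-b₁) *
      τ ^ (-((ρ + 2 - K₁) / 2)))) hr' hr'1 hd hΦ ?_ (by positivity) ?_
    · filter_upwards [self_mem_ae_restrict measurableSet_Ioo,
        ae_restrict_of_ae_restrict_of_subset Ioo_subset_Ioi_self hae] with τ hτ hτae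
      have hτ0 : 0 < τ := hτ.1
      have htτ : 0 < t - τ := by linarith [hτ.2]
      refine ⟨by positivity, ?_⟩
      have := h₁ (t - τ) htτ (Q' τ) (hQm τ) _ (by positivity) ((hQ₁ τ hτ0).mono hτae.symm.le)
      refine this.mono_const (le_of_eq ?_)
      rw [hb₁, show -(K₁ - K') / 2 = -((K₁ - K') / 2) by ring,
        show -(ρ + 2 - K₁) / 2 = -((ρ + 2 - K₁) / 2) by ring]
      ring
    · simp_rw [ENNReal.ofReal_mul (show 0 ≤ C₁ * A by positivity)]
      rw [lintegral_const_mul' _ _ ENNReal.ofReal_ne_top]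
      refine mul_le_mul_right ?_ _
      refine (lintegral_time_left (a₁ := a₁) ht (by rw [ha₁]; linarith) ha₁1).trans (le_of_eq ?_)
      congr 3
      rw [hb₁]; ring
  -- the part near `τ = t`
  have hright : WeakBound k' r' (2 / (1 - r') * (C₂ * A * (D₂ * t ^ (-(ρ - K') / 2))))
      (fun x => ∫⁻ τ in Ico (t / 2) t, _root_.eHeat (t - τ) (Q' τ) x) := by
    have hsub : Ico (t / 2) t ⊆ Ioi (0 : ℝ) := fun τ hτ => lt_of_lt_of_le (by positivity) hτ.1
    refine WeakBound.lintegral_time (b := fun τ => C₂ * A * ((t - τ) ^ (-b₂) *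
      τ ^ (-((ρ + 2 - K₂) / 2)))) hr' hr'1 hd hΦ ?_ (by positivity) ?_
    · filter_upwards [self_mem_ae_restrict measurableSet_Ico,
        ae_restrict_of_ae_restrict_of_subset hsub hae] with τ hτ hτae
      have hτ0 : 0 < τ := hsub hτ
      have htτ : 0 < t - τ := by linarith [hτ.2]
      refine ⟨by positivity, ?_⟩
      have := h₂ (t - τ) htτ (Q' τ) (hQm τ) _ (by positivity) ((hQ₂ τ hτ0).mono hτae.symm.le)
      refine this.mono_const (le_of_eq ?_)
      rw [hb₂, show -(K₂ - K') / 2 = -((K₂ - K') / 2) by ring,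
        show -(ρ + 2 - K₂) / 2 = -((ρ + 2 - K₂) / 2) by ring]
      ring
    · simp_rw [ENNReal.ofReal_mul (show 0 ≤ C₂ * A by positivity)]
      rw [lintegral_const_mul' _ _ ENNReal.ofReal_ne_top]
      refine mul_le_mul_right ?_ _
      have habs : |(ρ + 2 - K₂) / 2| ≤ a₂ := by
        rw [abs_div, ha₂, abs_of_pos (by norm_num : (0 : ℝ) < 2)]
        have h1 : |ρ| ≤ |ρ₀| + |ρ₁| := by
          rw [abs_le]
          constructor
          · linarith [neg_abs_le ρ₀, abs_nonneg ρ₁]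
          · linarith [le_abs_self ρ₁, abs_nonneg ρ₀]
        have h2 : |ρ + 2 - K₂| ≤ |ρ| + |2 - K₂| := by
          rw [add_sub_assoc]; exact abs_add_le _ _
        linarith
      refine (lintegral_time_right ht habs hb₂1).trans (le_of_eq ?_)
      congr 3
      rw [hb₂]; ring
  have hsum := hleft.add (by positivity) (by positivity) hr'1.le hright
  refine (hsum.mono_const (le_of_eq ?_)).mono (Eventually.of_forall fun x => ?_)
  · ring
  · have hU : Ioo 0 t = Ioo 0 (t / 2) ∪ Ico (t / 2) t :=
      (Ioo_union_Ico_eq_Ioo (by positivity) (by linarith)).symm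
    change _root_.duhamel Q' t x ≤ _
    unfold _root_.duhamel
    rw [hU]
    exact lintegral_union_le _ _ _

end Families

/-! ## Linear equations with a small potential -/

/-- The Duhamel integral of `V F`. -/
noncomputable def potOp {d : ℕ} (V F : ℝ → E d → ℝ≥0∞) : ℝ → E d → ℝ≥0∞ :=
  duhamel (fun τ y => V τ y * F τ y)

section Linear

variable {d : ℕ} {V F G f h : ℝ → E d → ℝ≥0∞}

theorem FamMeas.potOp (hV : FamMeas V) (hF : FamMeas F) : FamMeas (potOp V F) :=
  FamMeas.duhamel (hV.mul hF)

theorem potOp_mono (hFG : ∀ τ, 0 < τ → ∀ᵐ y, F τ y ≤ G τ y) (t : ℝ) (x : E d) :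
    potOp V F t x ≤ potOp V G t x := by
  refine duhamel_mono (fun τ hτ => ?_) t x
  filter_upwards [hFG τ hτ] with y hy
  exact mul_le_mul_right hy _

theorem potOp_add (hV : FamMeas V) (hG : FamMeas G) (t : ℝ) (x : E d) :
    potOp V (fun τ y => F τ y + G τ y) t x = potOp V F t x + potOp V G t x := by
  unfold potOp
  rw [← duhamel_add (hV.mul hG)]
  simp_rw [mul_add]

/-- The product V F has order ρ + 2, and its pair (kV + k, rV + r) serves at both ends of the time
interval. The operator norm is proportional to the size a of the potential and uniform in ρ, so a
small potential contracts at all these orders simultaneously. -/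
theorem KatoBound.potOp (hd : 0 < d) {ρ₀ ρ₁ kV rV k r : ℝ} (hkV : 0 ≤ kV) (hrV : 0 ≤ rV)
    (hKV : kV + d * rV < 2) (hr : 0 ≤ r) (hrr : rV + r < 1) (hK : 0 ≤ k + d * r)
    (hρ₁ : ρ₁ < kV + d * rV + (k + d * r)) (hKd : kV + d * rV + (k + d * r) < d) :
    ∃ C > 0, ∀ V : ℝ → E d → ℝ≥0∞, FamMeas V → ∀ a > 0, KatoBound 2 kV rV a V →
      ∀ ρ, ρ₀ ≤ ρ → ρ ≤ ρ₁ → ∀ F : ℝ → E d → ℝ≥0∞, FamMeas F → ∀ A > 0, KatoBound ρ k r A F →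
        KatoBound ρ k r (C * (a * A)) (potOp V F) := by
  have hKV0 : 0 ≤ kV + d * rV := by positivity
  obtain ⟨C, hC, H⟩ := KatoBound.duhamel (d := d) hd (ρ₀ := ρ₀) (ρ₁ := ρ₁) (k₁ := kV + k)
    (r₁ := rV + r) (k₂ := kV + k) (r₂ := rV + r) (k' := k) (r' := r) (by linarith) hrr
    (by linarith) hrr hr (by linarith) (by linarith) (by linarith) (by linarith) (by linarith)
    (by linarith) hK (by linarith) (by linarith) (by linarith)
  refine ⟨C * 2 ^ (rV + r), by positivity, fun V hV a ha hVa ρ hρ hρ' F hF A hA hFA => ?_⟩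
  have h1 := hVa.mul hd ha.le hFA
  rw [add_comm 2 ρ] at h1
  refine (H ρ hρ hρ' _ (hV.mul hF) _ (by positivity) h1 h1).mono_const (le_of_eq ?_)
  ring

/-- If `f ≤ h + potOp V f` and `potOp V` contracts a norm in which `f` is finite and a norm in
which `h` is bounded, then `f` inherits the bound of `h`. -/
theorem KatoBound.absorb (hd : 0 < d) (hV : FamMeas V) (hf : FamMeas f)
    (hfh : ∀ t, 0 < t → ∀ᵐ x, f t x ≤ h t x + _root_.potOp V f t x)
    {ρb kb rb M : ℝ} (hM : 0 < M) (hfb : KatoBound ρb kb rb M f)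
    (hcb : ∀ F, FamMeas F → ∀ A > 0, KatoBound ρb kb rb A F →
      KatoBound ρb kb rb (A / 4) (_root_.potOp V F))
    {ρ k r A : ℝ} (hr : r ≤ 1) (hA : 0 < A)
    (hc : ∀ F, FamMeas F → ∀ A > 0, KatoBound ρ k r A F →
      KatoBound ρ k r (A / 4) (_root_.potOp V F))
    (hh : KatoBound ρ k r A h) : KatoBound ρ k r (4 * A) f := by
  -- A measurable substitute for h, which itself is not assumed measurable.
  set h' : ℝ → E d → ℝ≥0∞ := fun t x => f t x - _root_.potOp V f t x with hh'
  have hh'm : FamMeas h' := AEMeasurable.sub hf (hV.potOp hf)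
  have hh'b : KatoBound ρ k r A h' := hh.mono fun t ht => by
    filter_upwards [hfh t ht] with x hx
    exact tsub_le_iff_right.mpr hx
  -- With T = `potOp V`, the H n are the Picard iterates of h' + T started at zero and the R n are
  -- the T^n f. By positivity and additivity f ≤ H n + R n for every n.
  set H : ℕ → ℝ → E d → ℝ≥0∞ := fun n => Nat.rec (fun _ _ => 0)
    (fun _ F => fun t x => h' t x + _root_.potOp V F t x) n with hH
  have hHs : ∀ n, H (n + 1) = fun t x => h' t x + _root_.potOp V (H n) t x := fun n => rfl
  set R : ℕ → ℝ → E d → ℝ≥0∞ := fun n => Nat.rec f (fun _ F => _root_.potOp V F) n with hR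
  have hRs : ∀ n, R (n + 1) = _root_.potOp V (R n) := fun n => rfl
  have hHm : ∀ n, FamMeas (H n) := by
    intro n
    induction n with
    | zero => exact FamMeas.of_measurable measurable_const
    | succ n ih => rw [hHs]; exact hh'm.add (hV.potOp ih)
  have hHb : ∀ n, KatoBound ρ k r (4 * A) (H n) := by
    intro n
    induction n with
    | zero => exact fun t ht => WeakBound.zero
    | succ n ih =>
      rw [hHs]
      -- The bound 4A is a fixed point of the iteration: 2(A + 4A/4) = 4A.
      refine (hh'b.add hA.le (by positivity) hr (hc _ (hHm n) _ (by positivity) ih)).mono_const ?_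
      linarith
  have hRm : ∀ n, FamMeas (R n) := by
    intro n
    induction n with
    | zero => exact hf
    | succ n ih => rw [hRs]; exact hV.potOp ih
  have hRb : ∀ n, KatoBound ρb kb rb (M / 4 ^ n) (R n) := by
    intro n
    induction n with
    | zero =>
      change KatoBound ρb kb rb (M / 4 ^ 0) f
      simpa using hfb
    | succ n ih =>
      rw [hRs]
      refine (hcb _ (hRm n) _ (by positivity) ih).mono_const (le_of_eq ?_)
      rw [pow_succ, div_div]
  have hle : ∀ n t, 0 < t → ∀ x, f t x ≤ H n t x + R n t x := by
    intro n
    induction n with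
    | zero => intro t _ x; simp [hH, hR]
    | succ n ih =>
      intro t ht x
      calc f t x ≤ h' t x + _root_.potOp V f t x := le_tsub_add
        _ ≤ h' t x + _root_.potOp V (fun τ y => H n τ y + R n τ y) t x := by
          refine add_le_add le_rfl (potOp_mono (fun τ hτ => ?_) t x)
          exact Eventually.of_forall (ih τ hτ)
        _ = H (n + 1) t x + R (n + 1) t x := by
          rw [potOp_add hV (hRm n), hHs, hRs, add_assoc]
  have hmono : ∀ n t x, H n t x ≤ H (n + 1) t x := by
    intro n
    induction n with
    | zero => intro t x; simp [hH]
    | succ n ih =>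
      intro t x
      rw [hHs (n + 1), hHs n]
      exact add_le_add le_rfl (potOp_mono (fun τ _ => Eventually.of_forall (ih τ)) t x)
  intro t ht
  have hsup : WeakBound k r (4 * A * t ^ (-(ρ - (k + d * r)) / 2)) (fun x => ⨆ n, H n t x) :=
    WeakBound.iSup (F := fun n => H n t) (monotone_nat_of_le_succ fun n x => hmono n t x)
      fun n => hHb n t ht
  refine hsup.mono ?_
  -- The excess is at most R n for every n, and the a priori norm of R n is M/4^n. The a priori
  -- bound serves only here and leaves no trace in the result.
  have hz : ∀ᵐ x, f t x - ⨆ n, H n t x = 0 := by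
    refine WeakBound.ae_eq_zero (k := kb) (r := rb) hd fun a ha => ?_
    set T := t ^ (-(ρb - (kb + d * rb)) / 2) with hT
    have hTpos : 0 < T := by positivity
    obtain ⟨n, hn⟩ := pow_unbounded_of_one_lt (M * T / a) (by norm_num : (1 : ℝ) < 4)
    refine ((hRb n t ht).mono_const ?_).mono (Eventually.of_forall fun x => ?_)
    · rw [div_lt_iff₀ ha] at hn
      rw [div_mul_eq_mul_div, div_le_iff₀ (by positivity), mul_comm a]
      exact hn.le
    · rw [tsub_le_iff_right, add_comm]
      exact (hle n t ht x).trans (add_le_add (le_iSup (fun n => H n t x) n) le_rfl)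
  filter_upwards [hz] with x hx
  exact tsub_eq_zero_iff_le.mp hx

set_option maxHeartbeats 800000 in
/-- Bounds propagate from `(k, r)` to all pairs with smaller weight and larger exponent. -/
theorem KatoBound.bootstrap (hd : 0 < d) {ρ kV rV k r a M : ℝ} (hkV : 0 ≤ kV) (hrV : 0 ≤ rV)
    (hKV : kV + d * rV < 2) (hrr : rV + r < 1)
    (hρ : ρ < kV + d * rV + (k + d * r)) (hKd : kV + d * rV + (k + d * r) < d)
    (hV : FamMeas V) (ha : 0 < a) (hVa : KatoBound 2 kV rV a V) (hf : FamMeas f)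
    (hfh : ∀ t, 0 < t → ∀ᵐ x, f t x ≤ h t x + _root_.potOp V f t x)
    (hM : 0 < M) (hfM : KatoBound ρ k r M f)
    (hh : ∀ k' r', k' ≤ k → 0 ≤ r' → r' ≤ r → 0 ≤ k' + d * r' →
      ∃ A > 0, KatoBound ρ k' r' A h)
    {k' r' : ℝ} (hk' : k' ≤ k) (hr0 : 0 ≤ r') (hr' : r' ≤ r) (hK' : 0 ≤ k' + d * r') :
    ∃ A > 0, KatoBound ρ k' r' A f := by
  have hd' : (0 : ℝ) < d := by exact_mod_cast hd
  set K := k + d * r with hKdef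
  set K' := k' + d * r' with hK'def
  set KV := kV + d * rV with hKVdef
  have hKV0 : 0 ≤ KV := by positivity
  have hKK' : K' ≤ K := by rw [hKdef, hK'def]; gcongr
  -- A direct passage from K to K' may violate integrability at τ = t, which requires KV plus the
  -- drop to be below 2. The segment is therefore cut into N steps with drop (K - K')/N.
  obtain ⟨N, hN⟩ := exists_nat_gt ((K - K') / (2 - KV))
  have hNpos : (0 : ℝ) < N := lt_of_le_of_lt (div_nonneg (by linarith) (by linarith)) hN
  have hNgap : KV + (K - K') / N < 2 := by
    rw [div_lt_iff₀ (by linarith)] at hN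
    have : (K - K') / N < 2 - KV := by rw [div_lt_iff₀ hNpos]; linarith
    linarith
  set ks : ℕ → ℝ := fun i => k + i / N * (k' - k) with hks
  set rs : ℕ → ℝ := fun i => r + i / N * (r' - r) with hrs
  have hKs : ∀ i, ks i + d * rs i = K + i / N * (K' - K) := fun i => by
    rw [hks, hrs, hKdef, hK'def]; ring
  have hfrac : ∀ i : ℕ, i ≤ N → (0 : ℝ) ≤ i / N ∧ (i : ℝ) / N ≤ 1 := fun i hi =>
    ⟨by positivity, by rw [div_le_one hNpos]; exact_mod_cast hi⟩
  have hup : ∀ {c x y : ℝ}, 0 ≤ c → y ≤ x → x + c * (y - x) ≤ x := fun hc hy => by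
    nlinarith
  have hlo : ∀ {c x y : ℝ}, c ≤ 1 → y ≤ x → y ≤ x + c * (y - x) := fun hc hy => by
    nlinarith
  have hmon : ∀ {c c' x y : ℝ}, c ≤ c' → y ≤ x → x + c' * (y - x) ≤ x + c * (y - x) :=
    fun hc hy => by nlinarith
  have hclaim : ∀ i : ℕ, i ≤ N → ∃ A > 0, KatoBound ρ (ks i) (rs i) A f := by
    intro i
    induction i with
    | zero => intro _; exact ⟨M, hM, by simpa [hks, hrs] using hfM⟩
    | succ i ih =>
      intro hi
      obtain ⟨A, hA, hfA⟩ := ih (by omega)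
      obtain ⟨h0, h1⟩ := hfrac i (by omega)
      obtain ⟨h0', h1'⟩ := hfrac (i + 1) hi
      have hstep : ((i + 1 : ℕ) : ℝ) / N = i / N + 1 / N := by push_cast; ring
      have hinv : 0 < 1 / (N : ℝ) := by positivity
      set c := (i : ℝ) / N with hc
      set c' := ((i + 1 : ℕ) : ℝ) / N with hc'
      have e1 : ks i = k + c * (k' - k) := rfl
      have e2 : rs i = r + c * (r' - r) := rfl
      have e1' : ks (i + 1) = k + c' * (k' - k) := rfl
      have e2' : rs (i + 1) = r + c' * (r' - r) := rfl
      have hcc : c ≤ c' := by rw [hstep]; linarith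
      have g1 : ks i ≤ k := hup h0 hk'
      have g2 : rs i ≤ r := hup h0 hr'
      have g2' : 0 ≤ rs i := hr0.trans (hlo h1 hr')
      have g3 : ks (i + 1) ≤ ks i := hmon hcc hk'
      have g4 : rs (i + 1) ≤ rs i := hmon hcc hr'
      have g5 : 0 ≤ rs (i + 1) := hr0.trans (hlo h1' hr')
      have hKi : ks i + d * rs i ≤ K := by rw [hKs]; exact hup h0 hKK'
      have hKi' : ks (i + 1) + d * rs (i + 1) ≤ ks i + d * rs i := by gcongr
      have hKi0 : 0 ≤ ks (i + 1) + d * rs (i + 1) := by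
        rw [hKs]; exact hK'.trans (hlo h1' hKK')
      have hdrop : ks i + d * rs i - (ks (i + 1) + d * rs (i + 1)) = (K - K') / N := by
        rw [hKs, hKs, ← hc, ← hc', hstep]; ring
      -- Near τ = 0 the initial pair is kept, for which ρ < KV + K is known; near τ = t the pair of
      -- the current step is used, which keeps the drop small.
      obtain ⟨C, hC, H⟩ := KatoBound.duhamel (d := d) hd (ρ₀ := ρ) (ρ₁ := ρ) (k₁ := kV + k)
        (r₁ := rV + r) (k₂ := kV + ks i) (r₂ := rV + rs i) (k' := ks (i + 1)) (r' := rs (i + 1))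
        (by linarith) hrr (by linarith) (by linarith) g5 (by linarith) (by linarith)
        (by linarith) (by linarith) (by linarith) (by linarith) hKi0 (by linarith)
        (by linarith) (by linarith)
      have b1 := hVa.mul hd ha.le hfM
      have b2 := hVa.mul hd ha.le hfA
      rw [add_comm 2 ρ] at b1 b2
      have hD := H ρ le_rfl le_rfl _ (hV.mul hf) (2 ^ (rV + r) * (a * M) + 2 ^ (rV + rs i) * (a * A))
        (by positivity) (b1.mono_const (le_add_of_nonneg_right (by positivity)))
        (b2.mono_const (le_add_of_nonneg_left (by positivity)))
      obtain ⟨B, hB, hhB⟩ := hh (ks (i + 1)) (rs (i + 1)) (by linarith) g5 (by linarith) hKi0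
      refine ⟨_, ?_, (hhB.add hB.le ?_ (by linarith) hD).mono hfh⟩
      · positivity
      · positivity
  obtain ⟨A, hA, hfA⟩ := hclaim N le_rfl
  refine ⟨A, hA, ?_⟩
  have e : (N : ℝ) / N = 1 := div_self hNpos.ne'
  simpa [hks, hrs, e] using hfA

end Linear

/-! ### Potentials, mixed sources and shifted pairs -/

section Core

variable {d : ℕ}

/-- The nonlinear potential `c |x|^γ m^β`. -/
noncomputable def potential (c γ β : ℝ) (m : ℝ → E d → ℝ≥0∞) (t : ℝ) (x : E d) : ℝ≥0∞ :=
  ENNReal.ofReal c * (ENNReal.ofReal (‖x‖ ^ γ) * m t x ^ β)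

/-- The source `c |x|^γ m^{β-θ} e^θ F`. -/
noncomputable def mixedSource (c γ β θ : ℝ) (m e F : ℝ → E d → ℝ≥0∞) (t : ℝ) (x : E d) : ℝ≥0∞ :=
  ENNReal.ofReal c * (ENNReal.ofReal (‖x‖ ^ γ) * (m t x ^ (β - θ) * (e t x ^ θ * F t x)))

/-- Raise the weight by `η` and lower the reciprocal exponent by `η / d`. -/
noncomputable def shiftExp (d : ℕ) (η r : ℝ) : ℝ := max 0 (r - η / d)

variable {c γ β θ : ℝ} {m e F : ℝ → E d → ℝ≥0∞}

theorem famMeas_norm_rpow (γ : ℝ) : FamMeas (fun (_ : ℝ) (x : E d) => ENNReal.ofReal (‖x‖ ^ γ)) := by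
  refine FamMeas.of_measurable ?_
  unfold Function.uncurry
  fun_prop

theorem FamMeas.potential (hm : FamMeas m) : FamMeas (potential c γ β m) :=
  ((famMeas_norm_rpow γ).mul (hm.rpow β)).const_mul _

theorem FamMeas.mixedSource (hm : FamMeas m) (he : FamMeas e) (hF : FamMeas F) :
    FamMeas (mixedSource c γ β θ m e F) :=
  ((famMeas_norm_rpow γ).mul ((hm.rpow (β - θ)).mul ((he.rpow θ).mul hF))).const_mul _

/-- Scaling criticality βs - γ = 2 makes the potential of order exactly 2, the loss which the
Duhamel integral makes up for. -/
theorem KatoBound.potential (hd : 0 < d) {s k r A : ℝ} (hc : 0 < c) (hβ : 0 ≤ β) (hA : 0 ≤ A)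
    (hs : β * s - γ = 2) (hm : KatoBound s k r A m) :
    KatoBound 2 (β * k - γ) (β * r) (c * (2 ^ (β * r) * A ^ β)) (potential c γ β m) := by
  have h := ((KatoBound.norm_rpow hd γ).mul hd zero_le_one (hm.rpow hA hβ)).const_mul hc
  rw [zero_add, one_mul, show -γ + β * s = 2 by linarith, show -γ + β * k = β * k - γ by ring] at h
  exact h

/-- Trading θ powers of m for θ powers of e raises the order by θ(ρ₁ - s), while the pair moves only
by θ times the difference of the two pairs. -/
theorem KatoBound.mixedSource (hd : 0 < d) {s k r A ρ₁ k₁ r₁ A₁ ρ₂ k₂ r₂ A₂ : ℝ} (hc : 0 < c)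
    (hθ : 0 ≤ θ) (hθβ : θ ≤ β) (hA : 0 < A) (hA₁ : 0 < A₁) (hA₂ : 0 < A₂)
    (hs : β * s - γ = 2) (hm : KatoBound s k r A m) (he : KatoBound ρ₁ k₁ r₁ A₁ e)
    (hF : KatoBound ρ₂ k₂ r₂ A₂ F) :
    ∃ B > 0, KatoBound (ρ₂ + θ * (ρ₁ - s) + 2) (β * k - γ + θ * (k₁ - k) + k₂)
      (β * r + θ * (r₁ - r) + r₂) B (mixedSource c γ β θ m e F) := by
  have h := (((KatoBound.norm_rpow hd γ).mul hd zero_le_one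
    ((hm.rpow hA.le (sub_nonneg.mpr hθβ)).mul hd (by positivity)
    ((he.rpow hA₁.le hθ).mul hd (by positivity) hF)))).const_mul hc
  rw [show -γ + ((β - θ) * s + (θ * ρ₁ + ρ₂)) = ρ₂ + θ * (ρ₁ - s) + 2 by linarith,
    show -γ + ((β - θ) * k + (θ * k₁ + k₂)) = β * k - γ + θ * (k₁ - k) + k₂ by ring] at h
  rw [show 0 + ((β - θ) * r + (θ * r₁ + r₂)) = β * r + θ * (r₁ - r) + r₂ by ring] at h
  exact ⟨_, by positivity, h⟩

theorem shiftExp_nonneg (η r : ℝ) : 0 ≤ shiftExp d η r := le_max_left _ _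

theorem shiftExp_le {η r : ℝ} (hη : 0 ≤ η) (hr : 0 ≤ r) : shiftExp d η r ≤ r := by
  have : 0 ≤ η / d := by positivity
  exact max_le hr (by linarith)

theorem shiftExp_mono {η r r' : ℝ} (h : r ≤ r') : shiftExp d η r ≤ shiftExp d η r' :=
  max_le_max le_rfl (by linarith)

theorem le_shift (hd : 0 < d) (k : ℝ) {η r : ℝ} : k + d * r ≤ k + η + d * shiftExp d η r := by
  have hd' : (0 : ℝ) < d := by exact_mod_cast hd
  have h := mul_le_mul_of_nonneg_left (le_max_right 0 (r - η / d)) hd'.le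
  rw [mul_sub, mul_div_cancel₀ _ hd'.ne'] at h
  unfold shiftExp
  linarith

theorem shift_le {η r : ℝ} (hη : 0 ≤ η) (hr : 0 ≤ r) (k : ℝ) :
    k + η + d * shiftExp d η r ≤ k + d * r + η := by
  have := mul_le_mul_of_nonneg_left (shiftExp_le (d := d) hη hr) (Nat.cast_nonneg d)
  linarith

/-- The shift preserves k + dr as long as k + η stays below it; otherwise the reciprocal exponent is
truncated at zero and only the weight remains. -/
theorem shift_eq_max (hd : 0 < d) (k η r : ℝ) :
    k + η + d * shiftExp d η r = max (k + η) (k + d * r) := by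
  have hd' : (0 : ℝ) < d := by exact_mod_cast hd
  have e : (d : ℝ) * (r - η / d) = d * r - η := by field_simp
  unfold shiftExp
  rw [mul_max_of_nonneg _ _ hd'.le, e, mul_zero]
  rcases le_total 0 (d * r - η) with h | h
  · rw [max_eq_right h, max_eq_right (by linarith)]; ring
  · rw [max_eq_left h, max_eq_left (by linarith)]; ring

set_option maxHeartbeats 400000 in
/-- The Duhamel integral of a mixed source gains the order `θ (ρ₁ - s)`. -/
theorem KatoBound.duhamel_mixedSource (hd : 0 < d) {s k r A ρ₁ k₁ r₁ A₁ ρ ks rs η : ℝ} (hc : 0 < c)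
    (hθ : 0 ≤ θ) (hθβ : θ ≤ β) (hA : 0 < A) (hA₁ : 0 < A₁) (hη : 0 ≤ η) (hr : 0 ≤ r) (hr₁ : 0 ≤ r₁)
    (hs : β * s - γ = 2) (hm : KatoBound s k r A m) (he : KatoBound ρ₁ k₁ r₁ A₁ e)
    (hmm : FamMeas m) (hem : FamMeas e) (hFm : FamMeas F) (hrs : 0 ≤ rs)
    (hKs : 0 ≤ ks + d * rs)
    (hF : ∀ k' r', k' ≤ ks → 0 ≤ r' → r' ≤ rs → 0 ≤ k' + d * r' →
      ∃ B > 0, KatoBound ρ (k' + η) (shiftExp d η r') B F)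
    (h1 : β * r + θ * (r₁ - r) + rs < 1)
    (h2 : ρ + θ * (ρ₁ - s) <
      β * k - γ + d * (β * r) + θ * (k₁ + d * r₁ - (k + d * r)) + (ks + d * rs))
    (h3 : β * k - γ + d * (β * r) + θ * (k₁ + d * r₁ - (k + d * r)) + (ks + d * rs) + η < d)
    (h4 : 0 ≤ β * k - γ + θ * (k₁ - k) + η)
    (h5 : 0 ≤ β * k - γ + d * (β * r) + θ * (k₁ + d * r₁ - (k + d * r)))
    (h6 : β * k - γ + d * (β * r) + θ * (k₁ + d * r₁ - (k + d * r)) + η < 2)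
    {k' r' : ℝ} (hk' : k' ≤ ks) (hr0 : 0 ≤ r') (hr' : r' ≤ rs) (hK' : 0 ≤ k' + d * r') :
    ∃ B > 0, KatoBound (ρ + θ * (ρ₁ - s)) k' r' B (_root_.duhamel (_root_.mixedSource c γ β θ m e F)) := by
  -- F is measured at the shifted top pair near τ = 0 and at the shifted target pair near τ = t. The
  -- extra weight η ensures that the weight of the source is not below the target weight even if
  -- θ(k₁ - k) is negative.
  obtain ⟨B₁, hB₁, hF₁⟩ := hF ks rs le_rfl hrs le_rfl hKs
  obtain ⟨B₂, hB₂, hF₂⟩ := hF k' r' hk' hr0 hr' hK'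
  obtain ⟨D₁, hD₁, hS₁⟩ := KatoBound.mixedSource hd hc hθ hθβ hA hA₁ hB₁ hs hm he hF₁
  obtain ⟨D₂, hD₂, hS₂⟩ := KatoBound.mixedSource hd hc hθ hθβ hA hA₁ hB₂ hs hm he hF₂
  have hnn : 0 ≤ β * r + θ * (r₁ - r) := by
    have : β * r + θ * (r₁ - r) = (β - θ) * r + θ * r₁ := by ring
    rw [this]
    have := mul_nonneg (sub_nonneg.mpr hθβ) hr
    have := mul_nonneg hθ hr₁
    linarith
  have a1 := shiftExp_nonneg (d := d) η rs
  have a2 := shiftExp_nonneg (d := d) η r'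
  have a3 := shiftExp_le (d := d) hη hrs
  have a4 := shiftExp_le (d := d) hη hr0
  have a5 := le_shift (d := d) hd ks (η := η) (r := rs)
  have a6 := le_shift (d := d) hd k' (η := η) (r := r')
  have a7 := shift_le (d := d) hη hrs ks
  have a8 := shift_le (d := d) hη hr0 k'
  have hKK : k' + d * r' ≤ ks + d * rs := by gcongr
  have e1 : ∀ x y : ℝ, β * k - γ + θ * (k₁ - k) + x + d * (β * r + θ * (r₁ - r) + y) =
      β * k - γ + d * (β * r) + θ * (k₁ + d * r₁ - (k + d * r)) + (x + d * y) := fun x y => by ring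
  obtain ⟨C, hC, H⟩ := KatoBound.duhamel (d := d) hd (ρ₀ := ρ + θ * (ρ₁ - s))
    (ρ₁ := ρ + θ * (ρ₁ - s)) (k₁ := β * k - γ + θ * (k₁ - k) + (ks + η))
    (r₁ := β * r + θ * (r₁ - r) + shiftExp d η rs)
    (k₂ := β * k - γ + θ * (k₁ - k) + (k' + η))
    (r₂ := β * r + θ * (r₁ - r) + shiftExp d η r') (k' := k') (r' := r')
    (by linarith) (by linarith) (by linarith) (by linarith) hr0 (by linarith)
    (by rw [e1]; linarith) (by rw [e1]; linarith) (by rw [e1]; linarith)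
    (by linarith) (by linarith) hK' (by rw [e1]; linarith) (by rw [e1]; linarith)
    (by rw [e1]; linarith)
  refine ⟨C * (D₁ + D₂), by positivity, H _ le_rfl le_rfl _ (hmm.mixedSource hem hFm) _
    (by positivity) (hS₁.mono_const (by linarith)) (hS₂.mono_const (by linarith))⟩

end Core

/-! ### The comparison argument for moduli -/

section Core

variable {d : ℕ}

/-- This turns the finitely many strict inequalities between exponents into one common margin. -/
theorem exists_pos_le_of_pos (l : List ℝ) (h : ∀ x ∈ l, 0 < x) : ∃ g > 0, ∀ x ∈ l, g ≤ x := by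
  induction l with
  | nil => exact ⟨1, one_pos, by simp⟩
  | cons a l ih =>
    obtain ⟨g, hg, hgl⟩ := ih fun x hx => h x (List.mem_cons_of_mem _ hx)
    refine ⟨min a g, lt_min (h a List.mem_cons_self) hg, fun x hx => ?_⟩
    rcases List.mem_cons.mp hx with rfl | hx
    · exact min_le_left _ _
    · exact (min_le_right _ _).trans (hgl x hx)

theorem KatoBound.of_ae_zero {ρ k r A : ℝ} {F : ℝ → E d → ℝ≥0∞}
    (h : ∀ t, 0 < t → ∀ᵐ x, F t x = 0) : KatoBound ρ k r A F := fun t ht =>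
  (WeakBound.zero (k := k) (r := r)).mono (by filter_upwards [h t ht] with x hx using hx.le)

set_option maxHeartbeats 4000000 in
/-- The asymptotic comparison for the moduli of all functions involved. -/
theorem asymptotic_comparison (hd : 0 < d) {c β γ s k r σ k₀ r₀ : ℝ} (hc : 0 < c) (hβ : 0 < β)
    (hs : β * s - γ = 2) (hr : 0 ≤ r) (hK : 0 ≤ k + d * r) (hkV : 0 ≤ β * k - γ)
    (hKs : k + d * r < s) (hlow : s < β * k - γ + d * (β * r) + (k + d * r))
    (hup : β * k - γ + d * (β * r) + (k + d * r) < d) (hrr : β * r + r < 1)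
    (hr₀ : 0 ≤ r₀) (hK₀ : 0 ≤ k₀ + d * r₀) (hrr₀ : β * r + r₀ < 1)
    (hlow₀ : σ < β * k - γ + d * (β * r) + (k₀ + d * r₀))
    (hup₀ : β * k - γ + d * (β * r) + (k₀ + d * r₀) < d) (hsσ : s < σ) :
    ∃ ε > 0, ∀ m U z u w v lU lz l g₁ g₂ : ℝ → E d → ℝ≥0∞,
      FamMeas m → FamMeas U → FamMeas z → FamMeas u → FamMeas w → FamMeas v →
      KatoBound s k r ε m → (∀ t, 0 < t → ∀ᵐ x, U t x ≤ m t x) →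
      (∀ t, 0 < t → ∀ᵐ x, u t x ≤ m t x) → (∀ t, 0 < t → ∀ᵐ x, w t x ≤ m t x) →
      (∀ t, 0 < t → ∀ᵐ x, v t x ≤ u t x + z t x) →
      (∀ t, 0 < t → ∀ᵐ x, U t x ≤ lU t x + potOp (potential c γ β m) U t x) →
      (∀ t, 0 < t → ∀ᵐ x, z t x ≤ lz t x + potOp (potential c γ β m) z t x) →
      (∀ t, 0 < t → ∀ᵐ x, u t x ≤ l t x + potOp (potential c γ β m) u t x) →
      (∀ θ, 0 ≤ θ → θ ≤ 1 → θ ≤ β → ∀ t, 0 < t → ∀ᵐ x, w t x ≤ g₁ t x +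
        duhamel (mixedSource c γ β θ m u U) t x + potOp (potential c γ β m) w t x) →
      (∀ θ₁ θ₂, 0 ≤ θ₁ → θ₁ ≤ 1 → θ₁ ≤ β → 0 ≤ θ₂ → θ₂ ≤ 1 → θ₂ ≤ β →
        ∀ t, 0 < t → ∀ᵐ x, v t x ≤ g₂ t x + (duhamel (mixedSource c γ β θ₁ m w z) t x +
        duhamel (mixedSource c γ β θ₂ m u z) t x) + potOp (potential c γ β m) v t x) →
      (∀ k' r' : ℝ, 0 ≤ r' → r' ≤ 1 → 0 ≤ k' + d * r' → k' + d * r' ≤ s →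
        ∃ A > 0, KatoBound s k' r' A lU) →
      ((∀ t, 0 < t → ∀ᵐ x, lz t x = 0) ∨ (k₀ + d * r₀ ≤ σ ∧
        ∀ k' r' : ℝ, 0 ≤ r' → r' ≤ 1 → 0 ≤ k' + d * r' → k' + d * r' ≤ σ →
          ∃ A > 0, KatoBound σ k' r' A lz)) →
      (∃ A > 0, KatoBound σ k₀ r₀ A l) → (∃ A > 0, KatoBound σ k₀ r₀ A z) →
      ∀ δ₀₁ > 0, ∀ δ₀₂ > 0,
      (∀ k' r' : ℝ, k' ≤ k → 0 ≤ r' → r' ≤ r → 0 ≤ k' + d * r' →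
        (∃ A > 0, KatoBound s k' r' A g₁) ∧ ∃ A > 0, KatoBound (s + 2 * δ₀₁) k' r' A g₁) →
      (∀ k' r' : ℝ, k' ≤ k₀ → 0 ≤ r' → r' ≤ r₀ → 0 ≤ k' + d * r' →
        (∃ A > 0, KatoBound σ k' r' A g₂) ∧ ∃ A > 0, KatoBound (σ + 2 * δ₀₂) k' r' A g₂) →
      ∃ δ₁ > 0, ∃ δ₂ > 0,
        (∀ k' r' : ℝ, k' ≤ k → 0 ≤ r' → r' ≤ r → 0 ≤ k' + d * r' →
          ∃ A > 0, KatoBound (s + 2 * δ₁) k' r' A w) ∧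
        (∀ k' r' : ℝ, k' ≤ k₀ → 0 ≤ r' → r' ≤ r₀ → 0 ≤ k' + d * r' →
          ∃ A > 0, KatoBound (σ + 2 * δ₂) k' r' A v) := by
  have hd' : (0 : ℝ) < d := by exact_mod_cast hd
  set K := k + d * r with hKdef
  set K₀ := k₀ + d * r₀ with hK₀def
  set KV := β * k - γ + d * (β * r) with hKVdef
  have hrV : 0 ≤ β * r := by positivity
  have hKV0 : 0 < KV := by linarith
  -- KV = βK - γ is below βs - γ = 2 because K < s.
  have hKV2 : KV < 2 := by
    have : KV = β * K - γ := by rw [hKVdef, hKdef]; ring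
    rw [this, ← hs]
    nlinarith
  obtain ⟨g, hg, hgl⟩ := exists_pos_le_of_pos [1 - (β * r + r), 1 - (β * r + r₀), KV + K - s,
    KV + K₀ - σ, d - (KV + K), d - (KV + K₀), KV, 2 - KV, s - K, σ - s] (by
      intro x hx
      simp only [List.mem_cons, List.not_mem_nil, or_false] at hx
      rcases hx with rfl | rfl | rfl | rfl | rfl | rfl | rfl | rfl | rfl | rfl <;> linarith)
  simp only [List.mem_cons, List.not_mem_nil, or_false, forall_eq_or_imp, forall_eq] at hgl
  obtain ⟨g1, g2, g3, g4, g5, g6, g7, g8, g9, g10⟩ := hgl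
  -- L dominates every difference that gets multiplied by θ. With θs L ≤ g/8 and the shift g/4, all
  -- exponent conditions survive within the margin g.
  set L := 1 + |r₀ - r| + |K₀ - K| + |k₀ - k| + |σ - s| with hL
  have hL0 : 0 < L := by positivity
  set η := g / 4 with hη
  have hη0 : 0 < η := by positivity
  set θs := min (min β 1) (g / (8 * L)) with hθs
  have hθs0 : 0 < θs := by positivity
  have hθsβ : θs ≤ β := (min_le_left _ _).trans (min_le_left _ _)
  have hθs1 : θs ≤ 1 := (min_le_left _ _).trans (min_le_right _ _)
  have hθsL : θs * L ≤ g / 8 := by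
    calc θs * L ≤ g / (8 * L) * L := by gcongr; exact min_le_right _ _
      _ = g / 8 := by field_simp
  have hsmall : ∀ θ y, 0 ≤ θ → θ ≤ θs → |y| ≤ L → θ * y ≤ g / 8 ∧ -(g / 8) ≤ θ * y := by
    intro θ y h0 h1 hy
    have : |θ * y| ≤ g / 8 := by
      rw [abs_mul, abs_of_nonneg h0]
      exact (mul_le_mul h1 hy (abs_nonneg y) hθs0.le).trans hθsL
    exact ⟨(le_abs_self _).trans this, by linarith [neg_abs_le (θ * y)]⟩
  have y1 : |r₀ - r| ≤ L := by
    rw [hL]; linarith [abs_nonneg (K₀ - K), abs_nonneg (k₀ - k), abs_nonneg (σ - s)]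
  have y2 : |K₀ - K| ≤ L := by
    rw [hL]; linarith [abs_nonneg (r₀ - r), abs_nonneg (k₀ - k), abs_nonneg (σ - s)]
  have y3 : |k₀ - k| ≤ L := by
    rw [hL]; linarith [abs_nonneg (r₀ - r), abs_nonneg (K₀ - K), abs_nonneg (σ - s)]
  have y4 : |σ - s| ≤ L := by
    rw [hL]; linarith [abs_nonneg (r₀ - r), abs_nonneg (K₀ - K), abs_nonneg (k₀ - k)]
  clear_value L
  -- For k ≤ k₀ the term θ(k₀ - k) is nonnegative and needs no compensation. Setting the shift to
  -- zero in this case keeps k₀ + η₀ ≤ σ when K₀ ≤ σ, the range in which the homogeneous heat flow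
  -- is controlled.
  set η₀ := if k ≤ k₀ then 0 else η with hη₀
  have hη₀0 : 0 ≤ η₀ := by rw [hη₀]; split_ifs <;> linarith
  have hη₀η : η₀ ≤ η := by rw [hη₀]; split_ifs <;> linarith
  -- the shifted pairs
  set r' := shiftExp d η r with hr'def
  have hr'0 : 0 ≤ r' := shiftExp_nonneg _ _
  have hr'r : r' ≤ r := shiftExp_le hη0.le hr
  have hK'1 : K ≤ k + η + d * r' := le_shift hd k
  have hK'2 : k + η + d * r' ≤ K + η := shift_le hη0.le hr k
  set r₀' := shiftExp d η₀ r₀ with hr₀'def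
  have hr₀'0 : 0 ≤ r₀' := shiftExp_nonneg _ _
  have hr₀'r : r₀' ≤ r₀ := shiftExp_le hη₀0 hr₀
  have hK₀'1 : K₀ ≤ k₀ + η₀ + d * r₀' := le_shift hd k₀
  have hK₀'2 : k₀ + η₀ + d * r₀' ≤ K₀ + η₀ := shift_le hη₀0 hr₀ k₀
  -- contraction constants
  obtain ⟨C₁, hC₁, c₁⟩ := KatoBound.potOp (d := d) hd (ρ₀ := s) (ρ₁ := s + g / 8) hkV hrV hKV2 hr
    hrr hK (by linarith) hup
  obtain ⟨C₂, hC₂, c₂⟩ := KatoBound.potOp (d := d) hd (ρ₀ := σ) (ρ₁ := σ + g / 8) hkV hrV hKV2 hr₀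
    hrr₀ hK₀ (by linarith) hup₀
  obtain ⟨C₃, hC₃, c₃⟩ := KatoBound.potOp (d := d) hd (ρ₀ := s) (ρ₁ := s) (k := k + η) (r := r')
    hkV hrV hKV2 hr'0 (by linarith) (by linarith) (by linarith) (by linarith)
  obtain ⟨C₄, hC₄, c₄⟩ := KatoBound.potOp (d := d) hd (ρ₀ := σ) (ρ₁ := σ) (k := k₀ + η₀) (r := r₀')
    hkV hrV hKV2 hr₀'0 (by linarith) (by linarith) (by linarith) (by linarith)
  set CS := C₁ + C₂ + C₃ + C₄ with hCS
  have hCS0 : 0 < CS := by positivity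
  -- This size of the potential makes all four operators contract by 1/4; ε then solves c 2^{βr} ε^β
  -- = a.
  set a := 1 / (4 * CS) with ha
  have ha0 : 0 < a := by positivity
  set ε := (a / (c * 2 ^ (β * r))) ^ (1 / β) with hε
  have hε0 : 0 < ε := by positivity
  have hεa : c * (2 ^ (β * r) * ε ^ β) = a := by
    rw [hε, ← Real.rpow_mul (by positivity), one_div, inv_mul_cancel₀ hβ.ne', Real.rpow_one]
    field_simp
  have hcontr : ∀ C, C ≤ CS → ∀ A, 0 < A → C * (a * A) ≤ A / 4 := by
    intro C hC A hA
    calc C * (a * A) ≤ CS * (a * A) := by gcongr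
      _ = A / 4 := by rw [ha]; field_simp
  refine ⟨ε, hε0, ?_⟩
  intro m U z u w v lU lz l g₁ g₂ hmm hUm hzm hum hwm hvm hm hUle hule hwle hvle hU hz hu hw hv
    hlU hlz hl hzb δ₀₁ hδ₀₁ δ₀₂ hδ₀₂ hg₁ hg₂
  obtain ⟨Al, hAl, hl⟩ := hl
  obtain ⟨Az, hAz, hzb⟩ := hzb
  set V := potential c γ β m with hVdef
  have hVm : FamMeas V := hmm.potential
  have hVb : KatoBound 2 (β * k - γ) (β * r) a V := by
    rw [← hεa]; exact KatoBound.potential hd hc hβ.le hε0.le hs hm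
  have k₁ : ∀ ρ, s ≤ ρ → ρ ≤ s + g / 8 → ∀ F, FamMeas F → ∀ A > 0, KatoBound ρ k r A F →
      KatoBound ρ k r (A / 4) (potOp V F) := fun ρ h1 h2 F hF A hA hFA =>
    (c₁ V hVm a ha0 hVb ρ h1 h2 F hF A hA hFA).mono_const (hcontr _ (by linarith) _ hA)
  have k₂ : ∀ ρ, σ ≤ ρ → ρ ≤ σ + g / 8 → ∀ F, FamMeas F → ∀ A > 0, KatoBound ρ k₀ r₀ A F →
      KatoBound ρ k₀ r₀ (A / 4) (potOp V F) := fun ρ h1 h2 F hF A hA hFA =>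
    (c₂ V hVm a ha0 hVb ρ h1 h2 F hF A hA hFA).mono_const (hcontr _ (by linarith) _ hA)
  have k₃ : ∀ F, FamMeas F → ∀ A > 0, KatoBound s (k + η) r' A F →
      KatoBound s (k + η) r' (A / 4) (potOp V F) := fun F hF A hA hFA =>
    (c₃ V hVm a ha0 hVb s le_rfl le_rfl F hF A hA hFA).mono_const (hcontr _ (by linarith) _ hA)
  have k₄ : ∀ F, FamMeas F → ∀ A > 0, KatoBound σ (k₀ + η₀) r₀' A F →
      KatoBound σ (k₀ + η₀) r₀' (A / 4) (potOp V F) := fun F hF A hA hFA =>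
    (c₄ V hVm a ha0 hVb σ le_rfl le_rfl F hF A hA hFA).mono_const (hcontr _ (by linarith) _ hA)
  -- the fast component
  have hub : KatoBound σ k₀ r₀ (4 * Al) u :=
    -- Finiteness is known only at order s, from u ≤ m; the linear inequality lifts it to the order
    -- σ of the data.
    KatoBound.absorb hd hVm hum hu hε0 (hm.mono hule) (k₁ s le_rfl (by linarith)) (by linarith)
      hAl (k₂ σ le_rfl (by linarith)) hl
  -- the profile `U` in shifted spaces
  have hUb : ∀ k' q : ℝ, k' ≤ k → 0 ≤ q → q ≤ r → 0 ≤ k' + d * q →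
      ∃ B > 0, KatoBound s (k' + η) (shiftExp d η q) B U := by
    obtain ⟨A, hA, hlA⟩ := hlU (k + η) r' hr'0 (by linarith) (by linarith) (by linarith)
    have hbase : KatoBound s (k + η) r' (4 * A) U :=
      KatoBound.absorb hd hVm hUm hU hε0 (hm.mono hUle) (k₁ s le_rfl (by linarith)) (by linarith)
        hA k₃ hlA
    intro k' q hk' hq0 hq hKq
    have b1 := shiftExp_nonneg (d := d) η q
    have b2 : shiftExp d η q ≤ r' := shiftExp_mono hq
    have b3 := le_shift (d := d) hd k' (η := η) (r := q)
    refine KatoBound.bootstrap hd hkV hrV hKV2 (by linarith) (by linarith) (by linarith) hVm ha0 hVb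
      hUm hU (by positivity) hbase ?_ (by linarith) b1 b2 (by linarith)
    intro k'' q'' h1 h2 h3 h4
    refine hlU k'' q'' h2 (by linarith) h4 ?_
    have : k'' + d * q'' ≤ k + η + d * r' := by gcongr
    linarith
  -- the profile `z` in shifted spaces
  have hlz' : ∀ k'' q'' : ℝ, k'' ≤ k₀ + η₀ → 0 ≤ q'' → q'' ≤ r₀' → 0 ≤ k'' + d * q'' →
      ∃ A > 0, KatoBound σ k'' q'' A lz := by
    intro k'' q'' h1 h2 h3 h4
    rcases hlz with hlz | ⟨hKσ, hlz⟩
    · exact ⟨1, one_pos, KatoBound.of_ae_zero hlz⟩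
    · refine hlz k'' q'' h2 (by linarith) h4 ?_
      have h5 : k'' + d * q'' ≤ k₀ + η₀ + d * r₀' := by gcongr
      rw [hr₀'def, shift_eq_max hd] at h5
      refine h5.trans (max_le ?_ hKσ)
      rw [hη₀]
      split_ifs with hk
      · have : 0 ≤ d * r₀ := by positivity
        linarith
      · have : 0 ≤ d * r := by positivity
        linarith
  have hzs : ∀ k' q : ℝ, k' ≤ k₀ → 0 ≤ q → q ≤ r₀ → 0 ≤ k' + d * q →
      ∃ B > 0, KatoBound σ (k' + η₀) (shiftExp d η₀ q) B z := by
    obtain ⟨A, hA, hlA⟩ := hlz' (k₀ + η₀) r₀' le_rfl hr₀'0 le_rfl (by linarith)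
    have hbase : KatoBound σ (k₀ + η₀) r₀' (4 * A) z :=
      KatoBound.absorb hd hVm hzm hz hAz hzb (k₂ σ le_rfl (by linarith)) (by linarith) hA k₄ hlA
    intro k' q hk' hq0 hq hKq
    have b1 := shiftExp_nonneg (d := d) η₀ q
    have b2 : shiftExp d η₀ q ≤ r₀' := shiftExp_mono hq
    have b3 := le_shift (d := d) hd k' (η := η₀) (r := q)
    exact KatoBound.bootstrap hd hkV hrV hKV2 (by linarith) (by linarith) (by linarith) hVm ha0 hVb
      hzm hz (by positivity) hbase hlz' (by linarith) b1 b2 (by linarith)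
  -- the slow component
  have hσs : 0 < σ - s := by linarith
  -- The rate is limited by that of the data and by the largest exponent θs allowed in the mixed
  -- source; θ below is chosen so that its gain θ(σ - s) equals 2δ₁.
  set δ₁ := min δ₀₁ (θs * (σ - s) / 2) with hδ₁
  have hδ₁0 : 0 < δ₁ := by positivity
  have hδ₁1 : δ₁ ≤ θs * (σ - s) / 2 := min_le_right _ _
  have hθσ := hsmall θs (σ - s) hθs0.le le_rfl y4
  set θ := 2 * δ₁ / (σ - s) with hθ
  have hθ0 : 0 ≤ θ := by positivity
  have hθle : θ ≤ θs := by rw [hθ, div_le_iff₀ hσs]; linarith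
  have hθδ : θ * (σ - s) = 2 * δ₁ := by rw [hθ]; field_simp
  have hsrc₁ : ∀ k' q : ℝ, k' ≤ k → 0 ≤ q → q ≤ r → 0 ≤ k' + d * q →
      ∃ A > 0, KatoBound (s + 2 * δ₁) k' q A
        (fun t x => g₁ t x + duhamel (mixedSource c γ β θ m u U) t x) := by
    intro k' q h1 h2 h3 h4
    obtain ⟨⟨A, hA, hgA⟩, ⟨A', hA', hgA'⟩⟩ := hg₁ k' q h1 h2 h3 h4
    have hg := hgA.interpolate (ρ' := s + 2 * δ₁) hgA' hA.le hA'.le (by linarith)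
      (by linarith [min_le_left δ₀₁ (θs * (σ - s) / 2)])
    have t1 := hsmall θ (r₀ - r) hθ0 hθle y1
    have t2 := hsmall θ (K₀ - K) hθ0 hθle y2
    have t3 := hsmall θ (k₀ - k) hθ0 hθle y3
    have t4 := hsmall θ (σ - s) hθ0 hθle y4
    obtain ⟨B, hB, hSB⟩ := KatoBound.duhamel_mixedSource hd (η := η) hc hθ0 (by linarith)
      hε0 (by positivity) hη0.le hr hr₀ hs hm hub hmm hum hUm hr hK hUb (by linarith)
      (by linarith) (by linarith) (by linarith) (by linarith) (by linarith) h1 h2 h3 h4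
    rw [hθδ] at hSB
    exact ⟨_, by positivity, hg.add (by positivity) hB.le (by linarith) hSB⟩
  have hwb : ∀ k' q : ℝ, k' ≤ k → 0 ≤ q → q ≤ r → 0 ≤ k' + d * q →
      ∃ A > 0, KatoBound (s + 2 * δ₁) k' q A w := by
    have hw' := hw θ hθ0 (by linarith) (by linarith)
    obtain ⟨A, hA, hSA⟩ := hsrc₁ k r le_rfl hr le_rfl hK
    have hbase : KatoBound (s + 2 * δ₁) k r (4 * A) w :=
      KatoBound.absorb hd hVm hwm hw' hε0 (hm.mono hwle) (k₁ s le_rfl (by linarith)) (by linarith)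
        hA (k₁ _ (by linarith) (by linarith)) hSA
    intro k' q h1 h2 h3 h4
    exact KatoBound.bootstrap hd hkV hrV hKV2 (by linarith) (by linarith) (by linarith) hVm ha0 hVb
      hwm hw' (by positivity) hbase hsrc₁ h1 h2 h3 h4
  -- the difference of the fast components
  obtain ⟨Aw, hAw, hwA⟩ := hwb k r le_rfl hr le_rfl hK
  -- Two sources compete: e = w exceeds order s by 2δ₁ and e = u exceeds it by σ - s. The exponents
  -- θa and θb give both the same gain 2δ₂, and the bounds here keep them at most θs.
  set δ₂ := min δ₀₂ (min (θs * δ₁) (θs * (σ - s) / 2)) with hδ₂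
  have hδ₂0 : 0 < δ₂ := by positivity
  have hδ₂1 : δ₂ ≤ θs * δ₁ := (min_le_right _ _).trans (min_le_left _ _)
  have hδ₂2 : δ₂ ≤ θs * (σ - s) / 2 := (min_le_right _ _).trans (min_le_right _ _)
  have hδ₂3 : δ₂ ≤ δ₀₂ := min_le_left _ _
  set θa := δ₂ / δ₁ with hθa
  have hθa0 : 0 ≤ θa := by positivity
  have hθale : θa ≤ θs := by rw [hθa, div_le_iff₀ hδ₁0]; linarith
  have hθaδ : θa * (s + 2 * δ₁ - s) = 2 * δ₂ := by rw [hθa]; field_simp; ring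
  set θb := 2 * δ₂ / (σ - s) with hθb
  have hθb0 : 0 ≤ θb := by positivity
  have hθble : θb ≤ θs := by rw [hθb, div_le_iff₀ hσs]; linarith
  have hθbδ : θb * (σ - s) = 2 * δ₂ := by rw [hθb]; field_simp
  have hsrc₂ : ∀ k' q : ℝ, k' ≤ k₀ → 0 ≤ q → q ≤ r₀ → 0 ≤ k' + d * q →
      ∃ A > 0, KatoBound (σ + 2 * δ₂) k' q A
        (fun t x => g₂ t x + (duhamel (mixedSource c γ β θa m w z) t x +
          duhamel (mixedSource c γ β θb m u z) t x)) := by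
    intro k' q h1 h2 h3 h4
    obtain ⟨⟨A, hA, hgA⟩, ⟨A', hA', hgA'⟩⟩ := hg₂ k' q h1 h2 h3 h4
    have hg := hgA.interpolate (ρ' := σ + 2 * δ₂) hgA' hA.le hA'.le (by linarith) (by linarith)
    have t1 := hsmall θb (r₀ - r) hθb0 hθble y1
    have t2 := hsmall θb (K₀ - K) hθb0 hθble y2
    have t3 := hsmall θb (k₀ - k) hθb0 hθble y3
    have t4 := hsmall θb (σ - s) hθb0 hθble y4
    obtain ⟨B, hB, hSB⟩ := KatoBound.duhamel_mixedSource hd (η := η₀) hc hθb0 (by linarith)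
      hε0 (by positivity) hη₀0 hr hr₀ hs hm hub hmm hum hzm hr₀ hK₀ hzs (by linarith)
      (by linarith) (by linarith)
      (by
        rw [hη₀]
        split_ifs with hk
        · have := mul_nonneg hθb0 (sub_nonneg.mpr hk)
          linarith
        · linarith)
      (by linarith) (by linarith) h1 h2 h3 h4
    rw [hθbδ] at hSB
    have z1 : θa * (r - r) = 0 := by ring
    have z2 : θa * (K - K) = 0 := by ring
    have z3 : θa * (k - k) = 0 := by ring
    obtain ⟨B', hB', hSB'⟩ := KatoBound.duhamel_mixedSource hd (η := η₀) hc hθa0 (by linarith)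
      hε0 hAw hη₀0 hr hr hs hm hwA hmm hwm hzm hr₀ hK₀ hzs (by linarith)
      (by linarith) (by linarith) (by linarith) (by linarith) (by linarith) h1 h2 h3 h4
    rw [hθaδ] at hSB'
    exact ⟨_, by positivity, hg.add (by positivity) (by positivity) (by linarith)
      (hSB'.add hB'.le hB.le (by linarith) hSB)⟩
  have hvb : ∀ k' q : ℝ, k' ≤ k₀ → 0 ≤ q → q ≤ r₀ → 0 ≤ k' + d * q →
      ∃ A > 0, KatoBound (σ + 2 * δ₂) k' q A v := by
    have hv' := hv θa θb hθa0 (by linarith) (by linarith) hθb0 (by linarith) (by linarith)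
    obtain ⟨A, hA, hSA⟩ := hsrc₂ k₀ r₀ le_rfl hr₀ le_rfl hK₀
    -- A priori finiteness at order σ, without any gain, is all that the absorption requires.
    have hvfin : KatoBound σ k₀ r₀ (2 * (4 * Al + Az)) v :=
      (hub.add (by positivity) hAz.le (by linarith) hzb).mono hvle
    have hbase : KatoBound (σ + 2 * δ₂) k₀ r₀ (4 * A) v :=
      KatoBound.absorb hd hVm hvm hv' (by positivity) hvfin (k₂ σ le_rfl (by linarith))
        (by linarith) hA (k₂ _ (by linarith) (by linarith)) hSA
    intro k' q h1 h2 h3 h4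
    exact KatoBound.bootstrap hd hkV hrV hKV2 (by linarith) (by linarith) (by linarith) hVm ha0 hVb
      hvm hv' (by positivity) hbase hsrc₂ h1 h2 h3 h4
  exact ⟨δ₁, hδ₁0, δ₂, hδ₂0, hwb, hvb⟩

end Core

/-! ## Elementary inequalities for the nonlinearity -/

section Elementary

/-- With τ = y/x this is 1 - τ^β ≤ max(1,β)(1 - τ): Bernoulli's inequality for β ≥ 1, and τ ≤ τ^β
for β ≤ 1. The additional factor x removes the singularity of the derivative when β < 1. -/
theorem rpow_sub_rpow_mul_le {β x y : ℝ} (hy : 0 ≤ y) (hyx : y ≤ x) :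
    (x ^ β - y ^ β) * x ≤ max 1 β * x ^ β * (x - y) := by
  rcases hy.trans hyx |>.eq_or_lt with rfl | hx
  · simp [le_antisymm hyx hy]
  have h0 : 0 ≤ y / x := by positivity
  have h1 : y / x ≤ 1 := (div_le_one hx).mpr hyx
  have key : 1 - (y / x) ^ β ≤ max 1 β * (1 - y / x) := by
    rcases le_total β 1 with hβ1 | hβ1
    · have := Real.self_le_rpow_of_le_one h0 h1 hβ1
      rw [max_eq_left hβ1]
      linarith
    · have := one_add_mul_self_le_rpow_one_add (s := y / x - 1) (by linarith) hβ1
      rw [max_eq_right hβ1]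
      rw [add_sub_cancel] at this
      linarith
  have h2 : y ^ β = x ^ β * (y / x) ^ β := by
    rw [← Real.mul_rpow hx.le h0, mul_div_cancel₀ _ hx.ne']
  have h3 : y = x * (y / x) := by rw [mul_div_cancel₀ _ hx.ne']
  have h4 : 0 ≤ x ^ β * x := by positivity
  calc (x ^ β - y ^ β) * x = x ^ β * x * (1 - (y / x) ^ β) := by rw [h2]; ring
    _ ≤ x ^ β * x * (max 1 β * (1 - y / x)) := by gcongr
    _ = max 1 β * x ^ β * (x - x * (y / x)) := by ring
    _ = _ := by rw [← h3]

/-- For y ≤ x one has x - y ≤ x^{1-θ} D^θ, which is inserted into `rpow_sub_rpow_mul_le`; θ ≤ β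
allows replacing x by M afterwards. -/
theorem abs_rpow_sub_rpow_le {β θ x y M D : ℝ} (hβ : 0 < β) (hθ : 0 ≤ θ) (hθ1 : θ ≤ 1) (hθβ : θ ≤ β)
    (hx : 0 ≤ x) (hy : 0 ≤ y) (hxM : x ≤ M) (hyM : y ≤ M) (hD : |x - y| ≤ D) :
    |x ^ β - y ^ β| ≤ max 1 β * (M ^ (β - θ) * D ^ θ) := by
  wlog hyx : y ≤ x generalizing x y
  · rw [abs_sub_comm]
    exact this hy hx hyM hxM (by rwa [abs_sub_comm]) (le_of_not_ge hyx)
  have hD0 : 0 ≤ D := (abs_nonneg _).trans hD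
  have hM0 : 0 ≤ M := hx.trans hxM
  rw [abs_of_nonneg (sub_nonneg.mpr (Real.rpow_le_rpow hy hyx hβ.le))]
  rw [abs_of_nonneg (sub_nonneg.mpr hyx)] at hD
  rcases hx.eq_or_lt with rfl | hx0
  · rw [le_antisymm hyx hy, sub_self]; positivity
  have h1 := rpow_sub_rpow_mul_le (β := β) hy hyx
  have h2 : x ^ β * (x - y) ≤ x ^ (β - θ) * D ^ θ * x := by
    have h0 : 0 ≤ x - y := sub_nonneg.mpr hyx
    have e1 : x ^ β = x ^ (β - θ) * x ^ θ := by rw [← Real.rpow_add hx0]; ring_nf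
    have e2 : x = x ^ (1 - θ) * x ^ θ := by rw [← Real.rpow_add hx0]; simp
    have e3 : x - y ≤ x ^ (1 - θ) * D ^ θ := by
      rcases h0.eq_or_lt with h | h
      · rw [← h]; positivity
      calc x - y = (x - y) ^ (1 - θ) * (x - y) ^ θ := by rw [← Real.rpow_add h]; simp
        _ ≤ x ^ (1 - θ) * D ^ θ := by
          gcongr
          · linarith
    calc x ^ β * (x - y) ≤ x ^ (β - θ) * x ^ θ * (x ^ (1 - θ) * D ^ θ) := by rw [e1]; gcongr
      _ = x ^ (β - θ) * D ^ θ * (x ^ (1 - θ) * x ^ θ) := by ring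
      _ = _ := by rw [← e2]
  have h3 : x ^ β - y ^ β ≤ max 1 β * (x ^ (β - θ) * D ^ θ) := by
    refine le_of_mul_le_mul_right ?_ hx0
    calc _ ≤ max 1 β * x ^ β * (x - y) := h1
      _ = max 1 β * (x ^ β * (x - y)) := by ring
      _ ≤ max 1 β * (x ^ (β - θ) * D ^ θ * x) := by gcongr
      _ = _ := by ring
  refine h3.trans ?_
  gcongr

theorem abs_rpow_sub_rpow_mul_le {β x y M : ℝ} (hβ : 0 < β)
    (hx : 0 ≤ x) (hy : 0 ≤ y) (hxM : x ≤ M) (hyM : y ≤ M) :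
    |x ^ β - y ^ β| * y ≤ max 1 β * (M ^ β * |x - y|) := by
  have hm : 0 ≤ max 1 β := by positivity
  rcases le_total y x with h | h
  · rw [abs_of_nonneg (sub_nonneg.mpr (Real.rpow_le_rpow hy h hβ.le)),
      abs_of_nonneg (sub_nonneg.mpr h)]
    have h0 : 0 ≤ x ^ β - y ^ β := sub_nonneg.mpr (Real.rpow_le_rpow hy h hβ.le)
    calc _ ≤ (x ^ β - y ^ β) * x := by gcongr
      _ ≤ max 1 β * x ^ β * (x - y) := rpow_sub_rpow_mul_le hy h
      _ ≤ max 1 β * M ^ β * (x - y) := by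
        have : 0 ≤ x - y := sub_nonneg.mpr h
        gcongr
      _ = _ := by ring
  · rw [abs_sub_comm, abs_of_nonneg (sub_nonneg.mpr (Real.rpow_le_rpow hx h hβ.le)),
      abs_sub_comm x y, abs_of_nonneg (sub_nonneg.mpr h)]
    calc _ ≤ max 1 β * y ^ β * (y - x) := rpow_sub_rpow_mul_le hx h
      _ ≤ max 1 β * M ^ β * (y - x) := by
        have : 0 ≤ y - x := sub_nonneg.mpr h
        gcongr
      _ = _ := by ring

variable {β n p q U z : ℝ}

/-- Difference of the slow components of the nonlinearity. -/
theorem abs_slow_sub_le (hβ : 0 < β) {θ : ℝ} (hθ : 0 ≤ θ) (hθ1 : θ ≤ 1) (hθβ : θ ≤ β)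
    (hp : |p| ≤ n) (hn : n ≤ |p| + |q|) :
    |n ^ β * p - |U| ^ β * U| ≤
      (1 + max 1 β) * ((n + |U|) ^ (β - θ) * (|q| ^ θ * |U|)) +
        (1 + max 1 β) * ((n + |U|) ^ β * |p - U|) := by
  have hn0 : 0 ≤ n := (abs_nonneg p).trans hp
  have hU := abs_nonneg U
  -- The first error is potential times difference. The second compares the modulus with its slow
  -- component, and n - |p| ≤ |q| brings in the fast one. In the third the factor U restores
  -- Lipschitz dependence on p, so it joins the first.
  have e : n ^ β * p - |U| ^ β * U =
      n ^ β * (p - U) + (n ^ β - |p| ^ β) * U + (|p| ^ β - |U| ^ β) * U := by ring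
  have h1 : |n ^ β * (p - U)| ≤ (n + |U|) ^ β * |p - U| := by
    rw [abs_mul, abs_of_nonneg (by positivity)]
    gcongr
    linarith
  have h2 : |(n ^ β - |p| ^ β) * U| ≤ max 1 β * ((n + |U|) ^ (β - θ) * |q| ^ θ) * |U| := by
    rw [abs_mul]
    gcongr
    refine abs_rpow_sub_rpow_le hβ hθ hθ1 hθβ hn0 (abs_nonneg p) (by linarith) (by linarith) ?_
    rw [abs_of_nonneg (by linarith)]
    linarith
  have h3 : |(|p| ^ β - |U| ^ β) * U| ≤ max 1 β * ((n + |U|) ^ β * |p - U|) := by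
    rw [abs_mul]
    refine (abs_rpow_sub_rpow_mul_le hβ (abs_nonneg p) hU (by linarith) (M := n + |U|)
      (by linarith)).trans ?_
    have := abs_abs_sub_abs_le p U
    gcongr max 1 β * ((n + |U|) ^ β * ?_)
  have h4 : 0 ≤ (n + |U|) ^ (β - θ) * (|q| ^ θ * |U|) := by positivity
  rw [e]
  calc _ ≤ |n ^ β * (p - U)| + |(n ^ β - |p| ^ β) * U| + |(|p| ^ β - |U| ^ β) * U| :=
        abs_add_three _ _ _
    _ ≤ _ := by linarith

/-- Difference of the fast components of the nonlinearity. -/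
theorem abs_fast_sub_le (hβ : 0 < β) {θ₁ θ₂ : ℝ} (hθ₁ : 0 ≤ θ₁) (hθ₁1 : θ₁ ≤ 1) (hθ₁β : θ₁ ≤ β)
    (hθ₂ : 0 ≤ θ₂) (hθ₂1 : θ₂ ≤ 1) (hθ₂β : θ₂ ≤ β) (hp : |p| ≤ n) (hn : n ≤ |p| + |q|) :
    |n ^ β * q - |U| ^ β * z| ≤
      (1 + max 1 β) * ((n + |U|) ^ (β - θ₁) * (|p - U| ^ θ₁ * |z|)) +
      (1 + max 1 β) * ((n + |U|) ^ (β - θ₂) * (|q| ^ θ₂ * |z|)) +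
        (1 + max 1 β) * ((n + |U|) ^ β * |q - z|) := by
  have hn0 : 0 ≤ n := (abs_nonneg p).trans hp
  have hU := abs_nonneg U
  -- The last term carries z instead of U, so it cannot be absorbed as before; it contributes a
  -- fractional power of |p - U|, the slow difference, whose decay has already been established when
  -- this is applied.
  have e : n ^ β * q - |U| ^ β * z =
      n ^ β * (q - z) + (n ^ β - |p| ^ β) * z + (|p| ^ β - |U| ^ β) * z := by ring
  have h1 : |n ^ β * (q - z)| ≤ (n + |U|) ^ β * |q - z| := by
    rw [abs_mul, abs_of_nonneg (by positivity)]
    gcongr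
    linarith
  have h2 : |(n ^ β - |p| ^ β) * z| ≤ max 1 β * ((n + |U|) ^ (β - θ₂) * |q| ^ θ₂) * |z| := by
    rw [abs_mul]
    gcongr
    refine abs_rpow_sub_rpow_le hβ hθ₂ hθ₂1 hθ₂β hn0 (abs_nonneg p) (by linarith) (by linarith) ?_
    rw [abs_of_nonneg (by linarith)]
    linarith
  have h3 : |(|p| ^ β - |U| ^ β) * z| ≤ max 1 β * ((n + |U|) ^ (β - θ₁) * |p - U| ^ θ₁) * |z| := by
    rw [abs_mul]
    gcongr
    exact abs_rpow_sub_rpow_le hβ hθ₁ hθ₁1 hθ₁β (abs_nonneg p) hU (by linarith) (by linarith)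
      (abs_abs_sub_abs_le p U)
  have h4 : 0 ≤ (n + |U|) ^ (β - θ₁) * (|p - U| ^ θ₁ * |z|) := by positivity
  have h5 : 0 ≤ (n + |U|) ^ (β - θ₂) * (|q| ^ θ₂ * |z|) := by positivity
  have h6 : 0 ≤ max 1 β * ((n + |U|) ^ β * |q - z|) := by positivity
  rw [e]
  calc _ ≤ |n ^ β * (q - z)| + |(n ^ β - |p| ^ β) * z| + |(|p| ^ β - |U| ^ β) * z| :=
        abs_add_three _ _ _
    _ ≤ _ := by linarith

end Elementary

/-! ## Duhamel integrals of vector-valued sources -/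

section VectorDuhamel

set_option linter.unusedSectionVars false

variable {d : ℕ} {F : Type*} [NormedAddCommGroup F] [NormedSpace ℝ F]

/-- The vector-valued Duhamel integral. -/
noncomputable def vecDuhamel {d : ℕ} {F : Type*} [NormedAddCommGroup F] [NormedSpace ℝ F]
    (N : ℝ → E d → F) (t : ℝ) (x : E d) : F :=
  ∫ τ in (0 : ℝ)..t, heat (t - τ) (N τ) x

/-- Joint measurability of a time-dependent vector-valued function on `(0, ∞)`. -/
def VecMeas {d : ℕ} {F : Type*} [NormedAddCommGroup F] (N : ℝ → E d → F) : Prop :=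
  AEStronglyMeasurable (Function.uncurry N)
    ((volume.restrict (Ioi (0 : ℝ))).prod (volume : Measure (E d)))

theorem VecMeas.enorm {N : ℝ → E d → F} (hN : VecMeas N) : FamMeas (fun t x => ‖N t x‖ₑ) :=
  AEStronglyMeasurable.enorm hN

theorem enorm_heat_le {t : ℝ} (ht : 0 < t) (f : E d → F) (x : E d) :
    ‖heat t f x‖ₑ ≤ eHeat t (fun y => ‖f y‖ₑ) x := by
  refine (enorm_integral_le_lintegral_enorm _).trans (lintegral_mono fun y => ?_)
  rw [enorm_smul, Real.enorm_of_nonneg (heatKernel_nonneg ht _)]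

theorem enorm_vecDuhamel_le (N : ℝ → E d → F) {t : ℝ} (ht : 0 < t) (x : E d) :
    ‖vecDuhamel N t x‖ₑ ≤ duhamel (fun τ y => ‖N τ y‖ₑ) t x := by
  rw [vecDuhamel, intervalIntegral.integral_of_le ht.le, integral_Ioc_eq_integral_Ioo]
  exact (enorm_integral_le_lintegral_enorm _).trans
    (setLIntegral_mono' measurableSet_Ioo fun τ hτ => enorm_heat_le (sub_pos.mpr hτ.2) _ _)

/-- Bochner integrals are additive only on integrable functions, so differences of Duhamel terms
need the finiteness of the scalar Duhamel integral of the norms. It makes the iterated integral a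
single integral over space-time. -/
theorem integrable_kernel_smul {N : ℝ → E d → F} (hN : VecMeas N) {t : ℝ} {x : E d}
    (hfin : duhamel (fun τ y => ‖N τ y‖ₑ) t x < ∞) :
    Integrable (fun z : ℝ × E d => heatKernel (t - z.1) (x - z.2) • N z.1 z.2)
      ((volume.restrict (Ioo (0 : ℝ) t)).prod volume) := by
  have hle : (volume.restrict (Ioo (0 : ℝ) t)).prod (volume : Measure (E d)) ≤
      (volume.restrict (Ioi (0 : ℝ))).prod volume :=
    Measure.prod_mono (Measure.restrict_mono Ioo_subset_Ioi_self le_rfl) le_rfl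
  have hK : Measurable fun z : ℝ × E d => (heatKernel (t - z.1) (x - z.2) : ℝ) := by
    have := (measurable_heatKernel_uncurry (d := d)).comp
      (show Measurable fun z : ℝ × E d => (t - z.1, x - z.2) by fun_prop)
    exact this
  have hm : AEStronglyMeasurable (fun z : ℝ × E d => heatKernel (t - z.1) (x - z.2) • N z.1 z.2)
      ((volume.restrict (Ioo (0 : ℝ) t)).prod volume) :=
    hK.aestronglyMeasurable.smul (AEStronglyMeasurable.mono_measure hN hle)
  refine ⟨hm, ?_⟩
  rw [HasFiniteIntegral, lintegral_prod _ hm.enorm]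
  refine lt_of_le_of_lt (le_of_eq ?_) hfin
  refine setLIntegral_congr_fun measurableSet_Ioo fun τ hτ => ?_
  refine lintegral_congr fun y => ?_
  rw [enorm_smul, Real.enorm_of_nonneg (heatKernel_nonneg (sub_pos.mpr hτ.2) _)]

theorem vecDuhamel_eq_integral_prod {N : ℝ → E d → F} (hN : VecMeas N) {t : ℝ} (ht : 0 < t)
    {x : E d} (hfin : duhamel (fun τ y => ‖N τ y‖ₑ) t x < ∞) :
    vecDuhamel N t x = ∫ z : ℝ × E d, heatKernel (t - z.1) (x - z.2) • N z.1 z.2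
      ∂((volume.restrict (Ioo (0 : ℝ) t)).prod volume) := by
  rw [integral_prod _ (integrable_kernel_smul hN hfin), vecDuhamel,
    intervalIntegral.integral_of_le ht.le, integral_Ioc_eq_integral_Ioo]
  rfl

/-- A continuous linear functional of a Duhamel integral minus another Duhamel integral. -/
theorem map_vecDuhamel_sub [CompleteSpace F] (P : F →L[ℝ] ℝ) {N : ℝ → E d → F}
    {N' : ℝ → E d → ℝ}
    (hN : VecMeas N) (hN' : VecMeas N') {t : ℝ} (ht : 0 < t) {x : E d}
    (hfin : duhamel (fun τ y => ‖N τ y‖ₑ) t x < ∞)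
    (hfin' : duhamel (fun τ y => ‖N' τ y‖ₑ) t x < ∞) :
    ‖P (vecDuhamel N t x) - vecDuhamel N' t x‖ₑ ≤
      duhamel (fun τ y => ‖P (N τ y) - N' τ y‖ₑ) t x := by
  have hi := integrable_kernel_smul hN hfin
  have hi' := integrable_kernel_smul hN' hfin'
  have hPi := P.integrable_comp hi
  rw [vecDuhamel_eq_integral_prod hN ht hfin, vecDuhamel_eq_integral_prod hN' ht hfin',
    ← P.integral_comp_comm hi, ← integral_sub hPi hi']
  refine (enorm_integral_le_lintegral_enorm _).trans ?_
  have hm := (hPi.1.sub hi'.1).enorm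
  simp only [Pi.sub_apply] at hm
  rw [lintegral_prod _ hm]
  refine setLIntegral_mono' measurableSet_Ioo fun τ hτ => ?_
  refine lintegral_mono fun y => ?_
  rw [map_smul, ← smul_sub, enorm_smul,
    Real.enorm_of_nonneg (heatKernel_nonneg (sub_pos.mpr hτ.2) _)]

variable {a γ α : ℝ}

/-- The source of a mild solution. -/
noncomputable def mildSource {d : ℕ} {F : Type*} [NormedAddCommGroup F] [NormedSpace ℝ F]
    (γ α : ℝ) (V v : ℝ → E d → F) (τ : ℝ) (y : E d) : F :=
  (‖y‖ ^ γ * ‖V τ y‖ ^ (α - 1)) • v τ y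

theorem enorm_smul_of_sign (ha : a = 1 ∨ a = -1) (y : F) : ‖a • y‖ₑ = ‖y‖ₑ := by
  rcases ha with rfl | rfl <;> simp

theorem VecMeas.mildSource {V v : ℝ → E d → F} (hV : VecMeas V) (hv : VecMeas v) :
    VecMeas (mildSource γ α V v) := by
  have h1 : Measurable fun z : ℝ × E d => ‖z.2‖ ^ γ := by fun_prop
  have h2 : AEStronglyMeasurable (fun z : ℝ × E d => ‖V z.1 z.2‖ ^ (α - 1))
      ((volume.restrict (Ioi (0 : ℝ))).prod (volume : Measure (E d))) :=
    (AEMeasurable.pow_const (AEStronglyMeasurable.norm hV).aemeasurable _).aestronglyMeasurable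
  exact AEStronglyMeasurable.smul (h1.aestronglyMeasurable.mul h2) hv

theorem enorm_mildSource (hα : 1 ≤ α) (V v : ℝ → E d → F) (τ : ℝ) (y : E d) :
    ‖mildSource γ α V v τ y‖ₑ =
      ENNReal.ofReal (‖y‖ ^ γ) * ‖V τ y‖ₑ ^ (α - 1) * ‖v τ y‖ₑ := by
  rw [mildSource, enorm_smul, Real.enorm_of_nonneg (by positivity),
    ENNReal.ofReal_mul (by positivity), ← ENNReal.ofReal_rpow_of_nonneg (norm_nonneg (V τ y))
    (by linarith), ofReal_norm]

namespace IsMildSolution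

theorem enorm_le (ha : a = 1 ∨ a = -1) {V L v : ℝ → E d → F} (hv : IsMildSolution a γ α V L v)
    {t : ℝ} (ht : 0 < t) : ∀ᵐ x, ‖v t x‖ₑ ≤ ‖L t x‖ₑ +
      duhamel (fun τ y => ‖mildSource γ α V v τ y‖ₑ) t x := by
  filter_upwards [hv.equation t ht] with x hx
  rw [hx]
  refine (enorm_add_le _ _).trans ?_
  rw [enorm_smul_of_sign ha]
  gcongr
  exact enorm_vecDuhamel_le (mildSource γ α V v) ht x

/-- The functional P commutes with the absolutely convergent Duhamel integral, so the cancellation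
between the two sources takes place inside it. -/
theorem enorm_map_sub_le [CompleteSpace F] (ha : a = 1 ∨ a = -1) (P : F →L[ℝ] ℝ)
    {V L v : ℝ → E d → F}
    {V' L' v' : ℝ → E d → ℝ} (hV : VecMeas V) (hV' : VecMeas V')
    (hv : IsMildSolution a γ α V L v) (hv' : IsMildSolution a γ α V' L' v') {t : ℝ} (ht : 0 < t)
    (hfin : ∀ᵐ x, duhamel (fun τ y => ‖mildSource γ α V v τ y‖ₑ) t x < ∞)
    (hfin' : ∀ᵐ x, duhamel (fun τ y => ‖mildSource γ α V' v' τ y‖ₑ) t x < ∞) :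
    ∀ᵐ x, ‖P (v t x) - v' t x‖ₑ ≤ ‖P (L t x) - L' t x‖ₑ +
      duhamel (fun τ y => ‖P (mildSource γ α V v τ y) - mildSource γ α V' v' τ y‖ₑ) t x := by
  filter_upwards [hv.equation t ht, hv'.equation t ht, hfin, hfin'] with x hx hx' hf hf'
  have key := map_vecDuhamel_sub P (hV.mildSource hv.measurable) (hV'.mildSource hv'.measurable)
    ht hf hf'
  have e1 : v t x = L t x + a • vecDuhamel (mildSource γ α V v) t x := hx
  have e2 : v' t x = L' t x + a • vecDuhamel (mildSource γ α V' v') t x := hx'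
  rw [e1, e2, map_add, map_smul, add_sub_add_comm, ← smul_sub]
  refine (enorm_add_le _ _).trans ?_
  rw [enorm_smul_of_sign ha]
  gcongr

theorem enorm_map_le [CompleteSpace F] (ha : a = 1 ∨ a = -1) (P : F →L[ℝ] ℝ)
    {V L v : ℝ → E d → F} (hV : VecMeas V)
    (hv : IsMildSolution a γ α V L v) {t : ℝ} (ht : 0 < t)
    (hfin : ∀ᵐ x, duhamel (fun τ y => ‖mildSource γ α V v τ y‖ₑ) t x < ∞) :
    ∀ᵐ x, ‖P (v t x)‖ₑ ≤ ‖P (L t x)‖ₑ +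
      duhamel (fun τ y => ‖P (mildSource γ α V v τ y)‖ₑ) t x := by
  filter_upwards [hv.equation t ht, hfin] with x hx hf
  have h0 : VecMeas (fun (_ : ℝ) (_ : E d) => (0 : ℝ)) := aestronglyMeasurable_const
  have key := map_vecDuhamel_sub P (hV.mildSource hv.measurable) h0 ht hf
    (by simp [duhamel, eHeat])
  have e0 : vecDuhamel (fun (_ : ℝ) (_ : E d) => (0 : ℝ)) t x = 0 := by simp [vecDuhamel, heat]
  have e1 : v t x = L t x + a • vecDuhamel (mildSource γ α V v) t x := hx
  simp only [e0, sub_zero] at key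
  rw [e1, map_add, map_smul]
  refine (enorm_add_le _ _).trans ?_
  rw [enorm_smul_of_sign ha]
  gcongr

end IsMildSolution

end VectorDuhamel

/-! ## Tempered distributions and superpositions of translates -/

section Superposition

set_option synthInstance.maxHeartbeats 200000

variable {d : ℕ}

open BoundedContinuousFunction

theorem SchwartzMap.iteratedFDeriv_bound (g : 𝓢(E d, ℂ)) (k n : ℕ) :
    ∃ C, 0 ≤ C ∧ ∀ x, (1 + ‖x‖) ^ k * ‖iteratedFDeriv ℝ n g x‖ ≤ C :=
  ⟨2 ^ k * (Finset.Iic (k, n)).sup (fun m => SchwartzMap.seminorm ℝ m.1 m.2) g,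
    by positivity, fun x => SchwartzMap.one_add_le_sup_seminorm_apply (m := (k, n)) le_rfl le_rfl g x⟩

theorem SchwartzMap.continuous_iteratedFDeriv' (g : 𝓢(E d, ℂ)) (n : ℕ) :
    Continuous (iteratedFDeriv ℝ n g) :=
  (g.smooth ⊤).continuous_iteratedFDeriv (mod_cast le_top)

/-- Derivatives of a convolution of an integrable function with a Schwartz function. -/
theorem iteratedFDeriv_integral_translate (g : 𝓢(E d, ℂ)) {ρ : E d → ℂ} (hρ : Integrable ρ)
    (n : ℕ) (w : E d) : iteratedFDeriv ℝ n (fun w => ∫ y, ρ y • g (w - y)) w =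
      ∫ y, ρ y • iteratedFDeriv ℝ n g (w - y) := by
  have hint : ∀ n w, Integrable fun y => ρ y • iteratedFDeriv ℝ n g (w - y) := by
    intro n w
    obtain ⟨C, -, hC⟩ := g.iteratedFDeriv_bound 0 n
    simp only [pow_zero, one_mul] at hC
    refine hρ.smul_of_top_left ?_
    refine memLp_top_of_bound ?_ C (Eventually.of_forall fun y => hC _)
    exact ((g.continuous_iteratedFDeriv' n).comp (by fun_prop)).aestronglyMeasurable
  induction n generalizing w with
  | zero =>
    ext m
    rw [iteratedFDeriv_zero_apply]
    have := ContinuousLinearMap.integral_comp_comm (ContinuousMultilinearMap.apply ℝ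
      (fun _ : Fin 0 => E d) ℂ m) (hint 0 w)
    rw [ContinuousMultilinearMap.apply_apply] at this
    rw [← this]
    simp [ContinuousMultilinearMap.apply_apply]
  | succ n ih =>
    obtain ⟨C, hC0, hC⟩ := g.iteratedFDeriv_bound 0 (n + 1)
    simp only [pow_zero, one_mul] at hC
    have hdiff : ∀ ξ, HasFDerivAt (iteratedFDeriv ℝ n g) (fderiv ℝ (iteratedFDeriv ℝ n g) ξ) ξ :=
      fun ξ => ((g.smooth ⊤).differentiable_iteratedFDeriv (mod_cast WithTop.coe_lt_top n) ξ).hasFDerivAt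
    have key : HasFDerivAt (fun w => ∫ y, ρ y • iteratedFDeriv ℝ n g (w - y))
        (∫ y, ρ y • fderiv ℝ (iteratedFDeriv ℝ n g) (w - y)) w := by
      -- The derivative of order n+1 of a Schwartz function is bounded by some C, so |ρ| C dominates
      -- uniformly in w.
      refine hasFDerivAt_integral_of_dominated_of_fderiv_le (𝕜 := ℝ) (s := univ)
        (F := fun w y => ρ y • iteratedFDeriv ℝ n g (w - y))
        (F' := fun w y => ρ y • fderiv ℝ (iteratedFDeriv ℝ n g) (w - y))
        (bound := fun y => ‖ρ y‖ * C) univ_mem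
        (Eventually.of_forall fun w => (hint n w).1) (hint n w) ?_ ?_ (hρ.norm.mul_const C) ?_
      · refine AEStronglyMeasurable.congr
          ((continuousMultilinearCurryLeftEquiv ℝ (fun _ : Fin (n + 1) => E d)
            ℂ).continuous.comp_aestronglyMeasurable (hint (n + 1) w).1)
          (Eventually.of_forall fun y => ?_)
        change continuousMultilinearCurryLeftEquiv ℝ (fun _ : Fin (n + 1) => E d) ℂ
          (ρ y • iteratedFDeriv ℝ (n + 1) g (w - y)) = _
        rw [iteratedFDeriv_succ_eq_comp_left]
        rfl
      · refine Eventually.of_forall fun y x _ => ?_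
        rw [norm_smul, norm_fderiv_iteratedFDeriv]
        gcongr
        exact hC _
      · refine Eventually.of_forall fun y x _ => ?_
        exact ((hdiff (x - y)).comp x ((hasFDerivAt_id x).sub_const y)).const_smul (ρ y)
    rw [iteratedFDeriv_succ_eq_comp_left, Function.comp_apply]
    have hfun : (iteratedFDeriv ℝ n fun w => ∫ y, ρ y • g (w - y)) =
        fun w => ∫ y, ρ y • iteratedFDeriv ℝ n g (w - y) := funext ih
    rw [hfun, key.fderiv]
    have e : ∀ y, ρ y • iteratedFDeriv ℝ (n + 1) g (w - y) =
        (continuousMultilinearCurryLeftEquiv ℝ (fun _ : Fin (n + 1) => E d) ℂ).symm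
          (ρ y • fderiv ℝ (iteratedFDeriv ℝ n g) (w - y)) := by
      intro y
      rw [iteratedFDeriv_succ_eq_comp_left]
      rfl
    simp_rw [e]
    exact (ContinuousLinearEquiv.integral_comp_comm (𝕜 := ℝ) (E := E d →L[ℝ] E d [×n]→L[ℝ] ℂ)
      (F := E d [×(n + 1)]→L[ℝ] ℂ) (continuousMultilinearCurryLeftEquiv ℝ
      (fun _ : Fin (n + 1) => E d) ℂ).symm.toContinuousLinearEquiv
      (μ := (volume : Measure (E d)))
      (fun y => ρ y • fderiv ℝ (iteratedFDeriv ℝ n g) (w - y))).symm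

/-- The space of values of `n`-th derivatives. -/
def DerivSpace (d n : ℕ) : Type := E d [×n]→L[ℝ] ℂ

noncomputable instance (d n : ℕ) : NormedAddCommGroup (DerivSpace d n) :=
  inferInstanceAs (NormedAddCommGroup (E d [×n]→L[ℝ] ℂ))

noncomputable instance (d n : ℕ) : NormedSpace ℂ (DerivSpace d n) :=
  inferInstanceAs (NormedSpace ℂ (E d [×n]→L[ℝ] ℂ))

instance (d n : ℕ) : CompleteSpace (DerivSpace d n) :=
  inferInstanceAs (CompleteSpace (E d [×n]→L[ℝ] ℂ))

/-- The `n`-th derivative of a Schwartz function. -/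
noncomputable def schwartzDeriv (n : ℕ) (g : 𝓢(E d, ℂ)) (x : E d) : DerivSpace d n :=
  iteratedFDeriv ℝ n g x

theorem continuous_schwartzDeriv (n : ℕ) (g : 𝓢(E d, ℂ)) : Continuous (schwartzDeriv n g) :=
  g.continuous_iteratedFDeriv' n

theorem schwartzDeriv_add (n : ℕ) (f g : 𝓢(E d, ℂ)) (x : E d) :
    schwartzDeriv n (f + g) x = schwartzDeriv n f x + schwartzDeriv n g x :=
  iteratedFDeriv_add_apply (𝕜 := ℝ) (i := n) (x := x) (f.smooth _).contDiffAt
    (g.smooth _).contDiffAt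

theorem schwartzDeriv_smul (n : ℕ) (c : ℂ) (g : 𝓢(E d, ℂ)) (x : E d) :
    schwartzDeriv n (c • g) x = c • schwartzDeriv n g x :=
  iteratedFDeriv_const_smul_apply (𝕜 := ℝ) (i := n) (x := x) (a := c) (g.smooth _).contDiffAt

theorem schwartzDeriv_superposition (n : ℕ) (g h : 𝓢(E d, ℂ)) {ρ : E d → ℂ} (hρ : Integrable ρ)
    (hh : ∀ w, h w = ∫ y, ρ y • g (w - y)) (w : E d) :
    schwartzDeriv n h w = ∫ y, ρ y • schwartzDeriv n g (w - y) := by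
  have h2 : (h : E d → ℂ) = fun w => ∫ y, ρ y • g (w - y) := funext hh
  have h1 := iteratedFDeriv_integral_translate g hρ n w
  rw [← h2] at h1
  exact h1

/-- The bounded function `x ↦ ‖x‖^k D^n g(x)`. -/
noncomputable def weightedDeriv (k n : ℕ) (g : 𝓢(E d, ℂ)) : E d →ᵇ DerivSpace d n :=
  BoundedContinuousFunction.ofNormedAddCommGroup (fun x => ((‖x‖ ^ k : ℝ) : ℂ) • schwartzDeriv n g x)
    ((by fun_prop : Continuous fun x : E d => ((‖x‖ ^ k : ℝ) : ℂ)).smul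
      (continuous_schwartzDeriv n g))
    (SchwartzMap.seminorm ℝ k n g) fun x => by
      rw [norm_smul, Complex.norm_real, Real.norm_of_nonneg (by positivity)]
      exact SchwartzMap.le_seminorm ℝ k n g x

theorem weightedDeriv_apply (k n : ℕ) (g : 𝓢(E d, ℂ)) (x : E d) :
    weightedDeriv k n g x = ((‖x‖ ^ k : ℝ) : ℂ) • schwartzDeriv n g x := rfl

theorem seminorm_le_norm_weightedDeriv (k n : ℕ) (g : 𝓢(E d, ℂ)) :
    SchwartzMap.seminorm ℂ k n g ≤ ‖weightedDeriv k n g‖ := by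
  refine SchwartzMap.seminorm_le_bound ℂ k n g (norm_nonneg (weightedDeriv k n g)) fun x => ?_
  have := (weightedDeriv k n g).norm_coe_le_norm x
  rwa [weightedDeriv_apply, norm_smul, Complex.norm_real, Real.norm_of_nonneg (by positivity)] at this

/-- Translation of a Schwartz function. -/
noncomputable abbrev SchwartzMap.shift (g : 𝓢(E d, ℂ)) (y : E d) : 𝓢(E d, ℂ) :=
  SchwartzMap.compSubConstCLM ℂ y g

theorem schwartzDeriv_shift (g : 𝓢(E d, ℂ)) (y : E d) (n : ℕ) (w : E d) :
    schwartzDeriv n (g.shift y) w = schwartzDeriv n g (w - y) :=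
  iteratedFDeriv_comp_sub n y w

/-- Since |w| ≤ (1+|y|)(1+|w-y|), translations grow at most polynomially in every seminorm;
densities with all moments can therefore be integrated against them. -/
theorem norm_weightedDeriv_shift_le (k n : ℕ) (g : 𝓢(E d, ℂ)) :
    ∃ C, 0 ≤ C ∧ ∀ y, ‖weightedDeriv k n (g.shift y)‖ ≤ C * (1 + ‖y‖) ^ k := by
  obtain ⟨C, hC0, hC⟩ := g.iteratedFDeriv_bound k n
  refine ⟨C, hC0, fun y => ?_⟩
  rw [BoundedContinuousFunction.norm_le (by positivity)]
  intro w
  rw [weightedDeriv_apply, norm_smul, Complex.norm_real, Real.norm_of_nonneg (by positivity),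
    schwartzDeriv_shift]
  have h1 : ‖w‖ ≤ (1 + ‖y‖) * (1 + ‖w - y‖) := by
    have := norm_sub_norm_le w y
    nlinarith [norm_nonneg y, norm_nonneg (w - y)]
  calc ‖w‖ ^ k * ‖schwartzDeriv n g (w - y)‖
      ≤ ((1 + ‖y‖) * (1 + ‖w - y‖)) ^ k * ‖schwartzDeriv n g (w - y)‖ := by gcongr
    _ = (1 + ‖y‖) ^ k * ((1 + ‖w - y‖) ^ k * ‖schwartzDeriv n g (w - y)‖) := by
      rw [mul_pow]; ring
    _ ≤ (1 + ‖y‖) ^ k * C := by gcongr; exact hC _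
    _ = _ := mul_comm _ _

/-- Translation is locally Lipschitz in each seminorm: the mean value inequality in the ball of
radius R about w reduces it to decay of the next derivative. -/
theorem continuous_weightedDeriv_shift (k n : ℕ) (g : 𝓢(E d, ℂ)) :
    Continuous fun y => weightedDeriv k n (g.shift y) := by
  obtain ⟨C, hC0, hC⟩ := g.iteratedFDeriv_bound k (n + 1)
  have hlip : ∀ R, 0 ≤ R → ∀ y y', ‖y‖ ≤ R → ‖y'‖ ≤ R →
      dist (weightedDeriv k n (g.shift y)) (weightedDeriv k n (g.shift y')) ≤
        (1 + R) ^ k * C * ‖y - y'‖ := by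
    intro R hR y y' hy hy'
    rw [BoundedContinuousFunction.dist_le (by positivity)]
    intro w
    rw [weightedDeriv_apply, weightedDeriv_apply, dist_eq_norm, schwartzDeriv_shift,
      schwartzDeriv_shift, ← smul_sub, norm_smul, Complex.norm_real,
      Real.norm_of_nonneg (by positivity)]
    have hmv : ∀ D, (∀ ξ, ‖w - ξ‖ ≤ R → ‖fderiv ℝ (iteratedFDeriv ℝ n g) ξ‖ ≤ D) →
        ‖schwartzDeriv n g (w - y) - schwartzDeriv n g (w - y')‖ ≤ D * ‖y - y'‖ := by
      intro D hD
      have := (convex_closedBall w R).norm_image_sub_le_of_norm_fderiv_le (𝕜 := ℝ)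
        (f := iteratedFDeriv ℝ n g) (C := D) (x := w - y') (y := w - y)
        (fun ξ _ => (g.smooth ⊤).differentiable_iteratedFDeriv (mod_cast WithTop.coe_lt_top n) ξ)
        (fun ξ hξ => hD ξ (by rw [← dist_eq_norm, dist_comm]; exact hξ))
        (by simpa [dist_eq_norm] using hy') (by simpa [dist_eq_norm] using hy)
      rwa [show w - y - (w - y') = -(y - y') by abel, norm_neg] at this
    -- The local Lipschitz constant is divided by |w|^k below, which excludes w = 0.
    rcases (norm_nonneg w).eq_or_lt with hw | hw
    · have h1 := hmv C (fun ξ _ => by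
        rw [norm_fderiv_iteratedFDeriv]
        refine le_trans ?_ (hC ξ)
        exact le_mul_of_one_le_left (norm_nonneg _) (one_le_pow₀ (by linarith [norm_nonneg ξ])))
      have h2 : ‖w‖ ^ k ≤ (1 + R) ^ k := by gcongr; linarith
      calc _ ≤ (1 + R) ^ k * (C * ‖y - y'‖) := by gcongr
        _ = _ := by ring
    · have h1 := hmv ((1 + R) ^ k * C / ‖w‖ ^ k) (fun ξ hξ => by
        rw [norm_fderiv_iteratedFDeriv, le_div_iff₀ (by positivity)]
        have h3 : ‖w‖ ≤ (1 + R) * (1 + ‖ξ‖) := by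
          have := norm_sub_norm_le w ξ
          nlinarith [norm_nonneg ξ]
        calc _ ≤ ‖iteratedFDeriv ℝ (n + 1) g ξ‖ * ((1 + R) * (1 + ‖ξ‖)) ^ k := by gcongr
          _ = (1 + R) ^ k * ((1 + ‖ξ‖) ^ k * ‖iteratedFDeriv ℝ (n + 1) g ξ‖) := by
            rw [mul_pow]; ring
          _ ≤ _ := by gcongr; exact hC ξ)
      calc _ ≤ ‖w‖ ^ k * ((1 + R) ^ k * C / ‖w‖ ^ k * ‖y - y'‖) := by gcongr
        _ = _ := by field_simp
  rw [Metric.continuous_iff']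
  intro y₀ ε hε
  have ht : Tendsto (fun y => (1 + (‖y₀‖ + ‖y - y₀‖)) ^ k * C * ‖y - y₀‖) (𝓝 y₀) (𝓝 0) := by
    have : Continuous fun y => (1 + (‖y₀‖ + ‖y - y₀‖)) ^ k * C * ‖y - y₀‖ := by fun_prop
    simpa using this.tendsto y₀
  filter_upwards [ht.eventually_lt_const hε] with y hy
  refine (hlip (‖y₀‖ + ‖y - y₀‖) (by positivity) y y₀ ?_ (by linarith [norm_nonneg (y - y₀)])).trans_lt hy
  have := norm_sub_norm_le y y₀
  linarith

/-- The collection of bounded functions `‖x‖^k D^n g(x)`, `(k, n) ∈ ι`, as a linear map. -/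
noncomputable def weightedDerivs (ι : Finset (ℕ × ℕ)) :
    𝓢(E d, ℂ) →ₗ[ℂ] ((i : ι) → E d →ᵇ DerivSpace d i.1.2) where
  toFun g i := weightedDeriv i.1.1 i.1.2 g
  map_add' f g := by
    ext i x : 2
    simp only [Pi.add_apply, BoundedContinuousFunction.add_apply, weightedDeriv_apply]
    rw [schwartzDeriv_add, smul_add]
  map_smul' c g := by
    ext i x : 2
    simp only [Pi.smul_apply, BoundedContinuousFunction.coe_smul, weightedDeriv_apply,
      RingHom.id_apply]
    rw [schwartzDeriv_smul, smul_comm]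

/-- A continuous functional on the Schwartz space factors through finitely many of the bounded
functions `‖x‖^k D^n g(x)`. -/
theorem exists_factor_weightedDerivs (φ : 𝓢(E d, ℂ) →ₗ[ℂ] ℂ) (hφ : Continuous φ) :
    ∃ (ι : Finset (ℕ × ℕ)) (Ψ : ((i : ι) → E d →ᵇ DerivSpace d i.1.2) →L[ℂ] ℂ),
      ∀ g, Ψ (weightedDerivs ι g) = φ g := by
  obtain ⟨ι, C, -, hC⟩ := Seminorm.bound_of_continuous (schwartz_withSeminorms ℂ (E d) ℂ)
    ((normSeminorm ℂ ℂ).comp φ) (continuous_norm.comp hφ)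
  refine ⟨ι, ?_⟩
  set J := weightedDerivs (d := d) ι with hJ
  have hbd : ∀ g, ‖φ g‖ ≤ C * ‖J g‖ := by
    intro g
    refine (hC g).trans ?_
    change C * (ι.sup (schwartzSeminormFamily ℂ (E d) ℂ)) g ≤ _
    gcongr
    refine Seminorm.finset_sup_apply_le (norm_nonneg _) fun i hi => ?_
    exact (seminorm_le_norm_weightedDeriv i.1 i.2 g).trans (norm_le_pi_norm (J g) ⟨i, hi⟩)
  -- The estimate by the norm of J g makes φ a bounded functional on the range of J. A linear right
  -- inverse expresses it there, and Hahn-Banach extends it to the whole product.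
  obtain ⟨R, hR⟩ := J.rangeRestrict.exists_rightInverse_of_surjective J.range_rangeRestrict
  have hR' : ∀ b : J.range, J (R b) = b := fun b => congrArg Subtype.val (LinearMap.congr_fun hR b)
  obtain ⟨Ψ, hΨ, -⟩ := exists_extension_norm_eq J.range
    ((φ ∘ₗ R).mkContinuous C fun b => by
      refine (hbd (R b)).trans_eq ?_
      rw [hR' b]
      rfl)
  refine ⟨Ψ, fun g => ?_⟩
  have h1 := hΨ ⟨J g, LinearMap.mem_range_self J g⟩
  refine h1.trans ?_
  change φ (R ⟨J g, LinearMap.mem_range_self J g⟩) = φ g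
  -- The value does not depend on the preimage: φ vanishes wherever J does.
  have h2 := hbd (R ⟨J g, LinearMap.mem_range_self J g⟩ - g)
  rw [map_sub, map_sub, hR', sub_self, norm_zero, mul_zero] at h2
  exact sub_eq_zero.mp (norm_le_zero_iff.mp h2)

/-- A tempered distribution commutes with superpositions of translates of a test function. -/
theorem map_superposition (φ : 𝓢(E d, ℂ) →ₗ[ℂ] ℂ) (hφ : Continuous φ) (g h : 𝓢(E d, ℂ))
    {ρ : E d → ℂ} (hρ : ∀ k : ℕ, Integrable fun y => (1 + ‖y‖) ^ k * ‖ρ y‖)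
    (hρm : AEStronglyMeasurable ρ)
    (hh : ∀ w, h w = ∫ y, ρ y • g (w - y)) :
    Integrable (fun y => ρ y • φ (g.shift y)) ∧ φ h = ∫ y, ρ y • φ (g.shift y) := by
  obtain ⟨ι, Ψ, hΨ⟩ := exists_factor_weightedDerivs φ hφ
  have hρi : Integrable ρ := by
    refine ⟨hρm, ?_⟩
    have := (hρ 0).2
    simpa [HasFiniteIntegral] using this
  -- The superposition is a Bochner integral in a Banach space, and bounded functionals commute with
  -- it; the Schwartz space itself is not normed.
  have hint : Integrable fun y => ρ y • weightedDerivs ι (g.shift y) := by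
    refine Integrable.of_eval fun i => ?_
    obtain ⟨C, hC0, hC⟩ := norm_weightedDeriv_shift_le i.1.1 i.1.2 g
    refine ((hρ i.1.1).const_mul C).mono'
      (hρm.smul (continuous_weightedDeriv_shift i.1.1 i.1.2 g).aestronglyMeasurable) ?_
    refine Eventually.of_forall fun y => ?_
    calc ‖ρ y • weightedDeriv i.1.1 i.1.2 (g.shift y)‖ =
          ‖ρ y‖ * ‖weightedDeriv i.1.1 i.1.2 (g.shift y)‖ := norm_smul _ _
      _ ≤ ‖ρ y‖ * (C * (1 + ‖y‖) ^ i.1.1) := by gcongr; exact hC y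
      _ = _ := by ring
  have key : weightedDerivs ι h = ∫ y, ρ y • weightedDerivs ι (g.shift y) := by
    ext i w : 2
    have h1 := ContinuousLinearMap.integral_comp_comm
      ((BoundedContinuousFunction.evalCLM ℂ w).comp
        (ContinuousLinearMap.proj (R := ℂ) (φ := fun i : ι => E d →ᵇ DerivSpace d i.1.2) i)) hint
    refine Eq.trans ?_ h1
    change ((‖w‖ ^ i.1.1 : ℝ) : ℂ) • schwartzDeriv i.1.2 h w =
      ∫ y, ρ y • (((‖w‖ ^ i.1.1 : ℝ) : ℂ) • schwartzDeriv i.1.2 (g.shift y) w)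
    rw [schwartzDeriv_superposition i.1.2 g h hρi hh, ← integral_smul]
    congr 1
    ext y : 1
    rw [schwartzDeriv_shift, smul_comm]
  have he : (fun y => Ψ (ρ y • weightedDerivs ι (g.shift y))) = fun y => ρ y • φ (g.shift y) := by
    ext y
    rw [map_smul, hΨ]
  refine ⟨he ▸ Ψ.integrable_comp hint, ?_⟩
  rw [← hΨ h, key, ← Ψ.integral_comp_comm hint, he]

theorem continuous_map_shift (φ : 𝓢(E d, ℂ) →ₗ[ℂ] ℂ) (hφ : Continuous φ) (g : 𝓢(E d, ℂ)) :
    Continuous fun y => φ (g.shift y) := by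
  obtain ⟨ι, Ψ, hΨ⟩ := exists_factor_weightedDerivs φ hφ
  simp_rw [← hΨ]
  exact Ψ.continuous.comp (continuous_pi fun i => continuous_weightedDeriv_shift i.1.1 i.1.2 g)

end Superposition

/-! ## The heat semigroup property -/

section HeatFlow

variable {d : ℕ}

/-- Completing the square in y; the Gaussian that remains is centred at s x/(t+s). -/
theorem heatKernel_mul_heatKernel {t s : ℝ} (ht : 0 < t) (hs : 0 < s) (x y : E d) :
    heatKernel t (x - y) * heatKernel s y = heatKernel (t + s) x *
      (((4 * Real.pi * (t + s)) ^ (d / 2 : ℝ) *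
        ((4 * Real.pi * t) ^ (-(d / 2 : ℝ)) * (4 * Real.pi * s) ^ (-(d / 2 : ℝ)))) *
      Real.exp (-((t + s) / (4 * t * s)) * ‖y - (s / (t + s)) • x‖ ^ 2)) := by
  have h1 : (4 * Real.pi * (t + s)) ^ (-(d / 2 : ℝ)) * (4 * Real.pi * (t + s)) ^ (d / 2 : ℝ) = 1 := by
    rw [← Real.rpow_add (by positivity)]; simp
  have hexp : -(1 / (4 * t)) * ‖x - y‖ ^ 2 + -(1 / (4 * s)) * ‖y‖ ^ 2 =
      -(1 / (4 * (t + s))) * ‖x‖ ^ 2 +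
        -((t + s) / (4 * t * s)) * ‖y - (s / (t + s)) • x‖ ^ 2 := by
    rw [norm_sub_sq_real, norm_sub_sq_real, norm_smul, real_inner_smul_right, real_inner_comm,
      Real.norm_of_nonneg (by positivity)]
    have : t + s ≠ 0 := by positivity
    field_simp
    ring
  unfold heatKernel
  calc _ = ((4 * Real.pi * t) ^ (-(d / 2 : ℝ)) * (4 * Real.pi * s) ^ (-(d / 2 : ℝ))) *
        Real.exp (-(1 / (4 * t)) * ‖x - y‖ ^ 2 + -(1 / (4 * s)) * ‖y‖ ^ 2) := by
        rw [Real.exp_add]; ring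
    _ = ((4 * Real.pi * (t + s)) ^ (-(d / 2 : ℝ)) * (4 * Real.pi * (t + s)) ^ (d / 2 : ℝ)) *
        (((4 * Real.pi * t) ^ (-(d / 2 : ℝ)) * (4 * Real.pi * s) ^ (-(d / 2 : ℝ))) *
        Real.exp (-(1 / (4 * (t + s))) * ‖x‖ ^ 2 +
        -((t + s) / (4 * t * s)) * ‖y - (s / (t + s)) • x‖ ^ 2)) := by rw [h1, one_mul, hexp]
    _ = _ := by rw [Real.exp_add]; ring

theorem integral_heatKernel_mul {t s : ℝ} (ht : 0 < t) (hs : 0 < s) (x w : E d) :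
    ∫ y, heatKernel t (x - y) * heatKernel s (y - w) = heatKernel (t + s) (x - w) := by
  have hshift : ∫ y, heatKernel t (x - y) * heatKernel s (y - w) =
      ∫ y, heatKernel t (x - w - y) * heatKernel s y := by
    rw [← integral_add_right_eq_self _ w]
    congr 1
    ext y
    rw [add_sub_cancel_right, sub_sub, add_comm w y]
  rw [hshift]
  simp_rw [heatKernel_mul_heatKernel ht hs]
  rw [integral_const_mul, integral_const_mul]
  have h2 := integral_sub_right_eq_self
    (fun y : E d => Real.exp (-((t + s) / (4 * t * s)) * ‖y‖ ^ 2)) ((s / (t + s)) • (x - w))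
    (μ := volume)
  rw [h2, GaussianFourier.integral_rexp_neg_mul_sq_norm (by positivity), finrank_euclideanSpace_fin]
  have h3 : (4 * Real.pi * (t + s)) ^ (d / 2 : ℝ) *
        ((4 * Real.pi * t) ^ (-(d / 2 : ℝ)) * (4 * Real.pi * s) ^ (-(d / 2 : ℝ))) *
        (Real.pi / ((t + s) / (4 * t * s))) ^ (d / 2 : ℝ) = 1 := by
    rw [Real.rpow_neg (by positivity), Real.rpow_neg (by positivity), ← Real.inv_rpow (by positivity),
      ← Real.inv_rpow (by positivity), ← Real.mul_rpow (by positivity) (by positivity),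
      ← Real.mul_rpow (by positivity) (by positivity),
      ← Real.mul_rpow (by positivity) (by positivity)]
    have : 4 * Real.pi * (t + s) * ((4 * Real.pi * t)⁻¹ * (4 * Real.pi * s)⁻¹) *
        (Real.pi / ((t + s) / (4 * t * s))) = 1 := by
      have := Real.pi_pos
      field_simp
    rw [this, Real.one_rpow]
  rw [h3, mul_one]

theorem lintegral_heatKernel_mul {t s : ℝ} (ht : 0 < t) (hs : 0 < s) (x w : E d) :
    ∫⁻ y, ENNReal.ofReal (heatKernel t (x - y)) * ENNReal.ofReal (heatKernel s (y - w)) =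
      ENNReal.ofReal (heatKernel (t + s) (x - w)) := by
  rw [← integral_heatKernel_mul ht hs, ofReal_integral_eq_lintegral_ofReal]
  · refine lintegral_congr fun y => ?_
    rw [ENNReal.ofReal_mul (heatKernel_nonneg ht _)]
  · by_contra hcon
    have h := integral_heatKernel_mul ht hs x w
    rw [integral_undef hcon] at h
    have : 0 < heatKernel (t + s) (x - w) := by unfold heatKernel; positivity
    exact this.ne h
  · exact Eventually.of_forall fun y => mul_nonneg (heatKernel_nonneg ht _) (heatKernel_nonneg hs _)

/-- `eHeat` is a semigroup. -/
theorem eHeat_eHeat {t s : ℝ} (ht : 0 < t) (hs : 0 < s) {f : E d → ℝ≥0∞} (hf : AEMeasurable f)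
    (x : E d) : eHeat t (eHeat s f) x = eHeat (t + s) f x := by
  have hK : ∀ t, Measurable fun z : E d × E d => ENNReal.ofReal (heatKernel t (z.1 - z.2)) := by
    intro t
    exact ((measurable_heatKernel t).comp (measurable_fst.sub measurable_snd)).ennreal_ofReal
  unfold eHeat
  calc _ = ∫⁻ y, ∫⁻ w, ENNReal.ofReal (heatKernel t (x - y)) *
        (ENNReal.ofReal (heatKernel s (y - w)) * f w) := by
        refine lintegral_congr fun y => (lintegral_const_mul'' _ ?_).symm
        exact (((hK s).comp (measurable_const.prodMk measurable_id)).aemeasurable.mul hf :)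
    _ = ∫⁻ w, ∫⁻ y, ENNReal.ofReal (heatKernel t (x - y)) *
        (ENNReal.ofReal (heatKernel s (y - w)) * f w) := by
        refine lintegral_lintegral_swap ?_
        refine AEMeasurable.mul ?_ ((hK s).aemeasurable.mul hf.comp_snd)
        exact (((hK t).comp (measurable_const.prodMk measurable_fst)).aemeasurable :)
    _ = _ := by
        refine lintegral_congr fun w => ?_
        rw [← lintegral_heatKernel_mul ht hs, ← lintegral_mul_const]
        · simp_rw [mul_assoc]
        · exact (((hK t).comp (measurable_const.prodMk measurable_id)).mul
            ((hK s).comp (measurable_id.prodMk measurable_const)) :)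

variable {F : Type*} [NormedAddCommGroup F] [NormedSpace ℝ F]

/-- `h(t + s) = e^{tΔ} h(s)` for all `s, t > 0`. -/
structure IsHeatFlow {d : ℕ} {F : Type*} [NormedAddCommGroup F] [NormedSpace ℝ F]
    (h : ℝ → E d → F) : Prop where
  measurable : ∀ t, 0 < t → AEStronglyMeasurable (h t) volume
  integrable : ∀ t s, 0 < t → 0 < s → ∀ᵐ x, Integrable fun y => heatKernel t (x - y) • h s y
  semigroup : ∀ t s, 0 < t → 0 < s → ∀ᵐ x, h (t + s) x = heat t (h s) x

namespace IsHeatFlow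

theorem sub {h h' : ℝ → E d → F} (hh : IsHeatFlow h) (hh' : IsHeatFlow h') :
    IsHeatFlow (fun t x => h t x - h' t x) where
  measurable t ht := (hh.measurable t ht).sub (hh'.measurable t ht)
  integrable t s ht hs := by
    filter_upwards [hh.integrable t s ht hs, hh'.integrable t s ht hs] with x h1 h2
    simp only [smul_sub]
    exact h1.sub h2
  semigroup t s ht hs := by
    filter_upwards [hh.integrable t s ht hs, hh'.integrable t s ht hs, hh.semigroup t s ht hs,
      hh'.semigroup t s ht hs] with x h1 h2 h3 h4
    rw [h3, h4, heat, heat, ← integral_sub h1 h2]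
    simp only [heat, smul_sub]

theorem map {F' : Type*} [NormedAddCommGroup F'] [NormedSpace ℝ F'] [CompleteSpace F]
    [CompleteSpace F'] (P : F →L[ℝ] F') {h : ℝ → E d → F} (hh : IsHeatFlow h) :
    IsHeatFlow (fun t x => P (h t x)) where
  measurable t ht := P.continuous.comp_aestronglyMeasurable (hh.measurable t ht)
  integrable t s ht hs := by
    filter_upwards [hh.integrable t s ht hs] with x h1
    simpa only [map_smul] using P.integrable_comp h1
  semigroup t s ht hs := by
    filter_upwards [hh.integrable t s ht hs, hh.semigroup t s ht hs] with x h1 h3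
    rw [h3, heat, ← P.integral_comp_comm h1]
    simp only [heat, map_smul]

theorem enorm_le {h : ℝ → E d → F} (hh : IsHeatFlow h) {t s : ℝ} (ht : 0 < t) (hs : 0 < s) :
    ∀ᵐ x, ‖h (t + s) x‖ₑ ≤ eHeat t (fun y => ‖h s y‖ₑ) x := by
  filter_upwards [hh.semigroup t s ht hs] with x hx
  rw [hx]
  exact enorm_heat_le ht _ _

/-- Bounds of a heat flow propagate to smaller weights and larger exponents. -/
theorem katoBound (hd : 0 < d) {h : ℝ → E d → F} (hh : IsHeatFlow h) {ρ k r A : ℝ} (hA : 0 < A)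
    (hr : 0 ≤ r) (hr1 : r < 1) (hK : k + d * r < d)
    (hb : KatoBound ρ k r A (fun t x => ‖h t x‖ₑ)) {k' r' : ℝ} (hk : k' ≤ k) (hr' : 0 ≤ r')
    (hrr : r' ≤ r) (hK' : 0 ≤ k' + d * r') :
    ∃ B > 0, KatoBound ρ k' r' B (fun t x => ‖h t x‖ₑ) := by
  obtain ⟨C, hC, H⟩ := WeakBound.eHeat hd hr hr1 hK hk hr' (by linarith) hK'
    (by gcongr : k' + d * r' ≤ k + d * r)
  refine ⟨C * A * 2⁻¹ ^ (-(ρ - (k' + d * r')) / 2), by positivity, fun t ht => ?_⟩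
  -- Half of the time is spent on the given bound and half on smoothing, so the order ρ is
  -- unchanged.
  have ht2 : 0 < t / 2 := by positivity
  have h1 := H (t / 2) ht2 _ (hh.measurable _ ht2).enorm _ (by positivity) (hb (t / 2) ht2)
  have h2 := hh.enorm_le ht2 ht2
  rw [add_halves] at h2
  refine (h1.mono h2).mono_const (le_of_eq ?_)
  have e1 : t / 2 = 2⁻¹ * t := by ring
  have e2 : -(ρ - (k' + d * r')) / 2 =
      -(ρ - (k + d * r)) / 2 + -(k + d * r - (k' + d * r')) / 2 := by ring
  calc _ = C * A * (t / 2) ^ (-(ρ - (k' + d * r')) / 2) := by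
        rw [e2, Real.rpow_add ht2]; ring
    _ = _ := by rw [e1, Real.mul_rpow (by positivity) ht.le]; ring

/-- A heat flow which is of lower order than the homogeneity of the norm vanishes. -/
theorem ae_eq_zero (hd : 0 < d) {h : ℝ → E d → F} (hh : IsHeatFlow h) {ρ k r A : ℝ} (hA : 0 < A)
    (hr : 0 ≤ r) (hr1 : r < 1) (hK0 : 0 ≤ k + d * r) (hK : k + d * r < d) (hρ : ρ < k + d * r)
    (hb : KatoBound ρ k r A (fun t x => ‖h t x‖ₑ)) {t : ℝ} (ht : 0 < t) :
    ∀ᵐ x, ‖h t x‖ₑ = 0 := by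
  obtain ⟨C, hC, H⟩ := WeakBound.eHeat hd hr hr1 hK le_rfl hr hr1.le hK0 le_rfl
  refine WeakBound.ae_eq_zero (k := k) (r := r) hd fun B hB => ?_
  -- Since ρ < k + dr, the norm at time s tends to zero as s → 0, while the flow from s to t
  -- increases it at most by the factor C.
  have hlim : Tendsto (fun s : ℝ => C * (A * s ^ (-(ρ - (k + d * r)) / 2))) (𝓝[>] 0) (𝓝 0) := by
    have h1 : Continuous fun s : ℝ => C * (A * s ^ (-(ρ - (k + d * r)) / 2)) :=
      continuous_const.mul (continuous_const.mul (Real.continuous_rpow_const (by linarith)))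
    have h2 := (h1.tendsto 0).mono_left (nhdsWithin_le_nhds (s := Ioi 0))
    rwa [Real.zero_rpow (by linarith), mul_zero, mul_zero] at h2
  obtain ⟨s, hsB, hs⟩ := ((hlim.eventually_lt_const hB).and
    (Ioo_mem_nhdsGT ht : ∀ᶠ s in 𝓝[>] (0 : ℝ), s ∈ Ioo 0 t)).exists
  have hs0 : 0 < s := hs.1
  have h1 := H (t - s) (sub_pos.mpr hs.2) _ (hh.measurable s hs0).enorm _ (by positivity) (hb s hs0)
  have h2 := hh.enorm_le (sub_pos.mpr hs.2) hs0
  rw [sub_add_cancel] at h2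
  refine (h1.mono h2).mono_const ?_
  rw [sub_self, neg_zero, zero_div, Real.rpow_zero, mul_one]
  exact hsB.le

end IsHeatFlow

theorem aestronglyMeasurable_heat {f : E d → F} (hf : AEStronglyMeasurable f volume) (t : ℝ) :
    AEStronglyMeasurable (heat t f) volume := by
  have hK : Measurable fun z : E d × E d => heatKernel t (z.1 - z.2) :=
    (measurable_heatKernel t).comp (measurable_fst.sub measurable_snd)
  exact AEStronglyMeasurable.integral_prod_right'
    (f := fun z : E d × E d => heatKernel t (z.1 - z.2) • f z.2)
    (hK.aestronglyMeasurable.smul hf.comp_snd)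

/-- The heat flow of a function. -/
theorem isHeatFlow_heat [CompleteSpace F] {f : E d → F} (hf : AEStronglyMeasurable f volume)
    (hfin : ∀ t, 0 < t → ∀ᵐ x, eHeat t (fun y => ‖f y‖ₑ) x < ∞) :
    IsHeatFlow (fun t => heat t f) where
  measurable t _ := aestronglyMeasurable_heat hf t
  integrable t s ht hs := by
    filter_upwards [hfin (t + s) (by positivity)] with x hx
    -- Finiteness at time t+s, read through the semigroup law for moduli, is absolute convergence of
    -- the composed flow.
    rw [← eHeat_eHeat ht hs hf.enorm] at hx
    have hK : Measurable fun y : E d => heatKernel t (x - y) :=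
      (measurable_heatKernel t).comp (measurable_const.sub measurable_id)
    refine ⟨hK.aestronglyMeasurable.smul (aestronglyMeasurable_heat hf s), lt_of_le_of_lt ?_ hx⟩
    refine lintegral_mono fun y => ?_
    rw [enorm_smul, Real.enorm_of_nonneg (heatKernel_nonneg ht _)]
    gcongr
    exact enorm_heat_le hs _ _
  semigroup t s ht hs := by
    filter_upwards [hfin (t + s) (by positivity)] with x hx
    rw [← eHeat_eHeat ht hs hf.enorm] at hx
    have hK : ∀ t, Measurable fun z : E d × E d => heatKernel t (z.1 - z.2) := fun t =>
      (measurable_heatKernel t).comp (measurable_fst.sub measurable_snd)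
    have hKx : ∀ (t : ℝ), Measurable fun y : E d => heatKernel t (x - y) := fun t =>
      (measurable_heatKernel t).comp (measurable_const.sub measurable_id)
    have hm : AEStronglyMeasurable (fun z : E d × E d =>
        heatKernel t (x - z.1) • heatKernel s (z.1 - z.2) • f z.2) (volume.prod volume) :=
      ((hKx t).comp measurable_fst).aestronglyMeasurable.smul
        ((hK s).aestronglyMeasurable.smul hf.comp_snd)
    have hint : Integrable (fun z : E d × E d =>
        heatKernel t (x - z.1) • heatKernel s (z.1 - z.2) • f z.2) (volume.prod volume) := by
      refine ⟨hm, ?_⟩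
      rw [HasFiniteIntegral, lintegral_prod _ hm.enorm]
      refine lt_of_le_of_lt (lintegral_mono fun y => ?_) hx
      rw [eHeat, ← lintegral_const_mul'' _]
      · refine lintegral_mono fun w => ?_
        rw [enorm_smul, enorm_smul, Real.enorm_of_nonneg (heatKernel_nonneg ht _),
          Real.enorm_of_nonneg (heatKernel_nonneg hs _)]
      · exact ((measurable_heatKernel s).comp
          (measurable_const.sub measurable_id)).ennreal_ofReal.aemeasurable.mul hf.enorm
    have hswap := integral_integral_swap
      (f := fun y w => heatKernel t (x - y) • heatKernel s (y - w) • f w) hint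
    simp only [heat]
    calc _ = ∫ w, ∫ y, heatKernel t (x - y) • heatKernel s (y - w) • f w := by
          congr 1
          ext w
          rw [← integral_heatKernel_mul ht hs, ← integral_smul_const]
          simp only [mul_smul]
      _ = ∫ y, ∫ w, heatKernel t (x - y) • heatKernel s (y - w) • f w := hswap.symm
      _ = _ := by
          congr 1
          ext y
          rw [integral_smul]

theorem heatKernelSchwartz_eq_shift {t : ℝ} (ht : 0 < t) (y : E d) :
    (heatKernelSchwartz ht 0).shift y = heatKernelSchwartz ht y := by
  ext w
  rw [heatKernelSchwartz_apply, SchwartzMap.compSubConstCLM_apply, heatKernelSchwartz_apply]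
  congr 2
  abel

/-- The heat flow of a tempered distribution. -/
theorem isHeatFlow_heatDist (φ : 𝓢'(E d, ℂ)) : IsHeatFlow (heatDist φ) := by
  have hφ : Continuous (fun g : 𝓢(E d, ℂ) => φ g) := φ.continuous
  have hval : ∀ {s : ℝ} (hs : 0 < s), heatDist φ s = fun y => φ ((heatKernelSchwartz hs 0).shift y) := by
    intro s hs
    ext y
    rw [heatDist, dif_pos hs, heatKernelSchwartz_eq_shift]
  have key : ∀ t s : ℝ, 0 < t → 0 < s → ∀ x : E d,
      Integrable (fun y => heatKernel t (x - y) • heatDist φ s y) ∧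
        heatDist φ (t + s) x = heat t (heatDist φ s) x := by
    intro t s ht hs x
    have hts : 0 < t + s := by positivity
    -- The kernel at time t+s is a superposition of translates of the kernel at time s, with the
    -- Gaussian density G_t(x - ·), which has all moments.
    have h := map_superposition (ContinuousLinearMap.toLinearMap φ) hφ (heatKernelSchwartz hs 0)
      (heatKernelSchwartz hts x) (ρ := heatKernelSchwartz ht x) (fun k => ?_)
      (heatKernelSchwartz ht x).continuous.aestronglyMeasurable (fun w => ?_)
    · simp only [heatKernelSchwartz_apply] at h
      rw [heat, hval hs, heatDist, dif_pos hts]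
      exact h
    · have h1 := ((heatKernelSchwartz ht x).integrable_pow_mul volume 0).add
        ((heatKernelSchwartz ht x).integrable_pow_mul volume k)
      refine (h1.const_mul (2 ^ (k - 1))).mono'
        (Continuous.aestronglyMeasurable (by fun_prop)) (Eventually.of_forall fun y => ?_)
      rw [Real.norm_of_nonneg (by positivity)]
      calc _ ≤ 2 ^ (k - 1) * (1 ^ k + ‖y‖ ^ k) * ‖heatKernelSchwartz ht x y‖ := by
            gcongr
            exact add_pow_le zero_le_one (norm_nonneg _) k
        _ = _ := by simp only [one_pow, pow_zero, Pi.add_apply]; ring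
    · simp only [heatKernelSchwartz_apply, smul_eq_mul, ← Complex.ofReal_mul]
      rw [integral_complex_ofReal, ← integral_heatKernel_mul ht hs]
      congr 2
      ext y
      rw [zero_sub, neg_sub]
  exact {
    measurable := fun t ht => by
      rw [hval ht]
      exact (continuous_map_shift (ContinuousLinearMap.toLinearMap φ) hφ _).aestronglyMeasurable
    integrable := fun t s ht hs => Eventually.of_forall fun x => (key t s ht hs x).1
    semigroup := fun t s ht hs => Eventually.of_forall fun x => (key t s ht hs x).2 }

end HeatFlow

/-! ## Homogeneous data -/

section Homogeneous

variable {d : ℕ}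

theorem aestronglyMeasurable_homData (σ : ℝ) {ω : E d → ℝ} (hω : IsAngular ω) :
    AEStronglyMeasurable (homData σ ω) volume :=
  hω.measurable.mul (by fun_prop : Measurable fun x : E d => ‖x‖ ^ (-σ)).aestronglyMeasurable

theorem weakBound_homData (hd : 0 < d) (σ : ℝ) {ω : E d → ℝ} {M : ℝ} (hM : 0 < M)
    (hωM : eLpNorm ω ⊤ volume ≤ ENNReal.ofReal M) :
    WeakBound σ 0 M (fun x => ‖homData σ ω x‖ₑ) := by
  have h := (WeakBound.norm_rpow (d := d) hd (-σ)).const_mul hM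
  rw [neg_neg, mul_one] at h
  refine h.mono ?_
  rw [eLpNorm_exponent_top] at hωM
  filter_upwards [enorm_ae_le_eLpNormEssSup ω volume] with x hx
  rw [homData, enorm_mul, Real.enorm_of_nonneg (by positivity : 0 ≤ ‖x‖ ^ (-σ))]
  exact mul_le_mul_left (hx.trans hωM) _

/-- Smoothing starts from the weighted L^∞ space with weight σ, in which the data are bounded by the
supremum of ω; this accounts for the conditions σ < d and k + dr ≤ σ. -/
theorem katoBound_heat_homData (hd : 0 < d) {σ k r : ℝ} (hσ : σ < d) (hr : 0 ≤ r) (hr1 : r ≤ 1)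
    (hK : 0 ≤ k + d * r) (hKσ : k + d * r ≤ σ) :
    ∃ C > 0, ∀ ω : E d → ℝ, IsAngular ω → ∀ M > 0, eLpNorm ω ⊤ volume ≤ ENNReal.ofReal M →
      KatoBound σ k r (C * M) (fun t x => ‖heat t (homData σ ω) x‖ₑ) := by
  have hkσ : k ≤ σ := by
    have : 0 ≤ d * r := by positivity
    linarith
  obtain ⟨C, hC, H⟩ := WeakBound.eHeat (d := d) hd (k₁ := σ) (r₁ := 0) le_rfl one_pos
    (by linarith) hkσ hr hr1 hK (by linarith)
  refine ⟨C, hC, fun ω hω M hM hωM t ht => ?_⟩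
  have h := H t ht _ (aestronglyMeasurable_homData σ hω).enorm M hM (weakBound_homData hd σ hM hωM)
  rw [mul_zero, add_zero] at h
  exact h.mono (Eventually.of_forall fun x => enorm_heat_le ht _ _)

theorem exists_bound_of_isAngular {ω : E d → ℝ} (hω : IsAngular ω) :
    ∃ M > 0, eLpNorm ω ⊤ volume ≤ ENNReal.ofReal M := by
  refine ⟨(eLpNorm ω ⊤ volume).toReal + 1, by positivity, ?_⟩
  rw [← ENNReal.ofReal_toReal hω.bounded.ne]
  apply ENNReal.ofReal_le_ofReal
  rw [ENNReal.ofReal_toReal hω.bounded.ne]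
  linarith

theorem isHeatFlow_heat_homData (hd : 0 < d) {σ : ℝ} (hσ0 : 0 ≤ σ) (hσ : σ < d) {ω : E d → ℝ}
    (hω : IsAngular ω) : IsHeatFlow (fun t => heat t (homData σ ω)) := by
  obtain ⟨M, hM, hωM⟩ := exists_bound_of_isAngular hω
  obtain ⟨C, hC, H⟩ := WeakBound.eHeat (d := d) hd (k₁ := σ) (r₁ := 0) (k₂ := σ) (r₂ := 0) le_rfl
    one_pos (by linarith) le_rfl le_rfl zero_le_one (by linarith) le_rfl
  refine isHeatFlow_heat (aestronglyMeasurable_homData σ hω) fun t ht => ?_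
  exact (H t ht _ (aestronglyMeasurable_homData σ hω).enorm M hM
    (weakBound_homData hd σ hM hωM)).ae_lt_top hd

end Homogeneous

/-! ## Translation of norms -/

section Norms

variable {d : ℕ} {F : Type*} [NormedAddCommGroup F] [NormedSpace ℝ F]

theorem ofReal_rpow_mul_wNorm_le_iff {A t : ℝ} (hA : 0 < A) (ht : 0 < t) (e k : ℝ) (p : ℝ≥0∞)
    (f : E d → F) : ENNReal.ofReal (t ^ e) * wNorm k p f ≤ ENNReal.ofReal A ↔
      WeakBound k (invExp p) (A * t ^ (-e)) (fun x => ‖f x‖ₑ) := by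
  rw [← wNorm_le_iff (by positivity), Real.rpow_neg ht.le, ← div_eq_mul_inv,
    ENNReal.ofReal_div_of_pos (by positivity), ENNReal.le_div_iff_mul_le (Or.inl (by positivity))
    (Or.inl ENNReal.ofReal_ne_top), mul_comm]

theorem decayExp_eq (hd : 0 < d) (s k : ℝ) (p : ℝ≥0∞) :
    decayExp d s k p = (s - (k + d * invExp p)) / 2 := by
  have hd' : (d : ℝ) ≠ 0 := by exact_mod_cast hd.ne'
  rw [decayExp]
  field_simp
  ring

theorem katoNorm_le_iff (hd : 0 < d) {A : ℝ} (hA : 0 < A) (s k : ℝ) (p : ℝ≥0∞)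
    (u : ℝ → E d → F) : katoNorm s k p u ≤ ENNReal.ofReal A ↔
      KatoBound s k (invExp p) A (fun t x => ‖u t x‖ₑ) := by
  rw [katoNorm, iSup₂_le_iff]
  refine forall₂_congr fun t ht => ?_
  rw [ofReal_rpow_mul_wNorm_le_iff hA ht, decayExp_eq hd, neg_div]

theorem katoBound_of_weighted_le (hd : 0 < d) {A δ : ℝ} (hA : 0 < A) {s k : ℝ} {p : ℝ≥0∞}
    {u : ℝ → E d → F} (h : ∀ t, 0 < t → ENNReal.ofReal (t ^ (decayExp d s k p + δ)) *
      wNorm k p (u t) ≤ ENNReal.ofReal A) :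
    KatoBound (s + 2 * δ) k (invExp p) A (fun t x => ‖u t x‖ₑ) := by
  intro t ht
  have h1 := (ofReal_rpow_mul_wNorm_le_iff hA ht _ _ _ _).mp (h t ht)
  rw [decayExp_eq hd] at h1
  convert! h1 using 3
  ring

theorem invExp_nonneg (p : ℝ≥0∞) : 0 ≤ invExp p := ENNReal.toReal_nonneg

theorem invExp_anti {p p' : ℝ≥0∞} (hp : p ≠ 0) (h : p ≤ p') : invExp p' ≤ invExp p :=
  ENNReal.toReal_mono (ENNReal.inv_ne_top.mpr hp) (ENNReal.inv_le_inv.mpr h)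

theorem ReachablePair.add_nonneg (hd : 0 < d) {k k' : ℝ} {p p' : ℝ≥0∞}
    (h : ReachablePair d k p k' p') : 0 ≤ k' + d * invExp p' := by
  have hd' : (0 : ℝ) < d := by exact_mod_cast hd
  have h1 := mul_nonneg hd'.le h.nonneg
  have h2 : d * (k' / d + invExp p') = k' + d * invExp p' := by field_simp
  rwa [h2] at h1

/-- Bounds at all reachable pairs yield convergence at the corresponding rate. -/
theorem convergesAtRate_of_katoBound (hd : 0 < d) {s k δ : ℝ} {p : ℝ≥0∞} (hp : p ≠ 0)
    {v V : ℝ → E d → ℝ}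
    (h : ∀ k' r' : ℝ, k' ≤ k → 0 ≤ r' → r' ≤ invExp p → 0 ≤ k' + d * r' →
      ∃ A > 0, KatoBound (s + 2 * δ) k' r' A (fun t x => ‖v t x - V t x‖ₑ)) :
    ConvergesAtRate s k p δ v V := by
  intro k' p' hr
  obtain ⟨A, hA, hb⟩ := h k' (invExp p') hr.weight_le (invExp_nonneg _) (invExp_anti hp hr.exp_le)
    (hr.add_nonneg hd)
  refine ⟨A, hA, (eventually_gt_atTop 0).mono fun t ht => ?_⟩
  rw [wNorm_le_iff (by positivity)]
  convert! hb t ht using 3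
  rw [decayExp_eq hd]
  ring

end Norms

/-! ## Sources as real numbers -/

section Sources

variable {d : ℕ} {c γ β : ℝ}

theorem mixedSource_eq_ofReal {θ : ℝ} {m e F : ℝ → E d → ℝ≥0∞} {τ : ℝ} {y : E d} {M D f : ℝ}
    (hc : 0 ≤ c) (hθ : 0 ≤ θ) (hθβ : θ ≤ β) (hM : 0 ≤ M) (hD : 0 ≤ D)
    (hm : m τ y = ENNReal.ofReal M) (he : e τ y = ENNReal.ofReal D)
    (hF : F τ y = ENNReal.ofReal f) :
    mixedSource c γ β θ m e F τ y =
      ENNReal.ofReal (c * (‖y‖ ^ γ * (M ^ (β - θ) * (D ^ θ * f)))) := by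
  rw [mixedSource, hm, he, hF, ENNReal.ofReal_rpow_of_nonneg hM (by linarith),
    ENNReal.ofReal_rpow_of_nonneg hD hθ, ← ENNReal.ofReal_mul (by positivity),
    ← ENNReal.ofReal_mul (by positivity), ← ENNReal.ofReal_mul (by positivity),
    ← ENNReal.ofReal_mul hc]

theorem potential_mul_eq_ofReal {m F : ℝ → E d → ℝ≥0∞} {τ : ℝ} {y : E d} {M f : ℝ}
    (hc : 0 ≤ c) (hβ : 0 ≤ β) (hM : 0 ≤ M)
    (hm : m τ y = ENNReal.ofReal M) (hF : F τ y = ENNReal.ofReal f) :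
    potential c γ β m τ y * F τ y = ENNReal.ofReal (c * (‖y‖ ^ γ * (M ^ β * f))) := by
  rw [potential, hm, hF, ENNReal.ofReal_rpow_of_nonneg hM hβ, ← ENNReal.ofReal_mul (by positivity),
    ← ENNReal.ofReal_mul hc, ← ENNReal.ofReal_mul (by positivity)]
  ring_nf

theorem enorm_mildSource_le {F : Type*} [NormedAddCommGroup F] [NormedSpace ℝ F] {α : ℝ}
    (hc : 1 ≤ c) (hα : 1 ≤ α)
    {V v : ℝ → E d → F} {m : ℝ → E d → ℝ≥0∞} {τ : ℝ} {y : E d} (h : ‖V τ y‖ₑ ≤ m τ y) :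
    ‖mildSource γ α V v τ y‖ₑ ≤ potential c γ (α - 1) m τ y * ‖v τ y‖ₑ := by
  rw [enorm_mildSource hα, potential]
  have h1 : ENNReal.ofReal (‖y‖ ^ γ) * ‖V τ y‖ₑ ^ (α - 1) ≤
      ENNReal.ofReal c * (ENNReal.ofReal (‖y‖ ^ γ) * m τ y ^ (α - 1)) :=
    calc ENNReal.ofReal (‖y‖ ^ γ) * ‖V τ y‖ₑ ^ (α - 1)
        ≤ ENNReal.ofReal (‖y‖ ^ γ) * m τ y ^ (α - 1) := by gcongr
      _ ≤ _ := le_mul_of_one_le_left zero_le (by simpa using hc)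
  exact mul_le_mul_left h1 _

variable {α : ℝ} {P Q : ℂ →L[ℝ] ℝ} {u : ℝ → E d → ℂ} {U z : ℝ → E d → ℝ}

theorem map_mildSource (V v : ℝ → E d → ℂ) (τ : ℝ) (y : E d) :
    P (mildSource γ α V v τ y) = ‖y‖ ^ γ * ‖V τ y‖ ^ (α - 1) * P (v τ y) := by
  rw [mildSource, map_smul, smul_eq_mul]

theorem add_enorm_eq_ofReal (τ : ℝ) (y : E d) :
    ‖u τ y‖ₑ + ‖U τ y‖ₑ = ENNReal.ofReal (‖u τ y‖ + |U τ y|) := by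
  rw [ENNReal.ofReal_add (norm_nonneg _) (abs_nonneg _), ofReal_norm, Real.enorm_eq_ofReal_abs]

theorem enorm_slow_sub_le (hα : 1 < α) {θ : ℝ} (hθ : 0 ≤ θ) (hθ1 : θ ≤ 1) (hθβ : θ ≤ α - 1)
    (hP : ∀ w, |P w| ≤ ‖w‖) (hPQ : ∀ w, ‖w‖ ≤ |P w| + |Q w|) (τ : ℝ) (y : E d) :
    ‖P (mildSource γ α u u τ y) - mildSource γ α U U τ y‖ₑ ≤
      mixedSource (1 + max 1 (α - 1)) γ (α - 1) θ (fun t x => ‖u t x‖ₑ + ‖U t x‖ₑ)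
        (fun t x => ‖Q (u t x)‖ₑ) (fun t x => ‖U t x‖ₑ) τ y +
      potential (1 + max 1 (α - 1)) γ (α - 1) (fun t x => ‖u t x‖ₑ + ‖U t x‖ₑ) τ y *
        ‖P (u τ y) - U τ y‖ₑ := by
  have hc : 0 ≤ 1 + max 1 (α - 1) := by positivity
  have hM : 0 ≤ ‖u τ y‖ + |U τ y| := by positivity
  rw [mixedSource_eq_ofReal hc hθ hθβ hM (abs_nonneg _) (add_enorm_eq_ofReal τ y)
    (Real.enorm_eq_ofReal_abs _) (Real.enorm_eq_ofReal_abs _),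
    potential_mul_eq_ofReal (F := fun τ y => ‖P (u τ y) - U τ y‖ₑ) hc (by linarith) hM
    (add_enorm_eq_ofReal τ y) (Real.enorm_eq_ofReal_abs _),
    ← ENNReal.ofReal_add (by positivity) (by positivity), Real.enorm_eq_ofReal_abs, map_mildSource,
    mildSource, smul_eq_mul, Real.norm_eq_abs]
  apply ENNReal.ofReal_le_ofReal
  have h := abs_slow_sub_le (U := U τ y) (by linarith : 0 < α - 1) hθ hθ1 hθβ (hP (u τ y))
    (hPQ (u τ y))
  calc _ = |‖y‖ ^ γ * (‖u τ y‖ ^ (α - 1) * P (u τ y) - |U τ y| ^ (α - 1) * U τ y)| := by ring_nf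
    _ = ‖y‖ ^ γ * |‖u τ y‖ ^ (α - 1) * P (u τ y) - |U τ y| ^ (α - 1) * U τ y| := by
      rw [abs_mul, abs_of_nonneg (by positivity)]
    _ ≤ _ := mul_le_mul_of_nonneg_left h (by positivity)
    _ = _ := by ring

theorem enorm_fast_sub_le (hα : 1 < α) {θ₁ θ₂ : ℝ} (hθ₁ : 0 ≤ θ₁) (hθ₁1 : θ₁ ≤ 1)
    (hθ₁β : θ₁ ≤ α - 1) (hθ₂ : 0 ≤ θ₂) (hθ₂1 : θ₂ ≤ 1) (hθ₂β : θ₂ ≤ α - 1)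
    (hP : ∀ w, |P w| ≤ ‖w‖) (hPQ : ∀ w, ‖w‖ ≤ |P w| + |Q w|) (τ : ℝ) (y : E d) :
    ‖Q (mildSource γ α u u τ y) - mildSource γ α U z τ y‖ₑ ≤
      mixedSource (1 + max 1 (α - 1)) γ (α - 1) θ₁ (fun t x => ‖u t x‖ₑ + ‖U t x‖ₑ)
        (fun t x => ‖P (u t x) - U t x‖ₑ) (fun t x => ‖z t x‖ₑ) τ y +
      mixedSource (1 + max 1 (α - 1)) γ (α - 1) θ₂ (fun t x => ‖u t x‖ₑ + ‖U t x‖ₑ)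
        (fun t x => ‖Q (u t x)‖ₑ) (fun t x => ‖z t x‖ₑ) τ y +
      potential (1 + max 1 (α - 1)) γ (α - 1) (fun t x => ‖u t x‖ₑ + ‖U t x‖ₑ) τ y *
        ‖Q (u τ y) - z τ y‖ₑ := by
  have hc : 0 ≤ 1 + max 1 (α - 1) := by positivity
  have hM : 0 ≤ ‖u τ y‖ + |U τ y| := by positivity
  rw [mixedSource_eq_ofReal hc hθ₁ hθ₁β hM (abs_nonneg _) (add_enorm_eq_ofReal τ y)
    (Real.enorm_eq_ofReal_abs _) (Real.enorm_eq_ofReal_abs _),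
    mixedSource_eq_ofReal hc hθ₂ hθ₂β hM (abs_nonneg _) (add_enorm_eq_ofReal τ y)
    (Real.enorm_eq_ofReal_abs _) (Real.enorm_eq_ofReal_abs _),
    potential_mul_eq_ofReal (F := fun τ y => ‖Q (u τ y) - z τ y‖ₑ) hc (by linarith) hM
    (add_enorm_eq_ofReal τ y) (Real.enorm_eq_ofReal_abs _),
    ← ENNReal.ofReal_add (by positivity) (by positivity),
    ← ENNReal.ofReal_add (by positivity) (by positivity), Real.enorm_eq_ofReal_abs, map_mildSource,
    mildSource, smul_eq_mul, Real.norm_eq_abs]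
  apply ENNReal.ofReal_le_ofReal
  have h := abs_fast_sub_le (U := U τ y) (z := z τ y) (by linarith : 0 < α - 1) hθ₁ hθ₁1 hθ₁β
    hθ₂ hθ₂1 hθ₂β (hP (u τ y)) (hPQ (u τ y))
  calc _ = |‖y‖ ^ γ * (‖u τ y‖ ^ (α - 1) * Q (u τ y) - |U τ y| ^ (α - 1) * z τ y)| := by ring_nf
    _ = ‖y‖ ^ γ * |‖u τ y‖ ^ (α - 1) * Q (u τ y) - |U τ y| ^ (α - 1) * z τ y| := by
      rw [abs_mul, abs_of_nonneg (by positivity)]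
    _ ≤ _ := mul_le_mul_of_nonneg_left h (by positivity)
    _ = _ := by ring

end Sources

/-! ### Recovering the data from the solution -/

section DataBound

variable {d : ℕ} {F : Type*} [NormedAddCommGroup F] [NormedSpace ℝ F] {a γ α : ℝ}

/-- Solving the equation for L bounds the heat flow of the data in spaces where a direct smoothing
estimate may be unavailable. -/
theorem IsMildSolution.enorm_data_le (ha : a = 1 ∨ a = -1) {V L v : ℝ → E d → F}
    (hv : IsMildSolution a γ α V L v) {t : ℝ} (ht : 0 < t) : ∀ᵐ x, ‖L t x‖ₑ ≤ ‖v t x‖ₑ +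
      duhamel (fun τ y => ‖mildSource γ α V v τ y‖ₑ) t x := by
  filter_upwards [hv.equation t ht] with x hx
  have e1 : L t x = v t x - a • vecDuhamel (mildSource γ α V v) t x :=
    eq_sub_of_add_eq (Eq.symm hx)
  rw [e1]
  refine enorm_sub_le.trans ?_
  rw [enorm_smul_of_sign ha]
  gcongr
  exact enorm_vecDuhamel_le (mildSource γ α V v) ht x

end DataBound

/-! ### Convergence of the slow and the fast component -/

section Main

variable {d : ℕ}

theorem VecMeas.map {P : ℂ →L[ℝ] ℝ} {u : ℝ → E d → ℂ} (hu : VecMeas u) :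
    VecMeas (fun t x => P (u t x)) := P.continuous.comp_aestronglyMeasurable hu

theorem duhamel_le_add {Q R V F : ℝ → E d → ℝ≥0∞} (hV : FamMeas V) (hF : FamMeas F)
    (h : ∀ τ y, Q τ y ≤ R τ y + V τ y * F τ y) (t : ℝ) (x : E d) :
    duhamel Q t x ≤ duhamel R t x + potOp V F t x :=
  (duhamel_mono (fun τ _ => Eventually.of_forall (h τ)) t x).trans_eq
    (duhamel_add (hV.mul hF) t x)

set_option maxHeartbeats 1000000 in
/-- Convergence of the slow component `P ∘ u` to the self-similar solution and of the fast component
`Q ∘ u` to the solution of the modified linear equation. -/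
theorem convergence_of_components (hd : 0 < d) {a γ α k σ k₀ : ℝ} {p p₀ : ℝ≥0∞}
    (ha : a = 1 ∨ a = -1) (hα : 1 < α) (hp : p ≠ 0) (hp₀ : p₀ ≠ 0) {s : ℝ}
    (hs : s = (2 + γ) / (α - 1)) (hK : 0 ≤ k + d * invExp p)
    (hkV : 0 ≤ (α - 1) * k - γ) (hKs : k + d * invExp p < s)
    (hlow : s < (α - 1) * k - γ + d * ((α - 1) * invExp p) + (k + d * invExp p))
    (hup : (α - 1) * k - γ + d * ((α - 1) * invExp p) + (k + d * invExp p) < d)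
    (hrr : (α - 1) * invExp p + invExp p < 1)
    (hK₀ : 0 ≤ k₀ + d * invExp p₀) (hrr₀ : (α - 1) * invExp p + invExp p₀ < 1)
    (hlow₀ : σ < (α - 1) * k - γ + d * ((α - 1) * invExp p) + (k₀ + d * invExp p₀))
    (hup₀ : (α - 1) * k - γ + d * ((α - 1) * invExp p) + (k₀ + d * invExp p₀) < d)
    (hsσ : s < σ) (hσd : σ < d)
    {P Q : ℂ →L[ℝ] ℝ} (hP : ∀ w, |P w| ≤ ‖w‖) (hQ : ∀ w, |Q w| ≤ ‖w‖)
    (hPQ : ∀ w, ‖w‖ ≤ |P w| + |Q w|) :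
    ∃ ε : ℝ, 0 < ε ∧ ∀ ω ω₀ : E d → ℝ, IsAngular ω → IsAngular ω₀ →
      eLpNorm ω ⊤ volume ≤ ENNReal.ofReal ε →
      ∀ L : ℝ → E d → ℂ, IsHeatFlow L → katoNorm s k p L ≤ ENNReal.ofReal ε →
      ∀ u : ℝ → E d → ℂ, IsSmallSolution a γ α k p L u →
      ∀ U z : ℝ → E d → ℝ, IsSelfSimilarSolution a γ α k p ω U →
      IsModifiedLinearSolution a γ α σ k₀ p₀ ω₀ U z →
      ∀ C₁ C₂ δ₀₁ δ₀₂ : ℝ, 0 < C₁ → 0 < C₂ → 0 < δ₀₁ → 0 < δ₀₂ →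
      KatoBound (s + 2 * δ₀₁) k (invExp p) C₁ (fun t x => ‖P (L t x) - heat t (homData s ω) x‖ₑ) →
      KatoBound σ k₀ (invExp p₀) C₂ (fun t x => ‖Q (L t x)‖ₑ) →
      KatoBound (σ + 2 * δ₀₂) k₀ (invExp p₀) C₂
        (fun t x => ‖Q (L t x) - heat t (homData σ ω₀) x‖ₑ) →
      ∃ δ₁ δ₂ : ℝ, 0 < δ₁ ∧ 0 < δ₂ ∧ ConvergesAtRate s k p δ₁ (fun t x => P (u t x)) U ∧
        ConvergesAtRate σ k₀ p₀ δ₂ (fun t x => Q (u t x)) z := by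
  have hd' : (0 : ℝ) < d := by exact_mod_cast hd
  set r := invExp p with hr_def
  set r₀ := invExp p₀ with hr₀_def
  have hr : 0 ≤ r := invExp_nonneg p
  have hr₀ : 0 ≤ r₀ := invExp_nonneg p₀
  have hβ : 0 < α - 1 := by linarith
  have hβr : 0 ≤ (α - 1) * r := by positivity
  have hr1 : r < 1 := by linarith
  have hr₀1 : r₀ < 1 := by linarith
  have hdβr : 0 ≤ d * ((α - 1) * r) := by positivity
  have hs' : (α - 1) * s - γ = 2 := by
    rw [hs, mul_div_cancel₀ _ hβ.ne']
    ring
  have hKV2 : (α - 1) * k - γ + d * ((α - 1) * r) < 2 := by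
    have : (α - 1) * (k + d * r) < (α - 1) * s := by gcongr
    linarith
  set c := 1 + max 1 (α - 1) with hc_def
  have hc : 0 < c := by positivity
  have hc1 : 1 ≤ c := by
    have : (0 : ℝ) ≤ max 1 (α - 1) := by positivity
    linarith
  obtain ⟨ε₀, hε₀, core⟩ := asymptotic_comparison hd hc hβ hs' hr hK hkV hKs hlow hup hrr hr₀ hK₀
    hrr₀ hlow₀ hup₀ hsσ
  obtain ⟨CΦ, hCΦ, hheat⟩ := katoBound_heat_homData (d := d) hd (σ := s) (k := k) (r := r)
    (by linarith) hr hr1.le hK hKs.le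
  obtain ⟨CV, hCV, hpot⟩ := KatoBound.potOp (d := d) hd (ρ₀ := s) (ρ₁ := s) hkV hβr hKV2 hr hrr hK
    hlow hup
  obtain ⟨CV₀, hCV₀, hpot₀⟩ := KatoBound.potOp (d := d) hd (ρ₀ := σ) (ρ₁ := σ) hkV hβr hKV2 hr₀ hrr₀
    hK₀ hlow₀ hup₀
  -- The norm of |u| + |U| is at most 2(2ε + 2CΦ ε), which equals ε₀.
  set ε := ε₀ / (4 * (1 + CΦ)) with hε
  have hε0 : 0 < ε := by positivity
  refine ⟨ε, hε0, ?_⟩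
  intro ω ω₀ hω hω₀ hωε L hL hLε u hu U z hU hz C₁ C₂ δ₀₁ δ₀₂ hC₁ hC₂ hδ₀₁ hδ₀₂ hgap₁ hsize hgap₂
  have hUs := hU.solution
  rw [← hs] at hUs
  have hzb := hz.bound
  -- smallness
  have hΦb := hheat ω hω ε hε0 hωε
  have hLb := (katoNorm_le_iff hd hε0 _ _ _ _).mp hLε
  have hub : KatoBound s k r (2 * ε) (fun t x => ‖u t x‖ₑ) := by
    rw [← katoNorm_le_iff hd (by positivity), ENNReal.ofReal_mul zero_le_two, hs]
    refine hu.bound.trans ?_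
    rw [← hs]
    gcongr
    simp
  have hUb : KatoBound s k r (2 * (CΦ * ε)) (fun t x => ‖U t x‖ₑ) := by
    rw [← katoNorm_le_iff hd (by positivity), ENNReal.ofReal_mul zero_le_two, hs]
    refine hUs.bound.trans ?_
    rw [← hs]
    gcongr
    · simp
    · exact (katoNorm_le_iff hd (by positivity) _ _ _ _).mpr hΦb
  set m : ℝ → E d → ℝ≥0∞ := fun t x => ‖u t x‖ₑ + ‖U t x‖ₑ with hm_def
  have hmb : KatoBound s k r ε₀ m := by
    refine (hub.add (by positivity) (by positivity) hr1.le hUb).mono_const (le_of_eq ?_)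
    rw [hε]
    field_simp
    ring
  -- measurability
  have huV : VecMeas u := hu.mild.measurable
  have hUV : VecMeas U := hUs.mild.measurable
  have hzV : VecMeas z := hz.mild.measurable
  have hmm : FamMeas m := huV.enorm.add hUV.enorm
  have hPum : FamMeas (fun t x => ‖P (u t x) - U t x‖ₑ) :=
    VecMeas.enorm (AEStronglyMeasurable.sub (VecMeas.map (P := P) huV) hUV)
  have hQzm : FamMeas (fun t x => ‖Q (u t x) - z t x‖ₑ) :=
    VecMeas.enorm (AEStronglyMeasurable.sub (VecMeas.map (P := Q) huV) hzV)
  have hQum : FamMeas (fun t x => ‖Q (u t x)‖ₑ) := (VecMeas.map (P := Q) huV).enorm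
  -- the potential
  set V := potential c γ (α - 1) m with hV_def
  have hVm : FamMeas V := hmm.potential
  have hVb := KatoBound.potential (γ := γ) hd hc hβ.le hε₀.le hs' hmb
  set aV := c * (2 ^ ((α - 1) * r) * ε₀ ^ (α - 1)) with haV
  have haV0 : 0 < aV := by positivity
  have hup : ∀ τ y, ‖mildSource γ α u u τ y‖ₑ ≤ V τ y * ‖u τ y‖ₑ := fun τ y =>
    enorm_mildSource_le hc1 hα.le le_self_add
  have hUp : ∀ τ y, ‖mildSource γ α U U τ y‖ₑ ≤ V τ y * ‖U τ y‖ₑ := fun τ y =>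
    enorm_mildSource_le hc1 hα.le le_add_self
  have hzp : ∀ τ y, ‖mildSource γ α U z τ y‖ₑ ≤ V τ y * ‖z τ y‖ₑ := fun τ y =>
    enorm_mildSource_le hc1 hα.le le_add_self
  -- the norm of `z`
  obtain ⟨Az, hAz, hzA⟩ : ∃ Az > 0, KatoBound σ k₀ r₀ Az (fun t x => ‖z t x‖ₑ) := by
    refine ⟨(katoNorm σ k₀ p₀ z).toReal + 1, by positivity, ?_⟩
    rw [← katoNorm_le_iff hd (by positivity), ← ENNReal.ofReal_toReal hzb.ne]
    apply ENNReal.ofReal_le_ofReal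
    rw [ENNReal.ofReal_toReal hzb.ne]
    linarith
  have hpu := hpot V hVm aV haV0 hVb s le_rfl le_rfl _ huV.enorm _ (by positivity) hub
  have hpU := hpot V hVm aV haV0 hVb s le_rfl le_rfl _ hUV.enorm _ (by positivity) hUb
  have hpz := hpot₀ V hVm aV haV0 hVb σ le_rfl le_rfl _ hzV.enorm _ hAz hzA
  -- finiteness of the Duhamel integrals
  have hfu : ∀ t, 0 < t → ∀ᵐ x, duhamel (fun τ y => ‖mildSource γ α u u τ y‖ₑ) t x < ∞ := by
    intro t ht
    filter_upwards [(hpu t ht).ae_lt_top hd] with x hx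
    exact (duhamel_mono (fun τ _ => Eventually.of_forall (hup τ)) t x).trans_lt hx
  have hfU : ∀ t, 0 < t → ∀ᵐ x, duhamel (fun τ y => ‖mildSource γ α U U τ y‖ₑ) t x < ∞ := by
    intro t ht
    filter_upwards [(hpU t ht).ae_lt_top hd] with x hx
    exact (duhamel_mono (fun τ _ => Eventually.of_forall (hUp τ)) t x).trans_lt hx
  have hfz : ∀ t, 0 < t → ∀ᵐ x, duhamel (fun τ y => ‖mildSource γ α U z τ y‖ₑ) t x < ∞ := by
    intro t ht
    filter_upwards [(hpz t ht).ae_lt_top hd] with x hx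
    exact (duhamel_mono (fun τ _ => Eventually.of_forall (hzp τ)) t x).trans_lt hx
  -- heat flows of the data
  have hΦ := isHeatFlow_heat_homData (d := d) hd (σ := s) (by linarith) (by linarith) hω
  have hΦ₀ := isHeatFlow_heat_homData (d := d) hd (σ := σ) (by linarith) hσd hω₀
  -- The bound is read off from the finite norm of z, since k₀ + d r₀ ≤ σ is not guaranteed and
  -- smoothing of the homogeneous data requires it.
  obtain ⟨A₀, hA₀, hΦ₀b⟩ : ∃ A > 0, KatoBound σ k₀ r₀ A (fun t x => ‖heat t (homData σ ω₀) x‖ₑ) := by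
    refine ⟨_, ?_, (hzA.add hAz.le (by positivity) hr₀1.le hpz).mono fun t ht => ?_⟩
    · positivity
    · filter_upwards [hz.mild.enorm_data_le ha ht] with x hx
      refine hx.trans ?_
      gcongr
      exact duhamel_mono (fun τ _ => Eventually.of_forall (hzp τ)) t x
  have hPL : KatoBound s k r ε (fun t x => ‖P (L t x)‖ₑ) := hLb.mono fun t ht =>
    Eventually.of_forall fun x => by
      rw [← ofReal_norm, ← ofReal_norm]
      exact ENNReal.ofReal_le_ofReal (hP _)
  have hg₁flow := (hL.map P).sub hΦ
  have hg₂flow := (hL.map Q).sub hΦ₀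
  -- The gapless bound controls short times; interpolated with the bound of order s + 2δ₀₁ it yields
  -- every order in between.
  have hg₁b : KatoBound s k r (2 * (ε + CΦ * ε))
      (fun t x => ‖P (L t x) - heat t (homData s ω) x‖ₑ) :=
    (hPL.add hε0.le (by positivity) hr1.le hΦb).mono fun t ht => Eventually.of_forall fun x =>
      enorm_sub_le
  have hg₂b : KatoBound σ k₀ r₀ (2 * (C₂ + A₀))
      (fun t x => ‖Q (L t x) - heat t (homData σ ω₀) x‖ₑ) :=
    (hsize.add hC₂.le hA₀.le hr₀1.le hΦ₀b).mono fun t ht => Eventually.of_forall fun x =>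
      enorm_sub_le
  obtain ⟨δ₁, hδ₁, δ₂, hδ₂, h1, h2⟩ := core m (fun t x => ‖U t x‖ₑ) (fun t x => ‖z t x‖ₑ)
    (fun t x => ‖Q (u t x)‖ₑ) (fun t x => ‖P (u t x) - U t x‖ₑ) (fun t x => ‖Q (u t x) - z t x‖ₑ)
    (fun t x => ‖heat t (homData s ω) x‖ₑ) (fun t x => ‖heat t (homData σ ω₀) x‖ₑ)
    (fun t x => ‖Q (L t x)‖ₑ) (fun t x => ‖P (L t x) - heat t (homData s ω) x‖ₑ)
    (fun t x => ‖Q (L t x) - heat t (homData σ ω₀) x‖ₑ)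
    hmm hUV.enorm hzV.enorm hQum hPum hQzm hmb
    (fun t _ => Eventually.of_forall fun x => le_add_self)
    (fun t _ => Eventually.of_forall fun x => le_trans (by
      rw [← ofReal_norm, ← ofReal_norm]
      exact ENNReal.ofReal_le_ofReal (hQ _)) le_self_add)
    (fun t _ => Eventually.of_forall fun x => enorm_sub_le.trans (by
      refine add_le_add_left ?_ _
      rw [← ofReal_norm, ← ofReal_norm]
      exact ENNReal.ofReal_le_ofReal (hP _)))
    (fun t _ => Eventually.of_forall fun x => enorm_sub_le)
    (fun t ht => by
      filter_upwards [hUs.mild.enorm_le ha ht] with x hx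
      refine hx.trans ?_
      gcongr
      exact duhamel_mono (fun τ _ => Eventually.of_forall (hUp τ)) t x)
    (fun t ht => by
      filter_upwards [hz.mild.enorm_le ha ht] with x hx
      refine hx.trans ?_
      gcongr
      exact duhamel_mono (fun τ _ => Eventually.of_forall (hzp τ)) t x)
    (fun t ht => by
      filter_upwards [hu.mild.enorm_map_le ha Q huV ht (hfu t ht)] with x hx
      refine hx.trans ?_
      gcongr
      refine duhamel_mono (fun τ _ => Eventually.of_forall fun y => ?_) t x
      -- Q u is regarded as complex valued so that the potential and the solution in the source
      -- share their codomain.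
      have hle : ‖mildSource γ α u (fun t x => (Q (u t x) : ℂ)) τ y‖ₑ ≤
          V τ y * ‖((Q (u τ y) : ℝ) : ℂ)‖ₑ := enorm_mildSource_le hc1 hα.le le_self_add
      rw [map_mildSource]
      rw [mildSource, enorm_smul, ← ofReal_norm ((Q (u τ y) : ℝ) : ℂ), Complex.norm_real,
        ofReal_norm] at hle
      rwa [enorm_mul])
    (fun θ h0 h1 hβ' t ht => by
      filter_upwards [hu.mild.enorm_map_sub_le ha P huV hUV hUs.mild ht (hfu t ht) (hfU t ht)]
        with x hx
      refine hx.trans ?_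
      rw [add_assoc]
      gcongr
      exact duhamel_le_add hVm hPum (enorm_slow_sub_le hα h0 h1 hβ' hP hPQ) t x)
    (fun θ₁ θ₂ h0 h1 hβ' h0' h1' hβ'' t ht => by
      filter_upwards [hu.mild.enorm_map_sub_le ha Q huV hUV hz.mild ht (hfu t ht) (hfz t ht)]
        with x hx
      refine hx.trans ?_
      rw [add_assoc]
      gcongr
      rw [← duhamel_add (hmm.mixedSource hQum hzV.enorm)]
      exact duhamel_le_add hVm hQzm (enorm_fast_sub_le hα h0 h1 hβ' h0' h1' hβ'' hP hPQ) t x)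
    (fun k' r' hr'0 hr'1 hK' hK's => by
      obtain ⟨C, hC, H⟩ := katoBound_heat_homData (d := d) hd (by linarith : s < d) hr'0 hr'1 hK' hK's
      exact ⟨_, by positivity, H ω hω ε hε0 hωε⟩)
    (by
      -- If k₀ + d r₀ exceeds σ, the finite norm forces the heat flow of the fast data to vanish.
      rcases le_or_gt (k₀ + d * r₀) σ with h | h
      · refine Or.inr ⟨h, fun k' r' hr'0 hr'1 hK' hK's => ?_⟩
        obtain ⟨M, hM, hωM⟩ := exists_bound_of_isAngular hω₀
        obtain ⟨C, hC, H⟩ := katoBound_heat_homData (d := d) hd hσd hr'0 hr'1 hK' hK's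
        exact ⟨_, by positivity, H ω₀ hω₀ M hM hωM⟩
      · exact Or.inl fun t ht => hΦ₀.ae_eq_zero hd hA₀ hr₀ hr₀1 hK₀ (by linarith) h hΦ₀b ht)
    ⟨C₂, hC₂, hsize⟩ ⟨Az, hAz, hzA⟩ δ₀₁ hδ₀₁ δ₀₂ hδ₀₂
    (fun k' r' hk' hr'0 hr' hK' =>
      ⟨hg₁flow.katoBound hd (by positivity) hr hr1 (by linarith) hg₁b hk' hr'0 hr' hK',
        hg₁flow.katoBound hd hC₁ hr hr1 (by linarith) hgap₁ hk' hr'0 hr' hK'⟩)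
    (fun k' r' hk' hr'0 hr' hK' =>
      ⟨hg₂flow.katoBound hd (by positivity) hr₀ hr₀1 (by linarith) hg₂b hk' hr'0 hr' hK',
        hg₂flow.katoBound hd hC₂ hr₀ hr₀1 (by linarith) hgap₂ hk' hr'0 hr' hK'⟩)
  exact ⟨δ₁, δ₂, hδ₁, hδ₂, convergesAtRate_of_katoBound hd hp h1,
    convergesAtRate_of_katoBound hd hp₀ h2⟩

end Main

/-! ### Exponent conditions in terms of k + d/p -/

section Parameters

variable {d : ℕ} {γ α l k : ℝ} {p : ℝ≥0∞}

theorem AuxiliaryPair.ne_zero (h : AuxiliaryPair d γ α l k p) : p ≠ 0 :=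
  (zero_le.trans_lt h.lt_exp).ne'

theorem AuxiliaryPair.mul_invExp_lt_one (hα : 1 < α) (h : AuxiliaryPair d γ α l k p) :
    α * invExp p < 1 := by
  have hα0 : 0 < α := by linarith
  have h1 : p⁻¹ < (ENNReal.ofReal α)⁻¹ := ENNReal.inv_lt_inv.mpr h.lt_exp
  have h2 := (ENNReal.toReal_lt_toReal h1.ne_top (by simpa using hα0)).mpr h1
  rw [ENNReal.toReal_inv (ENNReal.ofReal α), ENNReal.toReal_ofReal hα0.le] at h2
  calc α * invExp p < α * α⁻¹ := by gcongr; exact h2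
    _ = 1 := mul_inv_cancel₀ hα0.ne'

/-- The conditions on `(k, p)` in terms of `k + d / p`. -/
theorem AuxiliaryPair.bounds (hd : 0 < d) (hα : 1 < α) (h : AuxiliaryPair d γ α l k p) :
    0 ≤ k + d * invExp p ∧ 0 ≤ (α - 1) * k - γ ∧ k + d * invExp p < (2 + γ) / (α - 1) ∧
    (2 + γ) / (α - 1) < (α - 1) * k - γ + d * ((α - 1) * invExp p) + (k + d * invExp p) ∧
    (α - 1) * k - γ + d * ((α - 1) * invExp p) + (k + d * invExp p) < d ∧
    (α - 1) * invExp p + invExp p < 1 := by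
  have hd' : (0 : ℝ) < d := by exact_mod_cast hd
  have hβ : 0 < α - 1 := by linarith
  have hα0 : 0 < α := by linarith
  have e : k / d + invExp p = (k + d * invExp p) / d := by field_simp
  have h1 := h.nonneg
  have h2 := h.lower
  have h3 := h.upper_critical
  have h4 := h.upper_integrable
  rw [e] at h1 h2 h3 h4
  rw [invQc, div_lt_div_iff₀ hd' (by positivity)] at h3
  rw [div_lt_div_iff₀ (by positivity) hd'] at h2
  rw [div_lt_div_iff₀ hd' (by positivity)] at h4
  set K := k + d * invExp p with hK
  have h2' : 2 + γ * α < α * (α - 1) * K := by nlinarith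
  have h3' : K * (α - 1) < 2 + γ := by nlinarith
  have h4' : α * K < d + γ := by nlinarith
  have hr := h.mul_invExp_lt_one hα
  -- From l + γ ≤ αk and k ≤ l follows (α-1)k ≥ γ: the potential has nonnegative weight.
  have hl := h.weight_lower
  rw [div_le_iff₀ hα0] at hl
  have hl' := h.weight_upper
  have e2 : (α - 1) * k - γ + d * ((α - 1) * invExp p) + K = α * K - γ := by rw [hK]; ring
  rw [e2]
  refine ⟨?_, by linarith, ?_, ?_, by linarith, by linarith⟩
  · have := mul_nonneg h1 hd'.le
    rwa [div_mul_cancel₀ _ hd'.ne'] at this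
  · rwa [lt_div_iff₀ hβ]
  · rw [div_lt_iff₀ hβ]
    linarith

theorem SecondaryPair.ne_zero {σ k₀ : ℝ} {p₀ : ℝ≥0∞} (h : SecondaryPair d γ α k p σ k₀ p₀) :
    p₀ ≠ 0 := (zero_lt_one.trans_le h.one_le).ne'

/-- The conditions on `(k₀, p₀)` in terms of `k₀ + d / p₀`. -/
theorem SecondaryPair.bounds (hd : 0 < d) {σ k₀ : ℝ} {p₀ : ℝ≥0∞}
    (h : SecondaryPair d γ α k p σ k₀ p₀) :
    0 ≤ k₀ + d * invExp p₀ ∧ (α - 1) * invExp p + invExp p₀ < 1 ∧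
    σ < (α - 1) * k - γ + d * ((α - 1) * invExp p) + (k₀ + d * invExp p₀) ∧
    (α - 1) * k - γ + d * ((α - 1) * invExp p) + (k₀ + d * invExp p₀) < d := by
  have hd' : (0 : ℝ) < d := by exact_mod_cast hd
  have e : (α - 1) * (k / d + invExp p) + k₀ / d + invExp p₀ - γ / d =
      ((α - 1) * k - γ + d * ((α - 1) * invExp p) + (k₀ + d * invExp p₀)) / d := by
    field_simp
    ring
  have h1 := h.nonneg
  have h2 := h.lower
  have h3 := h.upper
  rw [e] at h2 h3
  rw [div_lt_div_iff_of_pos_right hd'] at h2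
  rw [div_lt_one hd'] at h3
  refine ⟨?_, h.holder_lt_one, h2, h3⟩
  have := mul_nonneg h1 hd'.le
  rwa [add_mul, div_mul_cancel₀ _ hd'.ne', mul_comm (invExp p₀)] at this

end Parameters

/-! ### Real and imaginary parts of the heat flow -/

section RealDistributions

variable {d : ℕ} {φ φ₁ φ₂ : 𝓢'(E d, ℂ)}

/-- The heat kernel is a real test function. Consequently φ₁ and φ₂ can be read off as real and
imaginary parts of the flow of φ. -/
theorem IsRealDist.heatDist_im (hφ : IsRealDist φ) (t : ℝ) (x : E d) : (heatDist φ t x).im = 0 := by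
  rw [heatDist]
  split_ifs with ht
  · exact hφ _ fun y => by rw [heatKernelSchwartz_apply, Complex.ofReal_im]
  · rfl

theorem heatDist_add_I_smul (φ₁ φ₂ : 𝓢'(E d, ℂ)) (t : ℝ) (x : E d) :
    heatDist (φ₁ + Complex.I • φ₂) t x = heatDist φ₁ t x + Complex.I * heatDist φ₂ t x := by
  unfold heatDist
  split_ifs
  · rfl
  · simp

theorem re_heatDist_add (h₂ : IsRealDist φ₂) (t : ℝ) (x : E d) :
    (heatDist (φ₁ + Complex.I • φ₂) t x).re = (heatDist φ₁ t x).re := by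
  rw [heatDist_add_I_smul]
  simp [h₂.heatDist_im]

theorem im_heatDist_add (h₁ : IsRealDist φ₁) (t : ℝ) (x : E d) :
    (heatDist (φ₁ + Complex.I • φ₂) t x).im = (heatDist φ₂ t x).re := by
  rw [heatDist_add_I_smul]
  simp [h₁.heatDist_im]

theorem IsRealDist.heatDist_eq (hφ : IsRealDist φ) (t : ℝ) (x : E d) :
    heatDist φ t x = (((heatDist φ t x).re : ℝ) : ℂ) :=
  Complex.ext rfl (by rw [hφ.heatDist_im, Complex.ofReal_im])

theorem IsRealDist.enorm_heatDist (hφ : IsRealDist φ) (t : ℝ) (x : E d) :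
    ‖heatDist φ t x‖ₑ = ‖(heatDist φ t x).re‖ₑ := by
  conv_lhs => rw [hφ.heatDist_eq]
  rw [← ofReal_norm, Complex.norm_real, ofReal_norm]

theorem IsRealDist.enorm_sub (hφ : IsRealDist φ) (t : ℝ) (x : E d) (y : ℝ) :
    ‖heatDist φ t x - (y : ℂ)‖ₑ = ‖(heatDist φ t x).re - y‖ₑ := by
  conv_lhs => rw [hφ.heatDist_eq, ← Complex.ofReal_sub]
  rw [← ofReal_norm, Complex.norm_real, ofReal_norm]

theorem katoBound_of_dataSize (hd : 0 < d) {σ k C : ℝ} {p : ℝ≥0∞} (hC : 0 < C)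
    (h : ∀ t, 0 < t → dataSize σ k p φ t ≤ ENNReal.ofReal C) :
    KatoBound σ k (invExp p) C (fun t x => ‖heatDist φ t x‖ₑ) :=
  (katoNorm_le_iff hd hC σ k p (heatDist φ)).mp (iSup₂_le h)

end RealDistributions

/-! ### The theorem: two assignments of slow and fast component -/

theorem theoremt (d : ℕ) (hd : 0 < d) (a γ α : ℝ) (ha : a = 1 ∨ a = -1)
    (hγ : -min 2 (d : ℝ) < γ) (hα : 1 + (2 + γ) / d < α)
    (l : ℝ) (q : ℝ≥0∞) (hlq : CriticalPair d γ α l q)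
    (k : ℝ) (p : ℝ≥0∞) (hkp : AuxiliaryPair d γ α l k p)
    (σ₁ σ₂ : ℝ)
    (hσ₁ : (2 + γ) / (α - 1) ≤ σ₁ ∧ σ₁ < d) (hσ₂ : (2 + γ) / (α - 1) ≤ σ₂ ∧ σ₂ < d)
    (k₀ : ℝ) (p₀ : ℝ≥0∞) :
    -- nonlinear - "modified linear" behavior
    ((2 + γ) / (α - 1) = σ₁ → σ₁ < σ₂ → SecondaryPair d γ α k p σ₂ k₀ p₀ →
      ∃ ε : ℝ, 0 < ε ∧ ∀ ω₁ ω₂ : E d → ℝ, IsAngular ω₁ → IsAngular ω₂ →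
        eLpNorm ω₁ ⊤ volume ≤ ENNReal.ofReal ε → eLpNorm ω₂ ⊤ volume ≤ ENNReal.ofReal ε →
        ∀ φ φ₁ φ₂ : 𝓢'(E d, ℂ), IsRealDist φ₁ → IsRealDist φ₂ → φ = φ₁ + Complex.I • φ₂ →
        φ ≠ 0 → katoNorm ((2 + γ) / (α - 1)) k p (heatDist φ) ≤ ENNReal.ofReal ε →
        ∀ u : ℝ → E d → ℂ, IsSmallSolution a γ α k p (heatDist φ) u →
        ∀ u₁S z₂ : ℝ → E d → ℝ, IsSelfSimilarSolution a γ α k p ω₁ u₁S →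
        IsModifiedLinearSolution a γ α σ₂ k₀ p₀ ω₂ u₁S z₂ →
        ∀ C₁ C₂ δ₀₁ δ₀₂ : ℝ, 0 < C₁ → 0 < C₂ → 0 < δ₀₁ → 0 < δ₀₂ →
        (∀ t : ℝ, 0 < t → dataGap σ₁ k p ω₁ φ₁ δ₀₁ t ≤ ENNReal.ofReal C₁) →
        (∀ t : ℝ, 0 < t → dataSize σ₂ k₀ p₀ φ₂ t + dataGap σ₂ k₀ p₀ ω₂ φ₂ δ₀₂ t ≤
          ENNReal.ofReal C₂) →
        ∃ δ₁ δ₂ : ℝ, 0 < δ₁ ∧ 0 < δ₂ ∧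
          ConvergesAtRate ((2 + γ) / (α - 1)) k p δ₁ (fun t x => (u t x).re) u₁S ∧
          ConvergesAtRate σ₂ k₀ p₀ δ₂ (fun t x => (u t x).im) z₂) ∧
    -- "modified linear" - nonlinear behavior
    ((2 + γ) / (α - 1) = σ₂ → σ₂ < σ₁ → SecondaryPair d γ α k p σ₁ k₀ p₀ →
      ∃ ε : ℝ, 0 < ε ∧ ∀ ω₁ ω₂ : E d → ℝ, IsAngular ω₁ → IsAngular ω₂ →
        eLpNorm ω₁ ⊤ volume ≤ ENNReal.ofReal ε → eLpNorm ω₂ ⊤ volume ≤ ENNReal.ofReal ε →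
        ∀ φ φ₁ φ₂ : 𝓢'(E d, ℂ), IsRealDist φ₁ → IsRealDist φ₂ → φ = φ₁ + Complex.I • φ₂ →
        φ ≠ 0 → katoNorm ((2 + γ) / (α - 1)) k p (heatDist φ) ≤ ENNReal.ofReal ε →
        ∀ u : ℝ → E d → ℂ, IsSmallSolution a γ α k p (heatDist φ) u →
        ∀ w₁ u₂S : ℝ → E d → ℝ, IsSelfSimilarSolution a γ α k p ω₂ u₂S →
        IsModifiedLinearSolution a γ α σ₁ k₀ p₀ ω₁ u₂S w₁ →
        ∀ C₁ C₂ δ₀₁ δ₀₂ : ℝ, 0 < C₁ → 0 < C₂ → 0 < δ₀₁ → 0 < δ₀₂ →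
        (∀ t : ℝ, 0 < t → dataSize σ₁ k₀ p₀ φ₁ t + dataGap σ₁ k₀ p₀ ω₁ φ₁ δ₀₁ t ≤
          ENNReal.ofReal C₁) →
        (∀ t : ℝ, 0 < t → dataGap σ₂ k p ω₂ φ₂ δ₀₂ t ≤ ENNReal.ofReal C₂) →
        ∃ δ₁ δ₂ : ℝ, 0 < δ₁ ∧ 0 < δ₂ ∧
          ConvergesAtRate σ₁ k₀ p₀ δ₁ (fun t x => (u t x).re) w₁ ∧
          ConvergesAtRate ((2 + γ) / (α - 1)) k p δ₂ (fun t x => (u t x).im) u₂S) := by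
  have hd' : (0 : ℝ) < d := by exact_mod_cast hd
  have hγ2 : -2 < γ := lt_of_le_of_lt (neg_le_neg (min_le_left _ _)) hγ
  have hα1 : 1 < α := by
    have : 0 ≤ (2 + γ) / d := div_nonneg (by linarith) hd'.le
    linarith
  have hA := hkp.bounds hd hα1
  have hp := hkp.ne_zero
  constructor
  · intro hs hlt hsec
    have hB := hsec.bounds hd
    have hp₀ := hsec.ne_zero
    subst hs
    -- The real part is slow and the imaginary part fast.
    obtain ⟨ε, hε, H⟩ := convergence_of_components hd ha hα1 hp hp₀ rfl hA.1 hA.2.1 hA.2.2.1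
      hA.2.2.2.1 hA.2.2.2.2.1 hA.2.2.2.2.2 hB.1 hB.2.1 hB.2.2.1 hB.2.2.2 hlt hσ₂.2
      (P := Complex.reCLM) (Q := Complex.imCLM) Complex.abs_re_le_norm Complex.abs_im_le_norm
      Complex.norm_le_abs_re_add_abs_im
    refine ⟨ε, hε, ?_⟩
    intro ω₁ ω₂ hω₁ hω₂ hω₁ε _ φ φ₁ φ₂ hφ₁ hφ₂ hφ _ hφε u hu U z hU hz C₁ C₂ δ₀₁ δ₀₂ hC₁ hC₂ hδ₁ hδ₂
      hg₁ hg₂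
    refine H ω₁ ω₂ hω₁ hω₂ hω₁ε _ (isHeatFlow_heatDist φ) hφε u hu U z hU hz C₁ C₂ δ₀₁ δ₀₂ hC₁ hC₂
      hδ₁ hδ₂ ?_ ?_ ?_
    · refine (katoBound_of_weighted_le hd hC₁ hg₁).mono fun t _ => Eventually.of_forall fun x => ?_
      rw [hφ₁.enorm_sub, hφ, Complex.reCLM_apply, re_heatDist_add hφ₂]
    · have h := katoBound_of_dataSize hd hC₂ fun t ht => le_self_add.trans (hg₂ t ht)
      refine h.mono fun t _ => Eventually.of_forall fun x => ?_
      rw [hφ₂.enorm_heatDist, hφ, Complex.imCLM_apply, im_heatDist_add hφ₁]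
    · refine (katoBound_of_weighted_le hd hC₂ fun t ht => le_add_self.trans (hg₂ t ht)).mono
        fun t _ => Eventually.of_forall fun x => ?_
      rw [hφ₂.enorm_sub, hφ, Complex.imCLM_apply, im_heatDist_add hφ₁]
  · intro hs hlt hsec
    have hB := hsec.bounds hd
    have hp₀ := hsec.ne_zero
    subst hs
    -- The roles of real and imaginary part are exchanged, and with them the order of the two rates.
    obtain ⟨ε, hε, H⟩ := convergence_of_components hd ha hα1 hp hp₀ rfl hA.1 hA.2.1 hA.2.2.1
      hA.2.2.2.1 hA.2.2.2.2.1 hA.2.2.2.2.2 hB.1 hB.2.1 hB.2.2.1 hB.2.2.2 hlt hσ₁.2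
      (P := Complex.imCLM) (Q := Complex.reCLM) Complex.abs_im_le_norm Complex.abs_re_le_norm
      fun w => (Complex.norm_le_abs_re_add_abs_im w).trans_eq (add_comm _ _)
    refine ⟨ε, hε, ?_⟩
    intro ω₁ ω₂ hω₁ hω₂ _ hω₂ε φ φ₁ φ₂ hφ₁ hφ₂ hφ _ hφε u hu w U hU hw C₁ C₂ δ₀₁ δ₀₂ hC₁ hC₂ hδ₁ hδ₂
      hg₁ hg₂
    obtain ⟨δ₂, δ₁, h2, h1, c2, c1⟩ := H ω₂ ω₁ hω₂ hω₁ hω₂ε _ (isHeatFlow_heatDist φ) hφε u hu U w hU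
      hw C₂ C₁ δ₀₂ δ₀₁ hC₂ hC₁ hδ₂ hδ₁ (by
        refine (katoBound_of_weighted_le hd hC₂ hg₂).mono fun t _ => Eventually.of_forall fun x => ?_
        rw [hφ₂.enorm_sub, hφ, Complex.imCLM_apply, im_heatDist_add hφ₁]) (by
        have h := katoBound_of_dataSize hd hC₁ fun t ht => le_self_add.trans (hg₁ t ht)
        refine h.mono fun t _ => Eventually.of_forall fun x => ?_
        rw [hφ₁.enorm_heatDist, hφ, Complex.reCLM_apply, re_heatDist_add hφ₂]) (by
        refine (katoBound_of_weighted_le hd hC₁ fun t ht => le_add_self.trans (hg₁ t ht)).mono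
          fun t _ => Eventually.of_forall fun x => ?_
        rw [hφ₁.enorm_sub, hφ, Complex.reCLM_apply, re_heatDist_add hφ₂])
    exact ⟨δ₁, δ₂, h1, h2, c1, c2⟩
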